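/- Manifolds are smooth, Hausdorff and second countable, possibly with boundary and possibly non-compact; $\mathrm{Int}(M)$ is the complement of the boundary of $M$, and $\mathrm{Int}(A)$ is the topological interior of a subset $A\subset M$. For $r>0$ let $\mathcal D_r=\{x\in\mathbb R^m:\|x\|<r\}$. Convergence in $C^\infty$ means uniform convergence of all derivatives on compact sets, in charts. Let $M$ be a manifold, $\mathcal K\subset \mathrm{Int}(M)$ compact, and $u_k:S_k\to M$ ($k\in\mathbb N$) smooth maps from manifolds $S_k$ of a common dimension $m$. The sequence $(u_k)$ is *robustly $\mathcal K$-proper* with respect to a compact set $\widetilde{\mathcal K}\subset\mathrm{Int}(M)$ with $\mathcal K\subset\mathrm{Int}(\widetilde{\mathcal K})$ if $u_k^{-1}(\widehat{\mathcal K})\setminus\partial S_k$ is compact for every $k$ and every compact $\widehat{\mathcal K}\subset\widetilde{\mathcal K}$; it is robustly $\mathcal K$-proper if this holds for some such $\widetilde{\mathcal K}$. A single map is robustly $\mathcal K$-proper if the constant sequence is. *Uniformly robust $\mathcal K$-covers* of a sequence $u_k$ of smooth maps, each of which is robustly $\mathcal K$-proper, are smooth maps $\phi_{i,k}:\mathcal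 D_r\to S_k$, $i=1,\dots,n$, with $n$ and $r>0$ independent of $k$, such that $u_k\big(S_k\setminus\bigcup_i\phi_{i,k}(\mathcal D_r)\big)\subset M\setminus\mathcal K$ for all $k$, and such that there are $\epsilon>0$ and a compact $\widetilde{\mathcal K}\subset M$ with $\mathcal K\subset\mathrm{Int}(\widetilde{\mathcal K})$ and $u_k\big(S_k\setminus\bigcup_i\phi_{i,k}(\mathcal D_{r'})\big)\subset M\setminus\widetilde{\mathcal K}$ for all $k$ and all $r'\in(r-\epsilon,r)$. Suppose that $(u_k)$ has uniformly robust $\mathcal K$-covers $\phi_{i,k}:\mathcal D_r\to S_k$, $i=1,\dots,n$, such that for each $i$ the maps $u_k\circ\phi_{i,k}$ converge in $C^\infty(\mathcal D_r,M)$ to an immersion. Then there is a subsequence, still denoted $u_k:S_k\to M$, that robustly $\mathcal K$-converges in $C^\infty$, that is: there are a compact set $\widetilde{\mathcal K}\subset \mathrm{Int}(M)$ with $\mathcal K\subset\mathrm{Int}(\widetilde{\mathcal K})$, with respect to which the subsequence is robustly $\mathcal K$-proper, a compact $m$-dimensional manifold $\widetilde S$ with (possibly empty) boundary, and smooth embeddings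 $\psi_k:\widetilde S\to S_k$ such that $u_k\big(S_k\setminus\psi_k(\widetilde S)\big)\subset M\setminus\widetilde{\mathcal K}$ for every $k$ and $u_k\circ\psi_k$ converges in $C^\infty(\widetilde S,M)$. -/

import Mathlib

open Set Filter Topology Manifold
open scoped ContDiff

namespace KConv

section Models

variable {E H : Type*} [NormedAddCommGroup E] [NormedSpace ℝ E] [TopologicalSpace H]

/-- The model spaces of manifolds with (possibly empty) boundary: the range of the model is the
whole vector space or a closed half-space in it. In particular no corners occur. -/
def IsHalfSpaceModel (I : ModelWithCorners ℝ E H) : Prop :=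
  range I = univ ∨ ∃ l : E →L[ℝ] ℝ, l ≠ 0 ∧ range I = {x | 0 ≤ l x}

end Models

section SmoothConvergence

variable {E H N F G M : Type*}
  [NormedAddCommGroup E] [NormedSpace ℝ E] [TopologicalSpace H]
  [TopologicalSpace N] [ChartedSpace H N]
  [NormedAddCommGroup F] [NormedSpace ℝ F] [TopologicalSpace G]
  [TopologicalSpace M] [ChartedSpace G M]

/-- `f k → g` in `C^∞(U, M)`, for `U` an open subset of the manifold `N`: the limit is smooth and,
for every chart of `N`, every chart of `M`, and every compact set `L ⊆ U` in the domain of the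
first chart that `g` maps into the domain of the second one, `f k` maps `L` into that domain for
all large `k`, and in these charts the derivatives of every order of `f k` converge to those of `g`
uniformly on `L`. (Derivatives are taken within the range of the model, so that they also make
sense at boundary points of `N`.) -/
def SmoothlyConvergesOn (I : ModelWithCorners ℝ E H) (J : ModelWithCorners ℝ F G)
    (U : Set N) (f : ℕ → N → M) (g : N → M) : Prop :=
  ContMDiffOn I J ∞ g U ∧
  ∀ (p : N) (q : M) (L : Set N), IsCompact L → L ⊆ U → L ⊆ (chartAt H p).source →
    MapsTo g L (chartAt G q).source →
    (∀ᶠ k in atTop, MapsTo (f k) L (chartAt G q).source) ∧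
    ∀ j : ℕ, TendstoUniformlyOn
      (fun k => iteratedFDerivWithin ℝ j
        (extChartAt J q ∘ f k ∘ (extChartAt I p).symm) (range I))
      (iteratedFDerivWithin ℝ j (extChartAt J q ∘ g ∘ (extChartAt I p).symm) (range I))
      atTop (extChartAt I p '' L)

/-- A smooth embedding: a smooth immersion that is a homeomorphism onto its image. -/
def IsSmoothEmb (I : ModelWithCorners ℝ E H) (J : ModelWithCorners ℝ F G) (f : N → M) : Prop :=
  ContMDiff I J ∞ f ∧ (∀ x, Function.Injective (mfderiv I J f x)) ∧ IsEmbedding f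

end SmoothConvergence

section Sequences

variable {d m : ℕ} {G M : Type*} [TopologicalSpace G] [TopologicalSpace M] [ChartedSpace G M]
  (J : ModelWithCorners ℝ (EuclideanSpace ℝ (Fin d)) G)
  {H S : ℕ → Type*} [∀ k, TopologicalSpace (H k)] [∀ k, TopologicalSpace (S k)]
  [∀ k, ChartedSpace (H k) (S k)]
  (I : ∀ k, ModelWithCorners ℝ (EuclideanSpace ℝ (Fin m)) (H k))

/-- The sequence `u k : S k → M` is robustly `K`-proper, with witness `Kt`. -/
def RobustlyProperWith (K Kt : Set M) (u : ∀ k, S k → M) : Prop :=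
  IsCompact Kt ∧ Kt ⊆ J.interior M ∧ K ⊆ interior Kt ∧
  ∀ (k : ℕ) (Kh : Set M), IsCompact Kh → Kh ⊆ Kt →
    IsCompact ((u k ⁻¹' Kh) \ (I k).boundary (S k))

/-- The sequence `u k : S k → M` is robustly `K`-proper. -/
def RobustlyProperSeq (K : Set M) (u : ∀ k, S k → M) : Prop :=
  ∃ Kt : Set M, RobustlyProperWith J I K Kt u

/-- A single map is robustly `K`-proper if the constant sequence is. -/
def RobustlyProperMap {H₀ S₀ : Type*} [TopologicalSpace H₀] [TopologicalSpace S₀]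
    [ChartedSpace H₀ S₀] (I₀ : ModelWithCorners ℝ (EuclideanSpace ℝ (Fin m)) H₀)
    (K : Set M) (u : S₀ → M) : Prop :=
  RobustlyProperSeq J (H := fun _ => H₀) (S := fun _ => S₀) (fun _ => I₀) K (fun _ => u)

/-- The smooth maps `φ i k`, `i = 1, …, n`, on the open ball of radius `r` in `ℝ^m` are uniformly
robust `K`-covers of the sequence `u k` of smooth robustly `K`-proper maps. (The values of `φ i k`
outside the ball are irrelevant.) -/
structure IsUniformlyRobustCover (K : Set M) (u : ∀ k, S k → M) (n : ℕ) (r : ℝ)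
    (φ : Fin n → ∀ k, EuclideanSpace ℝ (Fin m) → S k) : Prop where
  smooth : ∀ k, ContMDiff (I k) J ∞ (u k)
  proper : ∀ k, RobustlyProperMap J (I k) K (u k)
  radius_pos : 0 < r
  smooth_cover : ∀ i k, ContMDiffOn (𝓡 m) (I k) ∞ (φ i k) (Metric.ball 0 r)
  covers : ∀ k, MapsTo (u k) (⋃ i, φ i k '' Metric.ball 0 r)ᶜ Kᶜ
  robust : ∃ ε > 0, ∃ Kt : Set M, IsCompact Kt ∧ K ⊆ interior Kt ∧
    ∀ k, ∀ r' ∈ Ioo (r - ε) r, MapsTo (u k) (⋃ i, φ i k '' Metric.ball 0 r')ᶜ Ktᶜ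

/-- The sequence `u k` is uniformly robustly `K`-covered and converges in the smooth `K_loc` sense
to an immersed limit. -/
def KlocConvergesToImmersed (K : Set M) (u : ∀ k, S k → M) : Prop :=
  ∃ (n : ℕ) (r : ℝ) (φ : Fin n → ∀ k, EuclideanSpace ℝ (Fin m) → S k),
    IsUniformlyRobustCover J I K u n r φ ∧
    ∀ i, ∃ v : EuclideanSpace ℝ (Fin m) → M,
      SmoothlyConvergesOn (𝓡 m) J (Metric.ball 0 r) (fun k => u k ∘ φ i k) v ∧
      ∀ x ∈ Metric.ball (0 : EuclideanSpace ℝ (Fin m)) r,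
        Function.Injective (mfderiv (𝓡 m) J v x)

/-- The sequence `u k` is robustly `K`-proper and robustly `K`-converges in `C^∞`: with one compact
set `Kt` for both, there are a compact manifold `St` with (possibly empty) boundary and embeddings
`ψ k : St → S k` such that `u k` maps the complement of the image of `ψ k` into the complement of
`Kt`, and `u k ∘ ψ k` converges in `C^∞(St, M)`. -/
def RobustlyConverges (K : Set M) (u : ∀ k, S k → M) : Prop :=
  ∃ Kt : Set M, RobustlyProperWith J I K Kt u ∧
  ∃ (Ht St : Type) (_ : TopologicalSpace Ht) (_ : TopologicalSpace St) (_ : ChartedSpace Ht St)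
    (It : ModelWithCorners ℝ (EuclideanSpace ℝ (Fin m)) Ht),
    IsHalfSpaceModel It ∧ IsManifold It ∞ St ∧ T2Space St ∧ SecondCountableTopology St ∧
    CompactSpace St ∧
    ∃ ψ : ∀ k, St → S k,
      (∀ k, IsSmoothEmb It (I k) (ψ k)) ∧
      (∀ k, MapsTo (u k) (range (ψ k))ᶜ Ktᶜ) ∧
      ∃ v : St → M, SmoothlyConvergesOn It J univ (fun k => u k ∘ ψ k) v

end Sequences

end KConv

/-! The plan is to compare the maps in a Euclidean space and to identify their domains by projection
along normal directions. On a compact neighbourhood of `K`, take a smooth map from `M` to a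
Euclidean space with injective differential (`exists_contMDiff_injective_mfderiv`). Composed with
it, the limits of the `u k ∘ φ i k` are immersions where they meet that neighbourhood. After
rescaling parameters and target by the same small factor (`exists_scale`), they are `C²`-close to
linear isometries on balls of radius 12. By compactness, finitely many such charts suffice: for
large `k` the images of their unit balls cover the preimage of a compact neighbourhood `Kt` of `K`
(`exists_refinement`). Which of the images of the radius-3 balls meet is one of finitely many
patterns, so it is constant along a subsequence.

The first member `S 0` of the subsequence, with its map `w 0` to the Euclidean space, serves as
reference. The point `φ i 0 p` is sent to `φ i k z`, where `z` is the parameter at which `w k ∘ φ i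
k` meets the affine normal space of `w 0 ∘ φ i 0` at `p` (`normalParam`). Closeness to an isometry
makes `z` exist, be unique in the ball, and depend on `p` smoothly and in a bi-Lipschitz way. The
normal space depends on the point `φ i 0 p` only, not on `i`. Charts whose middle parts meet contain
each other's middle parts (`IsFramedChart.image_subset_image`), and the constant pattern carries
overlaps from `S 0` to `S k` and back. Hence the local recipes agree and define an injective
immersion (`FramedSequence.glue_eq`, `FramedSequence.glue_injective`). Points are always compared
inside one chart, so the map to the Euclidean space need not be injective.

A compact domain with smooth boundary, lying between the images in `S 0` of the closed balls of
radius 3/2 and of the open balls of radius 2, becomes the common manifold (`exists_compact_domain`).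
Its images in `S k` contain those of the unit balls, hence the preimage of `Kt`. Convergence holds
because `z` solves an equation whose data converge with all derivatives (`convC_normalParam`).
Throughout, convergence is expressed as a joint limit in the index and the point (`ConvC`), a form
that is stable under composition. -/

namespace KConv

set_option linter.unusedSectionVars false

/-! ### Joint convergence of derivatives and its calculus. -/

section ContinuousConvergence

variable {ι : Type*} {l : Filter ι} {E F G H : Type}
  [NormedAddCommGroup E] [NormedSpace ℝ E] [NormedAddCommGroup F] [NormedSpace ℝ F]
  [NormedAddCommGroup G] [NormedSpace ℝ G] [NormedAddCommGroup H] [NormedSpace ℝ H]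

theorem eventually_eventually_prod_nhds {X : Type*} [TopologicalSpace X] {x : X}
    {p : ι × X → Prop} (h : ∀ᶠ q in l ×ˢ 𝓝 x, p q) :
    ∀ᶠ q in l ×ˢ 𝓝 x, ∀ᶠ y in 𝓝 q.2, p (q.1, y) := by
  obtain ⟨P, hP, Q, hQ, hPQ⟩ := eventually_prod_iff.1 h
  refine eventually_prod_iff.2 ⟨P, hP, fun y => ∀ᶠ z in 𝓝 y, Q z, hQ.eventually_nhds, ?_⟩
  intro k hk y hy
  exact hy.mono fun z hz => hPQ hk hz

/-- Continuous convergence at the point `x` of the derivatives of order at most `n` of a family of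
functions that are smooth near `x`. -/
structure ConvC (n : ℕ) (l : Filter ι) (f : ι → E → F) (g : E → F) (x : E) : Prop where
  smooth : ∀ᶠ q in l ×ˢ 𝓝 x, ContDiffAt ℝ ∞ (f q.1) q.2
  smooth_limit : ∀ᶠ y in 𝓝 x, ContDiffAt ℝ ∞ g y
  tendsto : ∀ j ≤ n, Tendsto (fun q : ι × E => iteratedFDeriv ℝ j (f q.1) q.2) (l ×ˢ 𝓝 x)
    (𝓝 (iteratedFDeriv ℝ j g x))

namespace ConvC

variable {n : ℕ} {f : ι → E → F} {g : E → F} {x : E}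

theorem mono {k : ℕ} (h : ConvC n l f g x) (hk : k ≤ n) : ConvC k l f g x :=
  ⟨h.smooth, h.smooth_limit, fun j hj => h.tendsto j (hj.trans hk)⟩

theorem congr {f' : ι → E → F} {g' : E → F} (h : ConvC n l f g x)
    (hf : ∀ᶠ q in l ×ˢ 𝓝 x, f' q.1 q.2 = f q.1 q.2) (hg : g' =ᶠ[𝓝 x] g) :
    ConvC n l f' g' x := by
  have hf' : ∀ᶠ q in l ×ˢ 𝓝 x, f' q.1 =ᶠ[𝓝 q.2] f q.1 := eventually_eventually_prod_nhds hf
  refine ⟨?_, (h.smooth_limit.and hg.eventuallyEq_nhds).mono fun y hy => hy.1.congr_of_eventuallyEq hy.2,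
    fun j hj => ?_⟩
  · filter_upwards [hf', h.smooth] with q h1 h2 using h2.congr_of_eventuallyEq h1
  · rw [(hg.iteratedFDeriv ℝ j).eq_of_nhds]
    refine (h.tendsto j hj).congr' ?_
    filter_upwards [hf'] with q h1
    exact (h1.iteratedFDeriv ℝ j).eq_of_nhds.symm

theorem tendsto_zero_iff :
    Tendsto (fun q : ι × E => iteratedFDeriv ℝ 0 (f q.1) q.2) (l ×ˢ 𝓝 x)
      (𝓝 (iteratedFDeriv ℝ 0 g x)) ↔
    Tendsto (fun q : ι × E => f q.1 q.2) (l ×ˢ 𝓝 x) (𝓝 (g x)) := by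
  simp only [iteratedFDeriv_zero_eq_comp, Function.comp_apply]
  exact (continuousMultilinearCurryFin0 ℝ E F).symm.isometry.isEmbedding.tendsto_nhds_iff.symm

theorem apply (h : ConvC n l f g x) :
    Tendsto (fun q : ι × E => f q.1 q.2) (l ×ˢ 𝓝 x) (𝓝 (g x)) :=
  tendsto_zero_iff.1 (h.tendsto 0 (Nat.zero_le _))

theorem of_zero (hf : ∀ᶠ q in l ×ˢ 𝓝 x, ContDiffAt ℝ ∞ (f q.1) q.2) (hg : ∀ᶠ y in 𝓝 x, ContDiffAt ℝ ∞ g y)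
    (h : Tendsto (fun q : ι × E => f q.1 q.2) (l ×ˢ 𝓝 x) (𝓝 (g x))) : ConvC 0 l f g x :=
  ⟨hf, hg, fun j hj => by
    obtain rfl := Nat.le_zero.1 hj
    exact tendsto_zero_iff.2 h⟩

theorem tendsto_succ_iff {j : ℕ} :
    Tendsto (fun q : ι × E => iteratedFDeriv ℝ (j + 1) (f q.1) q.2) (l ×ˢ 𝓝 x)
      (𝓝 (iteratedFDeriv ℝ (j + 1) g x)) ↔
    Tendsto (fun q : ι × E => iteratedFDeriv ℝ j (fderiv ℝ (f q.1)) q.2) (l ×ˢ 𝓝 x)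
      (𝓝 (iteratedFDeriv ℝ j (fderiv ℝ g) x)) := by
  simp only [iteratedFDeriv_succ_eq_comp_right, Function.comp_apply]
  exact (continuousMultilinearCurryRightEquiv' ℝ j E F).symm.isometry.isEmbedding.tendsto_nhds_iff.symm

theorem fderiv (h : ConvC (n + 1) l f g x) :
    ConvC n l (fun k => fderiv ℝ (f k)) (fderiv ℝ g) x :=
  ⟨h.smooth.mono fun _ hq => hq.fderiv_right (by simp), h.smooth_limit.mono fun _ hq => hq.fderiv_right (by simp),
    fun j hj => tendsto_succ_iff.1 (h.tendsto (j + 1) (by omega))⟩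

theorem succ (h : ConvC 0 l f g x)
    (h' : ConvC n l (fun k => _root_.fderiv ℝ (f k)) (_root_.fderiv ℝ g) x) :
    ConvC (n + 1) l f g x := by
  refine ⟨h.smooth, h.smooth_limit, fun j hj => ?_⟩
  rcases j with _ | j
  · exact h.tendsto 0 le_rfl
  · exact tendsto_succ_iff.2 (h'.tendsto j (by omega))

theorem const (hg : ∀ᶠ y in 𝓝 x, ContDiffAt ℝ ∞ g y) : ConvC n l (fun _ => g) g x := by
  refine ⟨?_, hg, fun j _ => ?_⟩
  · exact tendsto_snd.eventually hg
  · have : ContinuousAt (iteratedFDeriv ℝ j g) x :=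
      (hg.self_of_nhds.iteratedFDeriv_right (m := 0) (i := j) (by exact_mod_cast le_top)).continuousAt
    exact this.tendsto.comp tendsto_snd

theorem add {f₁ f₂ : ι → E → F} {g₁ g₂ : E → F} (h₁ : ConvC n l f₁ g₁ x)
    (h₂ : ConvC n l f₂ g₂ x) :
    ConvC n l (fun k y => f₁ k y + f₂ k y) (fun y => g₁ y + g₂ y) x := by
  refine ⟨?_, (h₁.smooth_limit.and h₂.smooth_limit).mono fun _ hy => hy.1.add hy.2, fun j hj => ?_⟩
  · filter_upwards [h₁.smooth, h₂.smooth] with q a b using a.add b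
  · have e : ∀ {u v : E → F} {y : E}, ContDiffAt ℝ ∞ u y → ContDiffAt ℝ ∞ v y →
        iteratedFDeriv ℝ j (fun y => u y + v y) y
          = iteratedFDeriv ℝ j u y + iteratedFDeriv ℝ j v y := fun hu hv =>
      iteratedFDeriv_add_apply (hu.of_le (by exact_mod_cast le_top))
        (hv.of_le (by exact_mod_cast le_top))
    rw [e h₁.smooth_limit.self_of_nhds h₂.smooth_limit.self_of_nhds]
    refine ((h₁.tendsto j hj).add (h₂.tendsto j hj)).congr' ?_
    filter_upwards [h₁.smooth, h₂.smooth] with q a b using (e a b).symm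

theorem clm (L : F →L[ℝ] G) (h : ConvC n l f g x) :
    ConvC n l (fun k y => L (f k y)) (fun y => L (g y)) x := by
  refine ⟨h.smooth.mono fun q hq => L.contDiff.contDiffAt.comp _ hq,
    h.smooth_limit.mono fun q hq => L.contDiff.contDiffAt.comp _ hq, fun j hj => ?_⟩
  have e : ∀ {u : E → F} {y : E}, ContDiffAt ℝ ∞ u y →
      iteratedFDeriv ℝ j (fun y => L (u y)) y
        = L.compContinuousMultilinearMap (iteratedFDeriv ℝ j u y) := fun hu =>
    L.iteratedFDeriv_comp_left hu (by exact_mod_cast le_top)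
  rw [e h.smooth_limit.self_of_nhds]
  refine (((ContinuousLinearMap.compContinuousMultilinearMapL ℝ (fun _ : Fin j => E) F G
    L).continuous.tendsto _).comp (h.tendsto j hj)).congr' ?_
  filter_upwards [h.smooth] with q a using (e a).symm

theorem neg (h : ConvC n l f g x) : ConvC n l (fun k y => -f k y) (fun y => -g y) x := by
  simpa using h.clm (-ContinuousLinearMap.id ℝ F)

theorem sub {f₁ f₂ : ι → E → F} {g₁ g₂ : E → F} (h₁ : ConvC n l f₁ g₁ x)
    (h₂ : ConvC n l f₂ g₂ x) :
    ConvC n l (fun k y => f₁ k y - f₂ k y) (fun y => g₁ y - g₂ y) x := by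
  simpa [sub_eq_add_neg] using h₁.add h₂.neg

/-- Induction on the order through the product rule, which expresses the derivative by two bilinear
terms of lower order. These take values in operator spaces, so the spaces must vary within the
induction. -/
theorem bilin {n : ℕ} : ∀ {F G H : Type} [NormedAddCommGroup F] [NormedSpace ℝ F]
    [NormedAddCommGroup G] [NormedSpace ℝ G] [NormedAddCommGroup H] [NormedSpace ℝ H]
    (B : F →L[ℝ] G →L[ℝ] H) {f₁ : ι → E → F} {g₁ : E → F} {f₂ : ι → E → G} {g₂ : E → G}
    (_ : ConvC n l f₁ g₁ x) (_ : ConvC n l f₂ g₂ x),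
    ConvC n l (fun k y => B (f₁ k y) (f₂ k y)) (fun y => B (g₁ y) (g₂ y)) x := by
  induction n with
  | zero =>
    intro F G H _ _ _ _ _ _ B f₁ g₁ f₂ g₂ h₁ h₂
    refine of_zero ?_ ((h₁.smooth_limit.and h₂.smooth_limit).mono fun y hy =>
      B.isBoundedBilinearMap.contDiff.contDiffAt.comp y (hy.1.prodMk hy.2)) ?_
    · filter_upwards [h₁.smooth, h₂.smooth] with q a b using
        B.isBoundedBilinearMap.contDiff.contDiffAt.comp q.2 (a.prodMk b)
    · exact (B.isBoundedBilinearMap.continuous.tendsto (g₁ x, g₂ x)).comp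
        (h₁.apply.prodMk_nhds h₂.apply)
  | succ n ih =>
    intro F G H _ _ _ _ _ _ B f₁ g₁ f₂ g₂ h₁ h₂
    have s₁ := h₁.smooth
    have s₂ := h₂.smooth
    refine succ (of_zero ?_ ((h₁.smooth_limit.and h₂.smooth_limit).mono fun y hy =>
      B.isBoundedBilinearMap.contDiff.contDiffAt.comp y (hy.1.prodMk hy.2)) ?_) ?_
    · filter_upwards [h₁.smooth, h₂.smooth] with q a b using
        B.isBoundedBilinearMap.contDiff.contDiffAt.comp q.2 (a.prodMk b)
    · exact (B.isBoundedBilinearMap.continuous.tendsto (g₁ x, g₂ x)).comp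
        (h₁.apply.prodMk_nhds h₂.apply)
    · have e : ∀ {u : E → F} {v : E → G} {y : E}, ContDiffAt ℝ ∞ u y → ContDiffAt ℝ ∞ v y →
          _root_.fderiv ℝ (fun y => B (u y) (v y)) y
          = B.precompR E (u y) (_root_.fderiv ℝ v y) + B.precompL E (_root_.fderiv ℝ u y) (v y) :=
        fun hu hv => B.fderiv_of_bilinear (hu.differentiableAt (by simp))
          (hv.differentiableAt (by simp))
      refine ((ih (B.precompR E) (h₁.mono (Nat.le_succ n)) h₂.fderiv).add
        (ih (B.precompL E) h₁.fderiv (h₂.mono (Nat.le_succ n)))).congr ?_ ?_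
      · filter_upwards [s₁, s₂] with q a b using e a b
      · filter_upwards [h₁.smooth_limit, h₂.smooth_limit] with y a b using e a b

theorem tendsto_prodMk (h : ConvC n l f g x) :
    Tendsto (fun q : ι × E => (q.1, f q.1 q.2)) (l ×ˢ 𝓝 x) (l ×ˢ 𝓝 (g x)) :=
  tendsto_fst.prodMk h.apply

/-- The chain rule writes the derivative as a bilinear composition of families already known to
converge to order `n`. Evaluating `a k` at the moving point `f k y` is legitimate because limits are
joint in the index and the point. -/
theorem comp {n : ℕ} : ∀ {G : Type} [NormedAddCommGroup G] [NormedSpace ℝ G]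
    {a : ι → F → G} {b : F → G} {f : ι → E → F} {g : E → F}
    (_ : ConvC n l a b (g x)) (_ : ConvC n l f g x),
    ConvC n l (fun k y => a k (f k y)) (fun y => b (g y)) x := by
  induction n with
  | zero =>
    intro G _ _ a b f g ha hf
    refine of_zero ?_ ((hf.smooth_limit.and (hf.smooth_limit.self_of_nhds.continuousAt.eventually
      ha.smooth_limit)).mono fun y hy => hy.2.comp y hy.1) ?_
    · filter_upwards [hf.tendsto_prodMk.eventually ha.smooth, hf.smooth] with q h1 h2 using
        h1.comp q.2 h2
    · exact ha.apply.comp hf.tendsto_prodMk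
  | succ n ih =>
    intro G _ _ a b f g ha hf
    have sm : ∀ᶠ q in l ×ˢ 𝓝 x, ContDiffAt ℝ ∞ (a q.1) (f q.1 q.2) :=
      hf.tendsto_prodMk.eventually ha.smooth
    have sl := hf.smooth_limit.self_of_nhds.continuousAt.eventually ha.smooth_limit
    refine succ (of_zero ?_ ((hf.smooth_limit.and (hf.smooth_limit.self_of_nhds.continuousAt.eventually
      ha.smooth_limit)).mono fun y hy => hy.2.comp y hy.1) ?_) ?_
    · filter_upwards [sm, hf.smooth] with q h1 h2 using h1.comp q.2 h2
    · exact ha.apply.comp hf.tendsto_prodMk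
    · have e : ∀ {u : E → F} {v : F → G} {y : E}, ContDiffAt ℝ ∞ u y → ContDiffAt ℝ ∞ v (u y) →
          _root_.fderiv ℝ (fun y => v (u y)) y
          = ContinuousLinearMap.compL ℝ E F G (_root_.fderiv ℝ v (u y)) (_root_.fderiv ℝ u y) :=
        fun hu hv => fderiv_comp _ (hv.differentiableAt (by simp)) (hu.differentiableAt (by simp))
      refine (bilin (ContinuousLinearMap.compL ℝ E F G)
        (ih ha.fderiv (hf.mono (Nat.le_succ n))) hf.fderiv).congr ?_ ?_
      · filter_upwards [sm, hf.smooth] with q h1 h2 using e h2 h1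
      · filter_upwards [hf.smooth_limit, sl] with y h1 h2 using e h1 h2

theorem comp_left {b : F → G} (hb : ∀ᶠ z in 𝓝 (g x), ContDiffAt ℝ ∞ b z) (hf : ConvC n l f g x) :
    ConvC n l (fun k y => b (f k y)) (fun y => b (g y)) x :=
  comp (const hb) hf

theorem comp_right {a : ι → F → G} {b : F → G} (ha : ConvC n l a b (g x))
    (hg : ∀ᶠ y in 𝓝 x, ContDiffAt ℝ ∞ g y) : ConvC n l (fun k y => a k (g y)) (fun y => b (g y)) x :=
  comp ha (const hg)

end ConvC

/-- A joint eventuality is uniform on a neighbourhood of each point, and finitely many such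
neighbourhoods cover `L`. -/
theorem eventually_forall_mem_of_isCompact {X : Type*} [TopologicalSpace X] {L : Set X}
    (hL : IsCompact L) {p : ι → X → Prop} (h : ∀ x ∈ L, ∀ᶠ q in l ×ˢ 𝓝 x, p q.1 q.2) :
    ∀ᶠ k in l, ∀ x ∈ L, p k x := by
  refine hL.induction_on (p := fun s => ∀ᶠ k in l, ∀ x ∈ s, p k x) (by simp)
    (fun s t hst ht => ht.mono fun k hk x hx => hk x (hst hx))
    (fun s t hs ht => by
      filter_upwards [hs, ht] with k h1 h2 x hx
      exact hx.elim (h1 x) (h2 x)) ?_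
  intro x hx
  obtain ⟨P, hP, Q, hQ, hPQ⟩ := eventually_prod_iff.1 (h x hx)
  exact ⟨{y | Q y}, mem_nhdsWithin_of_mem_nhds hQ, hP.mono fun k hk y hy => hPQ hk hy⟩

end ContinuousConvergence

/-! ### Normal projection between two nearly isometric maps. -/

section NormalProjection

open Metric ContinuousLinearMap

variable {E V : Type} [NormedAddCommGroup E] [InnerProductSpace ℝ E] [FiniteDimensional ℝ E]
  [NormedAddCommGroup V] [InnerProductSpace ℝ V] [FiniteDimensional ℝ V]

/-- A smooth map on the ball of radius `R` that is `C²`-close to the linear isometry `A`. -/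
structure NearIsometry (A : E →ₗᵢ[ℝ] V) (R : ℝ) (f : E → V) : Prop where
  smooth : ∀ z ∈ ball (0 : E) R, ContDiffAt ℝ ∞ f z
  near : ∀ z ∈ ball (0 : E) R, ‖fderiv ℝ f z - A.toContinuousLinearMap‖ ≤ 1 / 100
  lip : ∀ z ∈ ball (0 : E) R, ∀ z' ∈ ball (0 : E) R,
    ‖fderiv ℝ f z - fderiv ℝ f z'‖ ≤ 1 / 100 * ‖z - z'‖

theorem adjoint_isometry_apply (A : E →ₗᵢ[ℝ] V) (h : E) :
    adjoint A.toContinuousLinearMap (A h) = h := by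
  refine ext_inner_right ℝ fun y => ?_
  rw [adjoint_inner_left]
  exact A.inner_map_map h y

theorem norm_adjoint_isometry_apply_le (A : E →ₗᵢ[ℝ] V) (v : V) :
    ‖adjoint A.toContinuousLinearMap v‖ ≤ ‖v‖ := by
  refine (le_opNorm _ _).trans ?_
  rw [LinearIsometryEquiv.norm_map]
  have := A.norm_toContinuousLinearMap_le
  nlinarith [norm_nonneg v]

namespace NearIsometry

variable {A : E →ₗᵢ[ℝ] V} {R : ℝ} {f₀ f : E → V} {p p' z z' : E}

theorem norm_sub_sub_le (hf : NearIsometry A R f) (hz : z ∈ ball 0 R) (hz' : z' ∈ ball 0 R) :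
    ‖f z - f z' - A (z - z')‖ ≤ 1 / 100 * ‖z - z'‖ :=
  (convex_ball (0 : E) R).norm_image_sub_le_of_norm_hasFDerivWithin_le' (φ := A.toContinuousLinearMap)
    (fun x hx => ((hf.smooth x hx).differentiableAt (by simp)).hasFDerivAt.hasFDerivWithinAt)
    (fun x hx => hf.near x hx) hz' hz

theorem norm_sub_le (hf : NearIsometry A R f) (hz : z ∈ ball 0 R) (hz' : z' ∈ ball 0 R) :
    ‖f z - f z'‖ ≤ 101 / 100 * ‖z - z'‖ := by
  have h1 := hf.norm_sub_sub_le hz hz'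
  have h2 := norm_le_norm_add_norm_sub' (f z - f z') (A (z - z'))
  rw [A.norm_map] at h2
  linarith

theorem le_norm_sub (hf : NearIsometry A R f) (hz : z ∈ ball 0 R) (hz' : z' ∈ ball 0 R) :
    99 / 100 * ‖z - z'‖ ≤ ‖f z - f z'‖ := by
  have h1 := hf.norm_sub_sub_le hz hz'
  have h2 := norm_le_norm_add_norm_sub (f z - f z') (A (z - z'))
  rw [A.norm_map] at h2
  linarith

theorem injOn (hf : NearIsometry A R f) : InjOn f (ball 0 R) := by
  intro z hz z' hz' h
  have := hf.le_norm_sub hz hz'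
  rw [h, sub_self, norm_zero] at this
  exact sub_eq_zero.1 (norm_eq_zero.1 (le_antisymm (by linarith) (norm_nonneg _)))

theorem fderiv_injective (hf : NearIsometry A R f) (hz : z ∈ ball 0 R) :
    Function.Injective (fderiv ℝ f z) := by
  refine (injective_iff_map_eq_zero _).2 fun h hh => ?_
  have h1 := le_of_opNorm_le _ (hf.near z hz) h
  rw [sub_apply, hh, zero_sub, norm_neg, LinearIsometry.coe_toContinuousLinearMap,
    A.norm_map] at h1
  exact norm_eq_zero.1 (le_antisymm (by linarith) (norm_nonneg _))

theorem norm_adjoint_sub_le (hf : NearIsometry A R f) (hp : p ∈ ball 0 R) (v : V) :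
    ‖adjoint (fderiv ℝ f p) v - adjoint A.toContinuousLinearMap v‖ ≤ 1 / 100 * ‖v‖ := by
  rw [← sub_apply, ← map_sub]
  exact le_of_opNorm_le _ (by rw [LinearIsometryEquiv.norm_map]; exact hf.near p hp) v

theorem norm_adjoint_le (hf : NearIsometry A R f) (hp : p ∈ ball 0 R) (v : V) :
    ‖adjoint (fderiv ℝ f p) v‖ ≤ 101 / 100 * ‖v‖ := by
  have h1 := hf.norm_adjoint_sub_le hp v
  have h2 := norm_adjoint_isometry_apply_le A v
  have h3 := norm_le_norm_add_norm_sub' (adjoint (fderiv ℝ f p) v)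
    (adjoint A.toContinuousLinearMap v)
  linarith

theorem norm_adjoint_sub_adjoint_le (hf : NearIsometry A R f) (hp : p ∈ ball 0 R)
    (hp' : p' ∈ ball 0 R) (v : V) :
    ‖adjoint (fderiv ℝ f p) v - adjoint (fderiv ℝ f p') v‖ ≤ 1 / 100 * ‖p - p'‖ * ‖v‖ := by
  rw [← sub_apply, ← map_sub]
  exact le_of_opNorm_le _ (by rw [LinearIsometryEquiv.norm_map]; exact hf.lip p hp p' hp') v

/-- The adjoint of `A` is a left inverse of `A`, and the adjoint of the differential of `f₀` is
within 1/100 of it. The errors add up to 1.01 · 0.01 + 0.01, which is below 0.03. -/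
theorem norm_adjoint_apply_sub_le (hf₀ : NearIsometry A R f₀) (hp : p ∈ ball 0 R) {v : V} {h : E}
    (hv : ‖v - A h‖ ≤ 1 / 100 * ‖h‖) :
    ‖adjoint (fderiv ℝ f₀ p) v - h‖ ≤ 3 / 100 * ‖h‖ := by
  have e : adjoint (fderiv ℝ f₀ p) v - h
      = adjoint (fderiv ℝ f₀ p) (v - A h)
        + (adjoint (fderiv ℝ f₀ p) (A h) - adjoint A.toContinuousLinearMap (A h)) := by
    rw [adjoint_isometry_apply, map_sub]; abel
  rw [e]
  have h1 := hf₀.norm_adjoint_le hp (v - A h)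
  have h2 := hf₀.norm_adjoint_sub_le hp (A h)
  rw [A.norm_map] at h2
  have h3 := norm_add_le (adjoint (fderiv ℝ f₀ p) (v - A h))
    (adjoint (fderiv ℝ f₀ p) (A h) - adjoint A.toContinuousLinearMap (A h))
  nlinarith [norm_nonneg h]

theorem norm_adjoint_image_sub_le (hf₀ : NearIsometry A R f₀) (hf : NearIsometry A R f)
    (hp : p ∈ ball 0 R) (hz : z ∈ ball 0 R) (hz' : z' ∈ ball 0 R) :
    ‖adjoint (fderiv ℝ f₀ p) (f z - f z') - (z - z')‖ ≤ 3 / 100 * ‖z - z'‖ :=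
  hf₀.norm_adjoint_apply_sub_le hp (hf.norm_sub_sub_le hz hz')

theorem isInvertible_adjoint_comp (hf₀ : NearIsometry A R f₀) (hf : NearIsometry A R f)
    (hp : p ∈ ball 0 R) (hz : z ∈ ball 0 R) :
    (adjoint (fderiv ℝ f₀ p) ∘L fderiv ℝ f z).IsInvertible := by
  have hinj : Function.Injective (adjoint (fderiv ℝ f₀ p) ∘L fderiv ℝ f z) := by
    refine (injective_iff_map_eq_zero _).2 fun h hh => ?_
    have h1 := hf₀.norm_adjoint_apply_sub_le hp (v := fderiv ℝ f z h) (h := h)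
      (by simpa using! le_of_opNorm_le _ (hf.near z hz) h)
    rw [coe_comp, Function.comp_apply] at hh
    rw [hh, zero_sub, norm_neg] at h1
    exact norm_eq_zero.1 (le_antisymm (by linarith) (norm_nonneg _))
  exact ⟨(LinearEquiv.ofInjectiveEndo _ hinj).toContinuousLinearEquiv, by ext; rfl⟩

end NearIsometry

/-- The component of `f z - f₀ p` tangent to `f₀` at `p`. -/
noncomputable def tangentDefect (f₀ f : E → V) (p z : E) : E :=
  adjoint (fderiv ℝ f₀ p) (f z - f₀ p)

open Classical in
/-- The parameter at which `f` meets the normal space of `f₀` at `p`. -/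
noncomputable def normalParam (R : ℝ) (f₀ f : E → V) (p : E) : E :=
  if h : ∃ z ∈ ball (0 : E) R, tangentDefect f₀ f p z = 0 then h.choose else 0

/-- Two maps that are near the same isometry and near each other. -/
structure NearPair (A : E →ₗᵢ[ℝ] V) (R : ℝ) (f₀ f : E → V) : Prop where
  left : NearIsometry A R f₀
  right : NearIsometry A R f
  close : ∀ z ∈ ball (0 : E) R, ‖f z - f₀ z‖ ≤ 1 / 100

namespace NearPair

variable {A : E →ₗᵢ[ℝ] V} {R : ℝ} {f₀ f : E → V} {p p' z z' : E}

theorem norm_tangentDefect_self (h : NearPair A R f₀ f) (hp : p ∈ ball 0 R) :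
    ‖tangentDefect f₀ f p p‖ ≤ 2 / 100 := by
  have h1 := h.left.norm_adjoint_le hp (f p - f₀ p)
  have h2 := h.close p hp
  rw [tangentDefect]; linarith

theorem tangentDefect_unique (h : NearPair A R f₀ f) (hp : p ∈ ball 0 R) (hz : z ∈ ball 0 R)
    (hz' : z' ∈ ball 0 R) (e : tangentDefect f₀ f p z = tangentDefect f₀ f p z') : z = z' := by
  have h1 := h.left.norm_adjoint_image_sub_le h.right hp hz hz'
  have h2 : adjoint (fderiv ℝ f₀ p) (f z - f z') = 0 := by
    have : f z - f z' = (f z - f₀ p) - (f z' - f₀ p) := by abel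
    rw [this, map_sub]; exact sub_eq_zero.2 e
  rw [h2, zero_sub, norm_neg] at h1
  exact sub_eq_zero.1 (norm_eq_zero.1 (le_antisymm (by linarith) (norm_nonneg _)))

theorem closedBall_subset {s : ℝ} (hp : p ∈ ball (0 : E) (R - s)) :
    closedBall p s ⊆ ball 0 R := by
  intro y hy
  have h1 : dist y 0 ≤ dist y p + dist p 0 := dist_triangle _ _ _
  rw [mem_closedBall] at hy
  rw [mem_ball] at hp ⊢
  linarith

/-- As a function of `z` the defect is a 3/100-Lipschitz perturbation of the identity, and its value
at `p` is at most 2/100. The quantitative inverse function theorem reaches 0 within distance 1/2. -/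
theorem exists_tangentDefect_eq_zero (h : NearPair A R f₀ f) (hp : p ∈ ball 0 (R - 1 / 2)) :
    ∃ z ∈ closedBall p (1 / 2), tangentDefect f₀ f p z = 0 := by
  have hpR : p ∈ ball (0 : E) R := closedBall_subset hp (mem_closedBall_self (by norm_num))
  have key : ApproximatesLinearOn (tangentDefect f₀ f p)
      ((ContinuousLinearEquiv.refl ℝ E : E ≃L[ℝ] E) : E →L[ℝ] E) (closedBall p (1 / 2))
      (3 / 100) := by
    intro z hz z' hz'
    have := h.left.norm_adjoint_image_sub_le h.right hpR (closedBall_subset hp hz)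
      (closedBall_subset hp hz')
    have e : tangentDefect f₀ f p z - tangentDefect f₀ f p z'
        = adjoint (fderiv ℝ f₀ p) (f z - f z') := by
      rw [tangentDefect, tangentDefect, ← map_sub]; congr 1; abel
    rw [e]; simpa using! this
  have hs := key.surjOn_closedBall_of_nonlinearRightInverse
    (⟨id, 1, fun y => by simp, fun y => by simp⟩ :
      (((ContinuousLinearEquiv.refl ℝ E : E ≃L[ℝ] E) : E →L[ℝ] E)).NonlinearRightInverse)
    (ε := 1 / 2) (b := p) (by norm_num) Subset.rfl
  obtain ⟨z, hz, e⟩ := hs (show (0 : E) ∈ _ by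
    rw [mem_closedBall, dist_comm, dist_zero_right]
    refine (h.norm_tangentDefect_self hpR).trans ?_
    norm_num)
  exact ⟨z, hz, e⟩

/-- The same argument with the base point varying, which later shows that the normal projection
covers smaller balls. The normal space now turns with `p`; the Lipschitz bound on the differential
of `f₀` controls this. -/
theorem exists_tangentDefect_eq_zero_left (h : NearPair A R f₀ f) (hz : z ∈ ball 0 (R - 1 / 2)) :
    ∃ p ∈ closedBall z (1 / 2), tangentDefect f₀ f p z = 0 := by
  have hzR : z ∈ ball (0 : E) R := closedBall_subset hz (mem_closedBall_self (by norm_num))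
  have key : ApproximatesLinearOn (fun p => -tangentDefect f₀ f p z)
      ((ContinuousLinearEquiv.refl ℝ E : E ≃L[ℝ] E) : E →L[ℝ] E) (closedBall z (1 / 2))
      (4 / 100) := by
    intro p hp p' hp'
    have hpR := closedBall_subset hz hp
    have hpR' := closedBall_subset hz hp'
    have h1 := h.left.norm_adjoint_image_sub_le h.left hpR hpR hpR'
    have h2 := h.left.norm_adjoint_sub_adjoint_le hpR' hpR (f z - f₀ p')
    have h3 : ‖f z - f₀ p'‖ ≤ 1 := by
      have a := h.right.norm_sub_le hzR hpR'
      have b := h.close p' hpR'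
      have c : ‖z - p'‖ ≤ 1 / 2 := by
        rw [← dist_eq_norm, dist_comm]; exact hp'
      have d := norm_add_le (f z - f p') (f p' - f₀ p')
      rw [sub_add_sub_cancel] at d
      linarith
    -- One term is the projected increment of `f₀`, the other the turning of the tangent space
    -- applied to a vector of length at most 1.
    have e : -tangentDefect f₀ f p z - -tangentDefect f₀ f p' z - (p - p')
        = (adjoint (fderiv ℝ f₀ p) (f₀ p - f₀ p') - (p - p'))
          + (adjoint (fderiv ℝ f₀ p') (f z - f₀ p') - adjoint (fderiv ℝ f₀ p) (f z - f₀ p')) := by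
      have : f₀ p - f₀ p' = (f z - f₀ p') - (f z - f₀ p) := by abel
      rw [tangentDefect, tangentDefect, this]; simp only [map_sub]; abel
    have h4 := norm_add_le (adjoint (fderiv ℝ f₀ p) (f₀ p - f₀ p') - (p - p'))
      (adjoint (fderiv ℝ f₀ p') (f z - f₀ p') - adjoint (fderiv ℝ f₀ p) (f z - f₀ p'))
    rw [← e, norm_sub_rev p' p] at *
    have : 1 / 100 * ‖p - p'‖ * ‖f z - f₀ p'‖ ≤ 1 / 100 * ‖p - p'‖ :=
      mul_le_of_le_one_right (by positivity) h3
    simp only [ContinuousLinearEquiv.coe_refl, coe_id', id_eq]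
    refine h4.trans ((add_le_add h1 (h2.trans this)).trans (le_of_eq ?_))
    push_cast; ring
  have hs := key.surjOn_closedBall_of_nonlinearRightInverse
    (⟨id, 1, fun y => by simp, fun y => by simp⟩ :
      (((ContinuousLinearEquiv.refl ℝ E : E ≃L[ℝ] E) : E →L[ℝ] E)).NonlinearRightInverse)
    (ε := 1 / 2) (b := z) (by norm_num) Subset.rfl
  obtain ⟨p, hp, e⟩ := hs (show (0 : E) ∈ _ by
    rw [mem_closedBall, dist_comm, dist_zero_right, norm_neg]
    refine (h.norm_tangentDefect_self hzR).trans ?_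
    norm_num)
  exact ⟨p, hp, neg_eq_zero.1 e⟩

theorem normalParam_spec (h : NearPair A R f₀ f) (hp : p ∈ ball 0 (R - 1 / 2)) :
    normalParam R f₀ f p ∈ closedBall p (1 / 2) ∧
      tangentDefect f₀ f p (normalParam R f₀ f p) = 0 := by
  have hpR : p ∈ ball (0 : E) R := closedBall_subset hp (mem_closedBall_self (by norm_num))
  obtain ⟨z, hz, e⟩ := h.exists_tangentDefect_eq_zero hp
  have hex : ∃ z ∈ ball (0 : E) R, tangentDefect f₀ f p z = 0 := ⟨z, closedBall_subset hp hz, e⟩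
  have h1 : normalParam R f₀ f p = hex.choose := by rw [normalParam, dif_pos hex]
  have h2 := hex.choose_spec
  rw [← h1] at h2
  exact ⟨(h.tangentDefect_unique hpR h2.1 (closedBall_subset hp hz) (h2.2.trans e.symm)) ▸ hz, h2.2⟩

theorem normalParam_mem (h : NearPair A R f₀ f) (hp : p ∈ ball 0 (R - 1 / 2)) :
    normalParam R f₀ f p ∈ ball 0 R :=
  closedBall_subset hp (h.normalParam_spec hp).1

theorem eq_normalParam (h : NearPair A R f₀ f) (hp : p ∈ ball 0 (R - 1 / 2)) (hz : z ∈ ball 0 R)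
    (e : tangentDefect f₀ f p z = 0) : z = normalParam R f₀ f p :=
  h.tangentDefect_unique (closedBall_subset hp (mem_closedBall_self (by norm_num))) hz
    (h.normalParam_mem hp) (e.trans (h.normalParam_spec hp).2.symm)

theorem exists_normalParam_eq (h : NearPair A R f₀ f) (hz : z ∈ ball 0 (R - 1)) :
    ∃ p ∈ closedBall z (1 / 2), normalParam R f₀ f p = z := by
  have hz1 : z ∈ ball (0 : E) (R - 1 / 2) := ball_subset_ball (by linarith) hz
  obtain ⟨p, hp, e⟩ := h.exists_tangentDefect_eq_zero_left hz1
  have : p ∈ ball (0 : E) (R - 1 / 2) :=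
    closedBall_subset (s := 1 / 2) (by rwa [sub_sub, add_halves]) hp
  exact ⟨p, hp, (h.eq_normalParam this (closedBall_subset hz1 (mem_closedBall_self (by norm_num)))
    e).symm⟩

/-- Subtracting the two defining equations bounds `(z - z') - (p - p')` by `3/100 * ‖z - z'‖ + 4/100
* ‖p - p'‖`. One inequality yields continuity, the other injectivity of the map and of its
differential. -/
theorem normalParam_bounds (h : NearPair A R f₀ f) (hp : p ∈ ball 0 (R - 1 / 2))
    (hp' : p' ∈ ball 0 (R - 1 / 2)) :
    ‖p - p'‖ ≤ 2 * ‖normalParam R f₀ f p - normalParam R f₀ f p'‖ ∧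
    ‖normalParam R f₀ f p - normalParam R f₀ f p'‖ ≤ 2 * ‖p - p'‖ := by
  have hpR : p ∈ ball (0 : E) R := closedBall_subset hp (mem_closedBall_self (by norm_num))
  have hpR' : p' ∈ ball (0 : E) R := closedBall_subset hp' (mem_closedBall_self (by norm_num))
  have hzR := h.normalParam_mem hp
  have hzR' := h.normalParam_mem hp'
  obtain ⟨-, e1⟩ := h.normalParam_spec hp
  obtain ⟨hz2, e2⟩ := h.normalParam_spec hp'
  set z := normalParam R f₀ f p
  set z' := normalParam R f₀ f p'
  have h1 := h.left.norm_adjoint_image_sub_le h.right hpR hzR hzR'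
  have h2 := h.left.norm_adjoint_image_sub_le h.left hpR hpR hpR'
  have h3 := h.left.norm_adjoint_sub_adjoint_le hpR hpR' (f z' - f₀ p')
  have h4 : ‖f z' - f₀ p'‖ ≤ 1 := by
    have a := h.right.norm_sub_le hzR' hpR'
    have b := h.close p' hpR'
    have c : ‖z' - p'‖ ≤ 1 / 2 := by rw [← dist_eq_norm]; exact hz2
    have d := norm_add_le (f z' - f p') (f p' - f₀ p')
    rw [sub_add_sub_cancel] at d
    linarith
  have h5 : 1 / 100 * ‖p - p'‖ * ‖f z' - f₀ p'‖ ≤ 1 / 100 * ‖p - p'‖ :=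
    mul_le_of_le_one_right (by positivity) h4
  set T := adjoint (fderiv ℝ f₀ p)
  set T' := adjoint (fderiv ℝ f₀ p')
  have e : (z - z') - (p - p') = -(T (f z - f z') - (z - z')) + (T (f₀ p - f₀ p') - (p - p'))
      - (T (f z' - f₀ p') - T' (f z' - f₀ p')) := by
    have e1' : T (f z - f₀ p) = 0 := e1
    have e2' : T' (f z' - f₀ p') = 0 := e2
    rw [map_sub] at e1'
    rw [e2']
    simp only [map_sub]
    have : T (f z) = T (f₀ p) := sub_eq_zero.1 e1'
    rw [this]; abel
  have h6 : ‖(z - z') - (p - p')‖ ≤ 3 / 100 * ‖z - z'‖ + 3 / 100 * ‖p - p'‖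
      + 1 / 100 * ‖p - p'‖ := by
    rw [e]
    refine (_root_.norm_sub_le _ _).trans (add_le_add ((norm_add_le _ _).trans
      (add_le_add ?_ h2)) (h3.trans h5))
    rwa [norm_neg]
  have h7 := norm_le_norm_add_norm_sub' (z - z') (p - p')
  have h8 := norm_le_norm_add_norm_sub (z - z') (p - p')
  constructor <;> nlinarith [norm_nonneg (z - z'), norm_nonneg (p - p')]

theorem normalParam_injOn (h : NearPair A R f₀ f) :
    InjOn (normalParam R f₀ f) (ball 0 (R - 1 / 2)) := by
  intro p hp p' hp' e
  have := (h.normalParam_bounds hp hp').1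
  rw [e, sub_self, norm_zero, mul_zero] at this
  exact sub_eq_zero.1 (norm_eq_zero.1 (le_antisymm this (norm_nonneg _)))

theorem continuousOn_normalParam (h : NearPair A R f₀ f) :
    ContinuousOn (normalParam R f₀ f) (ball 0 (R - 1 / 2)) :=
  (LipschitzOnWith.of_dist_le_mul (K := 2) fun p hp p' hp' => by
    simpa [dist_eq_norm] using (h.normalParam_bounds hp hp').2).continuousOn

theorem contDiffAt_tangentDefect (h : NearPair A R f₀ f) (hp : p ∈ ball 0 R)
    (hz : z ∈ ball 0 R) :
    ContDiffAt ℝ ∞ (fun q : E × E => tangentDefect f₀ f q.1 q.2) (p, z) := by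
  have h1 : ContDiffAt ℝ ∞ (fun q : E × E => adjoint (fderiv ℝ f₀ q.1)) (p, z) := by
    have a : ContDiffAt ℝ ∞ (fderiv ℝ f₀) p := (h.left.smooth p hp).fderiv_right (by simp)
    have b : ContDiffAt ℝ ∞ (fun q : E × E => fderiv ℝ f₀ q.1) (p, z) :=
      ContDiffAt.comp (p, z) (f := Prod.fst) (g := fderiv ℝ f₀) a contDiffAt_fst
    exact (adjoint (𝕜 := ℝ) (E := E) (F := V)).toContinuousLinearEquiv.contDiff.contDiffAt.comp
      _ b
  have h2 : ContDiffAt ℝ ∞ (fun q : E × E => f q.2 - f₀ q.1) (p, z) :=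
    (ContDiffAt.comp (p, z) (f := Prod.snd) (g := f) (h.right.smooth z hz) contDiffAt_snd).sub
      (ContDiffAt.comp (p, z) (f := Prod.fst) (g := f₀) (h.left.smooth p hp) contDiffAt_fst)
  exact h1.clm_apply h2

/-- The implicit function theorem applies because the defect has invertible derivative in `z`.
Continuity places `normalParam` on the branch that the theorem provides. -/
theorem contDiffAt_normalParam (h : NearPair A R f₀ f) (hp : p ∈ ball 0 (R - 1 / 2)) :
    ContDiffAt ℝ ∞ (normalParam R f₀ f) p := by
  have hpR : p ∈ ball (0 : E) R := closedBall_subset hp (mem_closedBall_self (by norm_num))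
  have hzR := h.normalParam_mem hp
  set z := normalParam R f₀ f p with hz
  have hc := h.contDiffAt_tangentDefect hpR hzR
  have hinv : (fderiv ℝ (fun q : E × E => tangentDefect f₀ f q.1 q.2) (p, z) ∘L
      ContinuousLinearMap.inr ℝ E E).IsInvertible := by
    have e : fderiv ℝ (fun q : E × E => tangentDefect f₀ f q.1 q.2) (p, z) ∘L
        ContinuousLinearMap.inr ℝ E E = adjoint (fderiv ℝ f₀ p) ∘L fderiv ℝ f z := by
      have a := (hc.differentiableAt (by simp)).hasFDerivAt.comp z
        (f := fun y : E => (p, y)) (hasFDerivAt_prodMk_right p z)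
      have b : HasFDerivAt (fun y => tangentDefect f₀ f p y)
          (adjoint (fderiv ℝ f₀ p) ∘L fderiv ℝ f z) z :=
        (adjoint (fderiv ℝ f₀ p)).hasFDerivAt.comp z
          (((h.right.smooth z hzR).differentiableAt (by simp)).hasFDerivAt.sub_const _)
      exact a.unique b
    rw [e]
    exact h.left.isInvertible_adjoint_comp h.right hpR hzR
  have h1 := hc.contDiffAt_implicitFunction (by simp) hinv
  refine h1.congr_of_eventuallyEq ?_
  have h2 := hc.eventually_apply_eq_iff_implicitFunction (by simp) hinv
  have hcont : ContinuousAt (normalParam R f₀ f) p :=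
    h.continuousOn_normalParam.continuousAt (isOpen_ball.mem_nhds hp)
  have h3 : Tendsto (fun p' => (p', normalParam R f₀ f p')) (𝓝 p) (𝓝 (p, z)) :=
    tendsto_id.prodMk_nhds hcont
  filter_upwards [h3.eventually h2, isOpen_ball.mem_nhds hp] with p' h4 h5
  refine (h4.1 ?_).symm
  exact (h.normalParam_spec h5).2.trans (h.normalParam_spec hp).2.symm

/-- Along a kernel direction the parameter would move by `o(t)`, against the linear lower bound in
`normalParam_bounds`. -/
theorem fderiv_normalParam_injective (h : NearPair A R f₀ f) (hp : p ∈ ball 0 (R - 1 / 2)) :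
    Function.Injective (fderiv ℝ (normalParam R f₀ f) p) := by
  refine (injective_iff_map_eq_zero _).2 fun v hv => ?_
  have hd : HasFDerivAt (normalParam R f₀ f) (fderiv ℝ (normalParam R f₀ f) p) p :=
    ((h.contDiffAt_normalParam hp).differentiableAt (by simp)).hasFDerivAt
  have h1 : HasDerivAt (fun t : ℝ => normalParam R f₀ f (p + t • v)) 0 0 := by
    have hl : HasDerivAt (fun t : ℝ => p + t • v) v 0 := by
      simpa using ((hasDerivAt_id (0 : ℝ)).smul_const v).const_add p
    have hd' : HasFDerivAt (normalParam R f₀ f) (fderiv ℝ (normalParam R f₀ f) p)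
        (p + (0 : ℝ) • v) := by simpa using hd
    have := hd'.comp_hasDerivAt (0 : ℝ) hl
    rwa [hv] at this
  have h2 := h1.isLittleO
  have h3 : (fun t : ℝ => t • v) =O[𝓝 0] fun t : ℝ => normalParam R f₀ f (p + t • v)
      - normalParam R f₀ f p := by
    refine Asymptotics.IsBigO.of_bound 2 ?_
    have hc : Tendsto (fun t : ℝ => p + t • v) (𝓝 0) (𝓝 p) := by
      have : Continuous (fun t : ℝ => p + t • v) := by fun_prop
      simpa using this.tendsto 0
    filter_upwards [hc.eventually (isOpen_ball.mem_nhds hp)] with t ht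
    simpa using (h.normalParam_bounds ht hp).1
  have h4 : (fun t : ℝ => t • v) =o[𝓝 0] fun t : ℝ => t := by
    refine h3.trans_isLittleO ?_
    simpa using h2
  by_contra hne
  have h5 : (fun t : ℝ => t) =O[𝓝 0] fun t : ℝ => t • v := by
    refine Asymptotics.IsBigO.of_bound ‖v‖⁻¹ (Eventually.of_forall fun t => ?_)
    rw [norm_smul]
    have : ‖v‖ ≠ 0 := norm_ne_zero_iff.2 hne
    field_simp; exact le_rfl
  have h6 : (fun t : ℝ => t) =o[𝓝 0] fun t : ℝ => t := h5.trans_isLittleO h4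
  have h7 := (h6.def (c := 1 / 2) (by norm_num))
  obtain ⟨ε, hε, h8⟩ := Metric.eventually_nhds_iff.1 h7
  have := h8 (y := ε / 2) (by rw [Real.dist_eq, sub_zero, abs_of_pos (by linarith)]; linarith)
  rw [Real.norm_eq_abs, abs_of_pos (by linarith)] at this
  linarith

/-- Differentiate the equation that says the defect vanishes. No derivative of `normalParam` occurs
on the right, so the formula gains one order of convergence each time it is used. -/
theorem fderiv_normalParam_eq (h : NearPair A R f₀ f) (hp : p ∈ ball 0 (R - 1 / 2)) :
    fderiv ℝ (normalParam R f₀ f) p =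
      (adjoint (fderiv ℝ f₀ p) ∘L fderiv ℝ f (normalParam R f₀ f p)).inverse ∘L
      (adjoint (fderiv ℝ f₀ p) ∘L fderiv ℝ f₀ p
        - (fderiv ℝ (fun y => adjoint (fderiv ℝ f₀ y)) p).flip
          (f (normalParam R f₀ f p) - f₀ p)) := by
  have hpR : p ∈ ball (0 : E) R := closedBall_subset hp (mem_closedBall_self (by norm_num))
  have hzR := h.normalParam_mem hp
  have hd : HasFDerivAt (normalParam R f₀ f) (fderiv ℝ (normalParam R f₀ f) p) p :=
    ((h.contDiffAt_normalParam hp).differentiableAt (by simp)).hasFDerivAt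
  have hA : HasFDerivAt (fun y => adjoint (fderiv ℝ f₀ y))
      (fderiv ℝ (fun y => adjoint (fderiv ℝ f₀ y)) p) p := by
    refine DifferentiableAt.hasFDerivAt ?_
    have a : ContDiffAt ℝ ∞ (fderiv ℝ f₀) p := (h.left.smooth p hpR).fderiv_right (by simp)
    exact ((adjoint (𝕜 := ℝ) (E := E) (F := V)).toContinuousLinearEquiv.contDiff.contDiffAt.comp
      p a).differentiableAt (by simp)
  have hf := ((h.right.smooth _ hzR).differentiableAt (by simp)).hasFDerivAt
  have hf₀ := ((h.left.smooth _ hpR).differentiableAt (by simp)).hasFDerivAt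
  have hD := hA.clm_apply ((hf.comp p hd).sub hf₀)
  have hz : (fun y => adjoint (fderiv ℝ f₀ y) ((f ∘ normalParam R f₀ f - f₀) y))
      =ᶠ[𝓝 p] fun _ => 0 := by
    filter_upwards [isOpen_ball.mem_nhds hp] with y hy
    exact (h.normalParam_spec hy).2
  have h0 := hD.unique ((hasFDerivAt_const (0 : E) p).congr_of_eventuallyEq hz)
  have hinv := h.left.isInvertible_adjoint_comp h.right hpR hzR
  set M := adjoint (fderiv ℝ f₀ p) ∘L fderiv ℝ f (normalParam R f₀ f p)
  have e : M ∘L fderiv ℝ (normalParam R f₀ f) p = adjoint (fderiv ℝ f₀ p) ∘L fderiv ℝ f₀ p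
        - (fderiv ℝ (fun y => adjoint (fderiv ℝ f₀ y)) p).flip
          (f (normalParam R f₀ f p) - f₀ p) := by
    rw [eq_sub_iff_add_eq, ← sub_eq_zero]
    rw [← h0]
    ext v
    simp [M]
    abel
  rw [← e, ← ContinuousLinearMap.comp_assoc]
  obtain ⟨M', hM'⟩ := hinv
  ext v
  simp [← hM']

end NearPair

/-- At order zero, the limit parameter has small defect with respect to `F k`, and a small defect
forces a small distance to the true parameter; the uniform Lipschitz bound handles the moving point.
Higher orders follow by bootstrapping in `fderiv_normalParam_eq`. -/
theorem convC_normalParam {ι : Type*} {l : Filter ι} {A : E →ₗᵢ[ℝ] V} {R : ℝ} {f₀ f : E → V}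
    {F : ι → E → V} {p : E} (hF : ∀ k, NearPair A R f₀ (F k)) (hf : NearPair A R f₀ f)
    (hp : p ∈ ball 0 (R - 1 / 2))
    (h : ∀ z ∈ ball (0 : E) R, ∀ n, ConvC n l F f z) (n : ℕ) :
    ConvC n l (fun k => normalParam R f₀ (F k)) (normalParam R f₀ f) p := by
  have hpR : p ∈ ball (0 : E) R :=
    NearPair.closedBall_subset hp (mem_closedBall_self (by norm_num))
  have hnear : ∀ᶠ q in l ×ˢ 𝓝 p, q.2 ∈ ball (0 : E) (R - 1 / 2) :=
    tendsto_snd.eventually (isOpen_ball.mem_nhds hp)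
  have hnear' : ∀ᶠ y in 𝓝 p, y ∈ ball (0 : E) (R - 1 / 2) := isOpen_ball.mem_nhds hp
  have hzR := hf.normalParam_mem hp
  have hsm₀ : ∀ᶠ y in 𝓝 p, ContDiffAt ℝ ∞ f₀ y := by
    filter_upwards [isOpen_ball.mem_nhds hpR] with y hy using hf.left.smooth y hy
  induction n with
  | zero =>
    refine ConvC.of_zero (hnear.mono fun q hq => (hF q.1).contDiffAt_normalParam hq)
      (hnear'.mono fun y hy => hf.contDiffAt_normalParam hy) ?_
    rw [tendsto_iff_norm_sub_tendsto_zero]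
    have h1 : Tendsto (fun q : ι × E => F q.1 (normalParam R f₀ f p) - f₀ p) (l ×ˢ 𝓝 p)
        (𝓝 (f (normalParam R f₀ f p) - f₀ p)) := by
      have : Tendsto (fun q : ι × E => (q.1, normalParam R f₀ f p)) (l ×ˢ 𝓝 p)
          (l ×ˢ 𝓝 (normalParam R f₀ f p)) := tendsto_fst.prodMk tendsto_const_nhds
      exact ((h _ hzR 0).apply.comp this).sub_const _
    have h2 : Tendsto (fun q : ι × E => tangentDefect f₀ (F q.1) p (normalParam R f₀ f p))
        (l ×ˢ 𝓝 p) (𝓝 0) := by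
      have := ((adjoint (fderiv ℝ f₀ p)).continuous.tendsto _).comp h1
      rwa [show adjoint (fderiv ℝ f₀ p) (f (normalParam R f₀ f p) - f₀ p) = 0 from
        (hf.normalParam_spec hp).2] at this
    have h3 : Tendsto (fun q : ι × E => 2 * ‖q.2 - p‖
        + 2 * ‖tangentDefect f₀ (F q.1) p (normalParam R f₀ f p)‖) (l ×ˢ 𝓝 p) (𝓝 0) := by
      have a : Tendsto (fun q : ι × E => ‖q.2 - p‖) (l ×ˢ 𝓝 p) (𝓝 0) := by
        have : Tendsto (fun y : E => ‖y - p‖) (𝓝 p) (𝓝 0) :=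
          tendsto_iff_norm_sub_tendsto_zero.1 tendsto_id
        exact this.comp tendsto_snd
      simpa using (a.const_mul 2).add (h2.norm.const_mul 2)
    refine squeeze_zero' (Eventually.of_forall fun _ => norm_nonneg _) ?_ h3
    filter_upwards [hnear] with q hq
    have a := ((hF q.1).normalParam_bounds hq hp).2
    have b : ‖normalParam R f₀ (F q.1) p - normalParam R f₀ f p‖
        ≤ 2 * ‖tangentDefect f₀ (F q.1) p (normalParam R f₀ f p)‖ := by
      have c := hf.left.norm_adjoint_image_sub_le (hF q.1).right hpR
        ((hF q.1).normalParam_mem hp) hzR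
      have d : adjoint (fderiv ℝ f₀ p) (F q.1 (normalParam R f₀ (F q.1) p)
          - F q.1 (normalParam R f₀ f p))
          = -tangentDefect f₀ (F q.1) p (normalParam R f₀ f p) := by
        have e := ((hF q.1).normalParam_spec hp).2
        rw [tangentDefect, map_sub, sub_eq_zero] at e
        rw [tangentDefect, map_sub, map_sub, e]; abel
      rw [d] at c
      have c' := norm_le_norm_add_norm_sub' (normalParam R f₀ (F q.1) p - normalParam R f₀ f p)
        (-tangentDefect f₀ (F q.1) p (normalParam R f₀ f p))
      rw [norm_neg, norm_sub_rev _ (-_)] at c'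
      linarith [norm_nonneg (normalParam R f₀ (F q.1) p - normalParam R f₀ f p)]
    have c := norm_add_le (normalParam R f₀ (F q.1) q.2 - normalParam R f₀ (F q.1) p)
      (normalParam R f₀ (F q.1) p - normalParam R f₀ f p)
    rw [sub_add_sub_cancel] at c
    linarith
  | succ n ih =>
    refine ConvC.succ (ih.mono (Nat.zero_le _)) ?_
    have hA : ∀ᶠ y in 𝓝 p, ContDiffAt ℝ ∞ (fun y => adjoint (fderiv ℝ f₀ y)) y :=
      hsm₀.mono fun y hy =>
        (adjoint (𝕜 := ℝ) (E := E) (F := V)).toContinuousLinearEquiv.contDiff.contDiffAt.comp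
          y (hy.fderiv_right (by simp))
    have cA : ConvC n l (fun _ y => adjoint (fderiv ℝ f₀ y)) (fun y => adjoint (fderiv ℝ f₀ y)) p :=
      ConvC.const hA
    have cF : ConvC n l (fun k y => F k (normalParam R f₀ (F k) y) - f₀ y)
        (fun y => f (normalParam R f₀ f y) - f₀ y) p :=
      (ConvC.comp (h _ hzR n) ih).sub (ConvC.const hsm₀)
    have cDF : ConvC n l (fun k y => fderiv ℝ (F k) (normalParam R f₀ (F k) y))
        (fun y => fderiv ℝ f (normalParam R f₀ f y)) p :=
      ConvC.comp (h _ hzR (n + 1)).fderiv ih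
    have cM := ConvC.bilin (ContinuousLinearMap.compL ℝ E V E) cA cDF
    obtain ⟨M, hM⟩ := hf.left.isInvertible_adjoint_comp hf.right hpR hzR
    have cI := ConvC.comp_left (b := ContinuousLinearMap.inverse) (by
      have : ∀ᶠ T in 𝓝 (M : E →L[ℝ] E), ContDiffAt ℝ ∞ ContinuousLinearMap.inverse T := by
        filter_upwards [ContinuousLinearEquiv.nhds M] with T ⟨M', hM'⟩
        rw [← hM']; exact contDiffAt_map_inverse M'
      rw [hM] at this
      exact this) cM
    have hDA : ∀ᶠ y in 𝓝 p, ContDiffAt ℝ ∞ (fun y => fderiv ℝ f₀ y) y :=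
      hsm₀.mono fun y hy => hy.fderiv_right (by simp)
    have cDA : ConvC n l (fun _ y => fderiv ℝ f₀ y) (fun y => fderiv ℝ f₀ y) p :=
      ConvC.const hDA
    have cG := ConvC.bilin (ContinuousLinearMap.compL ℝ E V E) cA cDA
    have hfl : ContDiff ℝ ∞ (fun T : E →L[ℝ] V →L[ℝ] E => T.flip) :=
      IsBoundedLinearMap.contDiff ⟨⟨fun x y => rfl, fun c x => rfl⟩, 1, one_pos, fun T => by
        rw [one_mul, T.opNorm_flip]⟩
    have hDDA : ∀ᶠ y in 𝓝 p, ContDiffAt ℝ ∞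
        (fun y => (fderiv ℝ (fun y => adjoint (fderiv ℝ f₀ y)) y).flip) y :=
      hA.mono fun y hy =>
        hfl.contDiffAt.comp y
          (hy.fderiv_right (m := ∞) (by simp))
    have cDDA : ConvC n l (fun _ y => (fderiv ℝ (fun y => adjoint (fderiv ℝ f₀ y)) y).flip)
        (fun y => (fderiv ℝ (fun y => adjoint (fderiv ℝ f₀ y)) y).flip) p := ConvC.const hDDA
    have cB := ConvC.bilin (ContinuousLinearMap.id ℝ (V →L[ℝ] E →L[ℝ] E)) cDDA cF
    refine (ConvC.bilin (ContinuousLinearMap.compL ℝ E E E) cI (cG.sub cB)).congr ?_ ?_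
    · filter_upwards [hnear] with q hq using (hF q.1).fderiv_normalParam_eq hq
    · filter_upwards [hnear'] with y hy using hf.fderiv_normalParam_eq hy

end NormalProjection

/-! ### Generic functions have countably many critical points. -/

section Sard

open ContinuousLinearMap MeasureTheory

variable {m : ℕ} {ι : Type} [Fintype ι] [DecidableEq ι]

local notation "𝔼" => EuclideanSpace ℝ (Fin m)

/-- The value of the `i`-th parameter for which `z` is a critical point of
`h₀ + ∑ j, ⟪a j, h j ·⟫`, if `h i` is the identity near `z`. -/
noncomputable def criticalParam (h₀ : 𝔼 → ℝ) (h : ι → 𝔼 → 𝔼) (i : ι) (z : 𝔼) (a : ι → 𝔼) : 𝔼 :=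
  -((InnerProductSpace.toDual ℝ 𝔼).symm (fderiv ℝ h₀ z)
    + ∑ j ∈ Finset.univ.erase i, adjoint (fderiv ℝ (h j) z) (a j))

theorem criticalParam_update (h₀ : 𝔼 → ℝ) (h : ι → 𝔼 → 𝔼) (i : ι) (z w : 𝔼) (a : ι → 𝔼) :
    criticalParam h₀ h i z (Function.update a i w) = criticalParam h₀ h i z a := by
  unfold criticalParam
  congr 2
  refine Finset.sum_congr rfl fun j hj => ?_
  rw [Function.update_of_ne (Finset.ne_of_mem_erase hj)]

theorem eq_criticalParam_of_fderiv_eq_zero {h₀ : 𝔼 → ℝ} {h : ι → 𝔼 → 𝔼} {i : ι} {z : 𝔼}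
    (hh₀ : DifferentiableAt ℝ h₀ z) (hh : ∀ j, DifferentiableAt ℝ (h j) z)
    (hi : h i =ᶠ[𝓝 z] id) {a : ι → 𝔼}
    (hz : fderiv ℝ (fun y => h₀ y + ∑ j, inner ℝ (a j) (h j y)) z = 0) :
    criticalParam h₀ h i z a = a i := by
  have h1 : HasFDerivAt (fun y => h₀ y + ∑ j, inner ℝ (a j) (h j y))
      (fderiv ℝ h₀ z + ∑ j, (innerSL ℝ (a j)) ∘L fderiv ℝ (h j) z) z :=
    hh₀.hasFDerivAt.add (HasFDerivAt.fun_sum fun j _ =>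
      (innerSL ℝ (a j)).hasFDerivAt.comp z (hh j).hasFDerivAt)
  rw [h1.fderiv] at hz
  have h2 : fderiv ℝ (h i) z = ContinuousLinearMap.id ℝ 𝔼 := by
    rw [hi.fderiv_eq, fderiv_id]
  rw [← Finset.add_sum_erase _ _ (Finset.mem_univ i), h2] at hz
  refine ext_inner_right ℝ fun v => ?_
  have h3 := DFunLike.congr_fun hz v
  simp only [add_apply, coe_comp, Function.comp_apply, innerSL_apply_apply, coe_id', id_eq,
    sum_apply, zero_apply] at h3
  simp only [criticalParam, inner_neg_left, inner_add_left, sum_inner, adjoint_inner_left,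
    InnerProductSpace.toDual_symm_apply]
  linarith

theorem contDiffAt_criticalParam {h₀ : 𝔼 → ℝ} {h : ι → 𝔼 → 𝔼} {i : ι} {z : 𝔼}
    (hh₀ : ContDiffAt ℝ ∞ h₀ z) (hh : ∀ j, ContDiffAt ℝ ∞ (h j) z) (a : ι → 𝔼) :
    ContDiffAt ℝ ∞ (fun q : 𝔼 × (ι → 𝔼) => criticalParam h₀ h i q.1 q.2) (z, a) := by
  refine ContDiffAt.neg (ContDiffAt.add ?_ (ContDiffAt.sum fun j _ => ?_))
  · have h1 : ContDiffAt ℝ ∞ (fun q : 𝔼 × (ι → 𝔼) => fderiv ℝ h₀ q.1) (z, a) :=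
      ContDiffAt.comp (z, a) (f := Prod.fst) (g := fderiv ℝ h₀)
        (hh₀.fderiv_right (m := ∞) (by simp)) contDiffAt_fst
    exact (InnerProductSpace.toDual ℝ 𝔼).symm.toContinuousLinearEquiv.contDiff.contDiffAt.comp
      _ h1
  · have h1 : ContDiffAt ℝ ∞ (fun q : 𝔼 × (ι → 𝔼) => fderiv ℝ (h j) q.1) (z, a) :=
      ContDiffAt.comp (z, a) (f := Prod.fst) (g := fderiv ℝ (h j))
        ((hh j).fderiv_right (m := ∞) (by simp)) contDiffAt_fst
    have h2 : ContDiffAt ℝ ∞ (fun q : 𝔼 × (ι → 𝔼) => adjoint (fderiv ℝ (h j) q.1)) (z, a) :=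
      (adjoint (𝕜 := ℝ) (E := 𝔼) (F := 𝔼)).toContinuousLinearEquiv.contDiff.contDiffAt.comp _ h1
    exact h2.clm_apply (by fun_prop)

/-- Let `Ψ` read the `i`-th coordinate as a point `z` and replace it by the parameter for which `z`
is critical. Critical points for the parameter `a` then give points of the fibre of `Ψ` over `a`.
Off the null set of critical values of `Ψ` these are isolated, hence countable. Only the
equidimensional case of Sard's theorem enters. -/
theorem ae_countable_critical {O : Set 𝔼} {h₀ : 𝔼 → ℝ} {h : ι → 𝔼 → 𝔼} (i : ι)
    (hO : IsOpen O) (hh₀ : ∀ z ∈ O, ContDiffAt ℝ ∞ h₀ z)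
    (hh : ∀ j, ∀ z ∈ O, ContDiffAt ℝ ∞ (h j) z) (hi : EqOn (h i) id O) :
    ∀ᵐ a : ι → 𝔼, {z ∈ O | fderiv ℝ (fun y => h₀ y + ∑ j, inner ℝ (a j) (h j y)) z = 0}.Countable := by
  set Ψ : (ι → 𝔼) → (ι → 𝔼) := fun b => Function.update b i (criticalParam h₀ h i (b i) b) with hΨ
  have hΨs : ∀ b : ι → 𝔼, b i ∈ O → ContDiffAt ℝ ∞ Ψ b := by
    intro b hb
    refine contDiffAt_pi.2 fun j => ?_
    by_cases hj : j = i
    · subst hj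
      simp only [hΨ, Function.update_self]
      exact ContDiffAt.comp b (f := fun b : ι → 𝔼 => (b j, b))
        (g := fun q : 𝔼 × (ι → 𝔼) => criticalParam h₀ h j q.1 q.2)
        (contDiffAt_criticalParam (hh₀ _ hb) (fun k => hh k _ hb) b) (by fun_prop)
    · simp only [hΨ, Function.update_of_ne hj]
      fun_prop
  set S : Set (ι → 𝔼) := {b | b i ∈ O ∧ (fderiv ℝ Ψ b).det = 0} with hS
  have hnull : volume (Ψ '' S) = 0 :=
    addHaar_image_eq_zero_of_det_fderivWithin_eq_zero volume (f' := fun b => fderiv ℝ Ψ b)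
      (fun b hb => ((hΨs b hb.1).differentiableAt (by simp)).hasFDerivAt.hasFDerivWithinAt)
      (fun b hb => hb.2)
  filter_upwards [compl_mem_ae_iff.2 hnull] with a ha
  set C := {z ∈ O | fderiv ℝ (fun y => h₀ y + ∑ j, inner ℝ (a j) (h j y)) z = 0} with hC
  have hval : ∀ z ∈ C, Ψ (Function.update a i z) = a := by
    intro z hz
    have h1 : criticalParam h₀ h i z a = a i :=
      eq_criticalParam_of_fderiv_eq_zero ((hh₀ z hz.1).differentiableAt (by simp))
        (fun j => (hh j z hz.1).differentiableAt (by simp))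
        (hi.eventuallyEq_of_mem (hO.mem_nhds hz.1)) hz.2
    simp only [hΨ, Function.update_self, criticalParam_update, Function.update_idem, h1,
      Function.update_eq_self]
  have hiso : ∀ z ∈ C, ({z} : Set 𝔼) ∈ 𝓝[C] z := by
    intro z hz
    set b := Function.update a i z with hb
    have hbi : b i = z := by simp [hb]
    have hdet : (fderiv ℝ Ψ b).det ≠ 0 := fun h0 =>
      ha ⟨b, ⟨by rw [hbi]; exact hz.1, h0⟩, hval z hz⟩
    have hsd := (hΨs b (by rw [hbi]; exact hz.1)).hasStrictFDerivAt (by simp)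
    set e := ContinuousLinearMap.toContinuousLinearEquivOfDetNeZero _ hdet
    have hsd' : HasStrictFDerivAt Ψ (e : (ι → 𝔼) →L[ℝ] (ι → 𝔼)) b := by
      rw [ContinuousLinearMap.coe_toContinuousLinearEquivOfDetNeZero]; exact hsd
    have hsrc : (hsd'.toOpenPartialHomeomorph Ψ).source ∈ 𝓝 b :=
      (hsd'.toOpenPartialHomeomorph Ψ).open_source.mem_nhds
        hsd'.mem_toOpenPartialHomeomorph_source
    have hcont : Tendsto (fun y => Function.update a i y) (𝓝 z) (𝓝 b) :=
      (continuous_const (y := a)).update i continuous_id |>.tendsto z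
    filter_upwards [mem_nhdsWithin_of_mem_nhds (hcont hsrc), self_mem_nhdsWithin] with y hy hyC
    have h1 := (hsd'.toOpenPartialHomeomorph Ψ).injOn hy
      hsd'.mem_toOpenPartialHomeomorph_source ((hval y hyC).trans (hval z hz).symm)
    simpa [hb] using congrFun h1 i
  obtain ⟨t, htC, ht, hcov⟩ := TopologicalSpace.countable_cover_nhdsWithin hiso
  refine ht.mono fun z hz => ?_
  simpa using hcov hz

end Sard

/-! ### Compact regular superlevel sets. -/

section RegularLevel

open MeasureTheory

variable {m : ℕ} {X : Type*} [TopologicalSpace X] [ChartedSpace (EuclideanSpace ℝ (Fin m)) X]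
  [IsManifold (𝓡 m) ∞ X] [T2Space X] [SecondCountableTopology X]

local notation "𝔼" => EuclideanSpace ℝ (Fin m)

/-- A cutoff function, 1 on `A` and 0 off the interior of `C`, is perturbed by linear combinations
of truncated chart coordinates. For almost every choice of coefficients there are countably many
critical points in `C`, so some level between 1/4 and 3/4 is not a critical value there. A
perturbation of size at most 1/4 keeps `A` above this level and the superlevel set inside `C`. -/
theorem exists_regular_superlevel {A : Set X} (hA : IsCompact A) :
    ∃ g : X → ℝ, ContMDiff (𝓡 m) 𝓘(ℝ, ℝ) ∞ g ∧ (∀ x ∈ A, 0 < g x) ∧ IsCompact {x | 0 ≤ g x} ∧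
      ∀ x, g x = 0 → mfderiv (𝓡 m) 𝓘(ℝ, ℝ) g x ≠ 0 := by
  classical
  have : LocallyCompactSpace X := Manifold.locallyCompact_of_finiteDimensional (𝓡 m)
  have : SigmaCompactSpace X := inferInstance
  obtain ⟨C, hC, hAC⟩ := exists_compact_superset hA
  obtain ⟨f, hf0, hf1, hf⟩ := exists_contMDiffMap_zero_one_of_isClosed (𝓡 m) (n := ⊤)
    (s := (interior C)ᶜ) (t := A) isOpen_interior.isClosed_compl hA.isClosed
    (disjoint_left.2 fun x hx hxA => hx (hAC hxA))
  have b : ∀ x : X, SmoothBumpFunction (𝓡 m) x := fun x => Classical.arbitrary _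
  set V : X → Set X := fun x => interior {y | b x y = 1} ∩ (extChartAt (𝓡 m) x).source with hV
  have hVo : ∀ x, IsOpen (V x) := fun x => isOpen_interior.inter (isOpen_extChartAt_source x)
  have hVx : ∀ x, x ∈ V x := fun x =>
    ⟨mem_interior_iff_mem_nhds.2 (b x).eventuallyEq_one, mem_extChartAt_source x⟩
  obtain ⟨t, ht⟩ := hC.elim_finite_subcover V hVo fun x _ => mem_iUnion.2 ⟨x, hVx x⟩
  -- the index type is moved to the lowest universe
  set n := t.card
  set c : Fin n → X := fun i => (t.equivFin.symm i : X) with hc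
  have hcov : C ⊆ ⋃ i, V (c i) := by
    intro x hx
    obtain ⟨y, hy, hxy⟩ := mem_iUnion₂.1 (ht hx)
    exact mem_iUnion.2 ⟨t.equivFin ⟨y, hy⟩, by simpa [hc] using hxy⟩
  set W : Fin n → X → 𝔼 := fun i x => b (c i) x • extChartAt (𝓡 m) (c i) x with hW
  have hWs : ∀ i, ContMDiff (𝓡 m) 𝓘(ℝ, 𝔼) ∞ (W i) := fun i =>
    (b (c i)).contMDiff_smul contMDiffOn_extChartAt
  have hWb : ∀ i, ∃ B, ∀ x, ‖W i x‖ ≤ B := fun i =>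
    (HasCompactSupport.smul_right (b (c i)).hasCompactSupport).exists_bound_of_continuous
      (hWs i).continuous
  choose B hB using hWb
  set g : (Fin n → 𝔼) → X → ℝ := fun a x => f x + ∑ j, inner ℝ (a j) (W j x) with hg
  have hgs : ∀ a, ContMDiff (𝓡 m) 𝓘(ℝ, ℝ) ∞ (g a) := fun a => by
    refine f.contMDiff.add (ContMDiff.sum fun j _ => ?_)
    exact ((innerSL ℝ (a j)).contMDiff).comp (hWs j)
  have hcrit : ∀ i, ∀ᵐ a : Fin n → 𝔼,
      {x ∈ V (c i) | mfderiv (𝓡 m) 𝓘(ℝ, ℝ) (g a) x = 0}.Countable := by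
    intro i
    set e := extChartAt (𝓡 m) (c i) with he
    set O : Set 𝔼 := e.target ∩ e.symm ⁻¹' (V (c i)) with hO
    have hOo : IsOpen O :=
      (continuousOn_extChartAt_symm (c i)).isOpen_inter_preimage
        (isOpen_extChartAt_target (c i)) (hVo _)
    have hsymm : ∀ z ∈ O, ContMDiffAt (𝓡 m) (𝓡 m) ∞ e.symm z := fun z hz =>
      (contMDiffOn_extChartAt_symm (c i)).contMDiffAt
        ((isOpen_extChartAt_target (c i)).mem_nhds hz.1)
    have hae := ae_countable_critical (h₀ := f ∘ e.symm) (h := fun j => W j ∘ e.symm) i hOo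
      (fun z hz => ((f.contMDiff.contMDiffAt).comp z (hsymm z hz)).contDiffAt)
      (fun j z hz => (((hWs j).contMDiffAt).comp z (hsymm z hz)).contDiffAt)
      (fun z hz => by
        have h1 : e.symm z ∈ {y | b (c i) y = 1} := interior_subset hz.2.1
        have h1 : b (c i) (e.symm z) = 1 := h1
        simp only [hW, Function.comp_apply, h1, one_smul, id_eq]
        exact e.right_inv hz.1)
    filter_upwards [hae] with a ha
    refine Set.Countable.mono ?_ (ha.image e.symm)
    intro x hx
    refine ⟨e x, ⟨⟨e.map_source hx.1.2, ?_⟩, ?_⟩, e.left_inv hx.1.2⟩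
    · rw [mem_preimage, e.left_inv hx.1.2]; exact hx.1
    · have hz : e x ∈ O := ⟨e.map_source hx.1.2, by
        rw [mem_preimage, e.left_inv hx.1.2]; exact hx.1⟩
      have h1 : mfderiv (𝓡 m) 𝓘(ℝ, ℝ) (g a ∘ e.symm) (e x) = 0 := by
        have h2 := mfderiv_comp (I := 𝓡 m) (I' := 𝓡 m) (I'' := 𝓘(ℝ, ℝ)) (e x)
          (g := g a) (f := e.symm)
          ((hgs a).mdifferentiableAt (by simp)) ((hsymm _ hz).mdifferentiableAt (by simp))
        rw [h2, e.left_inv hx.1.2, hx.2]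
        exact ContinuousLinearMap.zero_comp _
      rw [mfderiv_eq_fderiv] at h1
      exact h1
  have hae : ∀ᵐ a : Fin n → 𝔼, ∀ i, {x ∈ V (c i) | mfderiv (𝓡 m) 𝓘(ℝ, ℝ) (g a) x = 0}.Countable :=
    ae_all_iff.2 hcrit
  -- Coefficients of norm below `1 / (4 * (T + 1))` change the cutoff by at most 1/4.
  set T := ∑ i, |B i| with hT
  have hT0 : 0 ≤ T := Finset.sum_nonneg fun i _ => abs_nonneg _
  obtain ⟨a, ha, hcount⟩ := (Measure.dense_of_ae hae).exists_mem_open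
    (Metric.isOpen_ball (x := (0 : Fin n → 𝔼)) (ε := 1 / (4 * (T + 1))))
    ⟨0, Metric.mem_ball_self (by positivity)⟩
  have hclose : ∀ x, |g a x - f x| ≤ 1 / 4 := by
    intro x
    have h1 : ‖a‖ ≤ 1 / (4 * (T + 1)) := by simpa using (mem_ball_zero_iff.1 hcount).le
    simp only [hg, add_sub_cancel_left]
    refine (Finset.abs_sum_le_sum_abs _ _).trans ?_
    have h2 : ∑ i, |inner ℝ (a i) (W i x)| ≤ ∑ i, ‖a‖ * |B i| := by
      refine Finset.sum_le_sum fun i _ => (abs_real_inner_le_norm _ _).trans ?_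
      exact mul_le_mul (norm_le_pi_norm a i) ((hB i x).trans (le_abs_self _)) (norm_nonneg _)
        (norm_nonneg _)
    refine h2.trans ?_
    rw [← Finset.mul_sum]
    calc ‖a‖ * T ≤ 1 / (4 * (T + 1)) * (T + 1) :=
          mul_le_mul h1 (by linarith) hT0 (by positivity)
      _ = 1 / 4 := by field_simp
  have hcritC : (g a '' {x ∈ C | mfderiv (𝓡 m) 𝓘(ℝ, ℝ) (g a) x = 0}).Countable := by
    refine Countable.image ?_ _
    refine (countable_iUnion ha).mono ?_
    rintro x ⟨hxC, hx⟩
    obtain ⟨i, hi⟩ := mem_iUnion.1 (hcov hxC)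
    exact mem_iUnion.2 ⟨i, hi, hx⟩
  obtain ⟨s, hs, hsI⟩ : ∃ s ∈ Ioo (1 / 4 : ℝ) (3 / 4),
      s ∉ g a '' {x ∈ C | mfderiv (𝓡 m) 𝓘(ℝ, ℝ) (g a) x = 0} := by
    obtain ⟨s, hs, hsI⟩ := (hcritC.dense_compl ℝ).exists_mem_open isOpen_Ioo
      (nonempty_Ioo.2 (by norm_num : (1 / 4 : ℝ) < 3 / 4))
    exact ⟨s, hsI, hs⟩
  have hout : ∀ x ∉ interior C, g a x ≤ 1 / 4 := by
    intro x hx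
    have h1 := (abs_le.1 (hclose x)).2
    rw [show f x = 0 from hf0 hx] at h1
    linarith
  refine ⟨fun x => g a x - s, (hgs a).sub contMDiff_const, fun x hx => ?_, ?_, fun x hx h0 => ?_⟩
  · have h1 := (abs_le.1 (hclose x)).1
    rw [show f x = 1 from hf1 hx] at h1
    linarith [hs.2]
  · refine hC.of_isClosed_subset (isClosed_le continuous_const
      ((hgs a).continuous.sub continuous_const)) fun x hx => ?_
    by_contra hxC
    have := hout x fun h => hxC (interior_subset h)
    have hx' : 0 ≤ g a x - s := hx
    linarith [hs.1]
  · have hgx : g a x = s := sub_eq_zero.1 hx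
    refine hsI ⟨x, ⟨?_, ?_⟩, hgx⟩
    · by_contra hxC
      have := hout x fun h => hxC (interior_subset h)
      linarith [hs.1]
    · refine Eq.trans ?_ h0
      have := mfderiv_sub (I := 𝓡 m) (z := x) (f := g a) (g := fun _ => s)
        ((hgs a).mdifferentiableAt (by simp)) mdifferentiableAt_const
      refine Eq.trans ?_ this.symm
      rw [mfderiv_const]
      exact (sub_zero _).symm

end RegularLevel

/-! ### Model half-spaces in every dimension. -/

section HalfSpace

/-- In dimension zero there is no proper half-space, and `l = 0` lets the whole space be written as
`0 ≤ l`. The last clause confines `l = 0` to that case. -/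
theorem exists_halfSpace_model (m : ℕ) :
    ∃ (Ht : Type) (_ : TopologicalSpace Ht)
      (It : ModelWithCorners ℝ (EuclideanSpace ℝ (Fin m)) Ht)
      (l : EuclideanSpace ℝ (Fin m) →L[ℝ] ℝ),
      IsHalfSpaceModel It ∧ range It = {x | 0 ≤ l x} ∧ (l = 0 → m = 0) := by
  rcases Nat.eq_zero_or_pos m with rfl | hm
  · exact ⟨_, _, 𝓡 0, 0, Or.inl (by simp), by simp, fun _ => rfl⟩
  · have : NeZero m := ⟨hm.ne'⟩
    have hr : range (𝓡∂ m) = {x | 0 ≤ (EuclideanSpace.proj 0 : EuclideanSpace ℝ (Fin m) →L[ℝ] ℝ) x} := by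
      rw [range_modelWithCornersEuclideanHalfSpace]; rfl
    have hl : (EuclideanSpace.proj 0 : EuclideanSpace ℝ (Fin m) →L[ℝ] ℝ) ≠ 0 := by
      intro h
      have := DFunLike.congr_fun h (EuclideanSpace.single 0 1)
      simp at this
    exact ⟨_, _, 𝓡∂ m, EuclideanSpace.proj 0, Or.inr ⟨_, hl, hr⟩, hr, fun h => absurd h hl⟩

end HalfSpace

/-! ### Local diffeomorphisms and straightening of a function. -/

section AdaptedCharts

variable {E : Type*} [NormedAddCommGroup E] [NormedSpace ℝ E] [FiniteDimensional ℝ E]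

/-- The inverse function theorem, restricted to a neighbourhood where the differential stays
invertible, so that the inverse is smooth on its entire domain. -/
theorem exists_openPartialHomeomorph_of_injective_fderiv {f : E → E} {O : Set E} (hO : IsOpen O)
    (hf : ∀ z ∈ O, ContDiffAt ℝ ∞ f z) {z₀ : E} (hz₀ : z₀ ∈ O)
    (hinj : Function.Injective (fderiv ℝ f z₀)) :
    ∃ Φ : OpenPartialHomeomorph E E, z₀ ∈ Φ.source ∧ Φ.source ⊆ O ∧ (∀ z, Φ z = f z) ∧
      ∀ y ∈ Φ.target, ContDiffAt ℝ ∞ Φ.symm y := by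
  set e : E ≃L[ℝ] E := (LinearEquiv.ofInjectiveEndo (fderiv ℝ f z₀ : E →ₗ[ℝ] E) hinj).toContinuousLinearEquiv
  have he : (e : E →L[ℝ] E) = fderiv ℝ f z₀ := by ext; rfl
  have hd : HasFDerivAt f (e : E →L[ℝ] E) z₀ := by
    rw [he]; exact ((hf z₀ hz₀).differentiableAt (by simp)).hasFDerivAt
  set Ψ := (hf z₀ hz₀).toOpenPartialHomeomorph f hd (by simp) with hΨ
  have hcont : ContinuousAt (fderiv ℝ f) z₀ :=
    ((hf z₀ hz₀).fderiv_right (m := ∞) (by simp)).continuousAt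
  have hnear : ∀ᶠ z in 𝓝 z₀, fderiv ℝ f z ∈ range ((↑) : (E ≃L[ℝ] E) → E →L[ℝ] E) := by
    refine hcont.eventually ?_
    rw [← he]
    exact ContinuousLinearEquiv.nhds e
  obtain ⟨U, hU, hUo, hzU⟩ := eventually_nhds_iff.1 hnear
  refine ⟨Ψ.restrOpen (U ∩ O) (hUo.inter hO), ⟨(hf z₀ hz₀).mem_toOpenPartialHomeomorph_source hd
    (by simp), hzU, hz₀⟩, fun z hz => hz.2.2, fun z => rfl, fun y hy => ?_⟩
  have hy' := (Ψ.restrOpen (U ∩ O) (hUo.inter hO)).map_target hy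
  obtain ⟨e', he'⟩ := hU _ hy'.2.1
  refine OpenPartialHomeomorph.contDiffAt_symm (f₀' := e') _ hy ?_ (hf _ hy'.2.2)
  rw [he']
  exact ((hf _ hy'.2.2).differentiableAt (by simp)).hasFDerivAt

theorem exists_common_direction {l D : E →L[ℝ] ℝ} (hl : l ≠ 0) (hD : D ≠ 0) :
    ∃ w, l w = 1 ∧ D w ≠ 0 := by
  obtain ⟨v, hv⟩ := DFunLike.ne_iff.1 hl
  obtain ⟨u, hu⟩ := DFunLike.ne_iff.1 hD
  simp only [zero_apply] at hu hv
  by_cases h1 : l u = 0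
  · by_cases h2 : D ((l v)⁻¹ • v) = 0
    · exact ⟨(l v)⁻¹ • v + u, by simp [h1, hv], by rw [map_add, h2]; simpa using hu⟩
    · exact ⟨(l v)⁻¹ • v, by simp [hv], h2⟩
  · exact ⟨(l u)⁻¹ • u, by simp [h1], by simp [h1, hu]⟩

/-- Shift `z` by `G z - l z` along a vector `w` with `l w = 1`; then `l` of the result is `G z`.
Choosing `w` outside the kernel of the differential of `G` as well makes the shift a local
diffeomorphism. -/
theorem exists_straightening {G : E → ℝ} {O : Set E} (hO : IsOpen O)
    (hG : ∀ z ∈ O, ContDiffAt ℝ ∞ G z) {z₀ : E} (hz₀ : z₀ ∈ O) {l : E →L[ℝ] ℝ} (hl : l ≠ 0)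
    (hD : fderiv ℝ G z₀ ≠ 0) :
    ∃ Φ : OpenPartialHomeomorph E E, z₀ ∈ Φ.source ∧ Φ.source ⊆ O ∧
      (∀ z ∈ Φ.source, ContDiffAt ℝ ∞ Φ z) ∧ (∀ y ∈ Φ.target, ContDiffAt ℝ ∞ Φ.symm y) ∧
      ∀ z ∈ Φ.source, l (Φ z) = G z := by
  obtain ⟨w, hlw, hDw⟩ := exists_common_direction hl hD
  set f : E → E := fun z => z + (G z - l z) • w with hf
  have hfs : ∀ z ∈ O, ContDiffAt ℝ ∞ f z := fun z hz =>
    contDiffAt_id.add (((hG z hz).sub l.contDiff.contDiffAt).smul contDiffAt_const)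
  have hfd : HasFDerivAt f (ContinuousLinearMap.id ℝ E + (fderiv ℝ G z₀ - l).smulRight w) z₀ :=
    (hasFDerivAt_id z₀).add
      ((((hG z₀ hz₀).differentiableAt (by simp)).hasFDerivAt.sub l.hasFDerivAt).smul_const w)
  obtain ⟨Φ, h1, h2, h3, h4⟩ := exists_openPartialHomeomorph_of_injective_fderiv hO hfs hz₀ (by
    rw [hfd.fderiv]
    refine (injective_iff_map_eq_zero _).2 fun v hv => ?_
    set t := fderiv ℝ G z₀ v - l v with ht
    have hv' : v + t • w = 0 := hv
    have e1 : v = -(t • w) := eq_neg_of_add_eq_zero_left hv'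
    have e2 : t = -(t * fderiv ℝ G z₀ w) + t := by
      have a : fderiv ℝ G z₀ v = -(t * fderiv ℝ G z₀ w) := by
        conv_lhs => rw [e1]
        simp
      have b : l v = -t := by
        conv_lhs => rw [e1]
        simp [hlw]
      rw [a, b] at ht
      linarith
    have e3 : t * fderiv ℝ G z₀ w = 0 := by linarith
    have e4 : t = 0 := (mul_eq_zero.1 e3).resolve_right hDw
    rw [e1, e4]; simp)
  refine ⟨Φ, h1, h2, fun z hz => ?_, h4, fun z _ => ?_⟩
  · exact (hfs z (h2 hz)).congr_of_eventuallyEq (Eventually.of_forall h3)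
  · rw [h3]; simp [hf, hlw]

end AdaptedCharts

/-! ### Charts adapted to a superlevel set. -/

section Adapted

variable {m : ℕ} {X : Type*} [TopologicalSpace X] [ChartedSpace (EuclideanSpace ℝ (Fin m)) X]

local notation "𝔼" => EuclideanSpace ℝ (Fin m)

/-- A smooth chart in which the subset `T` is the half-space `0 ≤ l`. -/
structure IsAdaptedChart (T : Set X) (l : 𝔼 →L[ℝ] ℝ) (Φ : OpenPartialHomeomorph X 𝔼) : Prop where
  smooth : ContMDiffOn (𝓡 m) (𝓡 m) ∞ Φ Φ.source
  smooth_symm : ContMDiffOn (𝓡 m) (𝓡 m) ∞ Φ.symm Φ.target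
  mem_iff : ∀ y ∈ Φ.source, y ∈ T ↔ 0 ≤ l (Φ y)

/-- Where `g` is positive, a translated chart with values in the half-space does the job. Where `g`
vanishes, `g` is straightened to `l`; there `l = 0` is impossible, since in dimension zero no zero
is regular. -/
theorem exists_isAdaptedChart [IsManifold (𝓡 m) ∞ X] {g : X → ℝ}
    (hg : ContMDiff (𝓡 m) 𝓘(ℝ, ℝ) ∞ g)
    (hreg : ∀ x, g x = 0 → mfderiv (𝓡 m) 𝓘(ℝ, ℝ) g x ≠ 0) {l : 𝔼 →L[ℝ] ℝ} (hl : l = 0 → m = 0)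
    {x : X} (hx : 0 ≤ g x) :
    ∃ Φ : OpenPartialHomeomorph X 𝔼, x ∈ Φ.source ∧ IsAdaptedChart {y | 0 ≤ g y} l Φ := by
  set e := chartAt 𝔼 x with he
  have hes : ContMDiffOn (𝓡 m) (𝓡 m) ∞ e e.source := contMDiffOn_chart
  have hes' : ContMDiffOn (𝓡 m) (𝓡 m) ∞ e.symm e.target := contMDiffOn_chart_symm
  have hxe : x ∈ e.source := mem_chart_source 𝔼 x
  rcases hx.lt_or_eq with hpos | hzero
  · obtain ⟨v, hv⟩ : ∃ v, ∀ z, l (e x) - 1 < l z → 0 ≤ l (z + v) := by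
      by_cases h0 : l = 0
      · exact ⟨0, fun z _ => by simp [h0]⟩
      · obtain ⟨w, hw⟩ := DFunLike.ne_iff.1 h0
        refine ⟨((1 - l (e x)) / l w) • w, fun t ht => ?_⟩
        have : l w ≠ 0 := hw
        rw [map_add, map_smul, smul_eq_mul, div_mul_cancel₀ _ this]
        linarith
    have hU : IsOpen (e.source ∩ e ⁻¹' {z | l (e x) - 1 < l z}) :=
      e.isOpen_inter_preimage (isOpen_lt continuous_const l.continuous)
    have hV : IsOpen {y | 0 < g y} := isOpen_lt continuous_const hg.continuous
    set Φ := (e.restrOpen _ (hU.inter hV)).transHomeomorph (Homeomorph.addRight v) with hΦ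
    have hsrc : ∀ y ∈ Φ.source, y ∈ e.source ∧ l (e x) - 1 < l (e y) ∧ 0 < g y :=
      fun y hy => ⟨hy.1, hy.2.1.2, hy.2.2⟩
    refine ⟨Φ, ⟨hxe, ⟨hxe, by simp⟩, hpos⟩, ?_, ?_, fun y hy => ?_⟩
    · have : ContMDiffOn (𝓡 m) (𝓡 m) ∞ (fun y => e y + v) e.source :=
        ((contDiff_id.add contDiff_const).contMDiff (n := ∞)).comp_contMDiffOn hes
      exact this.mono fun y hy => hy.1
    · have : ContMDiffOn (𝓡 m) (𝓡 m) ∞ (e.symm ∘ fun z => z - v) ((fun z => z - v) ⁻¹' e.target) :=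
        hes'.comp ((contDiff_id.sub contDiff_const).contMDiff.contMDiffOn) fun z hz => hz
      refine (this.congr (f₁ := Φ.symm) fun z _ => ?_).mono fun z hz => ?_
      · change e.symm ((Homeomorph.addRight v).symm z) = e.symm (z - v)
        rw [sub_eq_add_neg]; rfl
      · have h1 := e.map_source (hsrc _ (Φ.map_target hz)).1
        have h2 : e (Φ.symm z) + v = z := Φ.right_inv hz
        change z - v ∈ e.target
        rwa [← eq_sub_of_add_eq h2]
    · have h := hsrc y hy
      refine ⟨fun _ => ?_, fun _ => h.2.2.le⟩
      have : Φ y = e y + v := rfl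
      rw [this]
      exact hv _ h.2.1
  · have hl0 : l ≠ 0 := by
      intro h
      obtain rfl := hl h
      refine hreg x hzero.symm ?_
      ext v
      have : v = 0 := Subsingleton.elim (α := EuclideanSpace ℝ (Fin 0)) v 0
      rw [this]; simp
    have hsm : ∀ z ∈ e.target, ContDiffAt ℝ ∞ (g ∘ e.symm) z := fun z hz =>
      (hg.contMDiffAt.comp z (hes'.contMDiffAt (e.open_target.mem_nhds hz))).contDiffAt
    have hD : fderiv ℝ (g ∘ e.symm) (e x) ≠ 0 := by
      intro h0
      refine hreg x hzero.symm ?_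
      have h1 : g =ᶠ[𝓝 x] (g ∘ e.symm) ∘ e := by
        filter_upwards [e.open_source.mem_nhds hxe] with y hy
        simp [e.left_inv hy]
      rw [h1.mfderiv_eq, mfderiv_comp x (I' := 𝓡 m)
        ((hsm _ (e.map_source hxe)).contMDiffAt.mdifferentiableAt (by simp))
        ((hes.contMDiffAt (e.open_source.mem_nhds hxe)).mdifferentiableAt (by simp)),
        mfderiv_eq_fderiv, h0]
      exact ContinuousLinearMap.zero_comp _
    obtain ⟨Ψ, h1, h2, h3, h4, h5⟩ := exists_straightening e.open_target hsm (e.map_source hxe)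
      hl0 hD
    refine ⟨e.trans Ψ, ?_, ?_, ?_, fun y hy => ?_⟩
    · simp [hxe, h1]
    · have : ContMDiffOn (𝓡 m) (𝓡 m) ∞ Ψ Ψ.source := fun z hz =>
        (h3 z hz).contMDiffAt.contMDiffWithinAt
      refine this.comp (hes.mono fun y hy => ?_) fun y hy => ?_
      · exact (by simpa using hy : _ ∧ _).1
      · exact (by simpa using hy : _ ∧ _).2
    · have : ContMDiffOn (𝓡 m) (𝓡 m) ∞ Ψ.symm Ψ.target := fun z hz =>
        (h4 z hz).contMDiffAt.contMDiffWithinAt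
      refine hes'.comp (this.mono fun y hy => ?_) fun y hy => ?_
      · exact (by simpa using hy : _ ∧ _).1
      · exact (by simpa using hy : _ ∧ _).2
    · have hy' : y ∈ e.source ∧ e y ∈ Ψ.source := by simpa using hy
      have : l ((e.trans Ψ) y) = g y := by
        simp [h5 _ hy'.2, e.left_inv hy'.1]
      rw [this]; rfl

end Adapted

/-! ### Compact domains as manifolds with boundary. -/

section Domain

variable {m : ℕ} {X : Type*} [TopologicalSpace X] [ChartedSpace (EuclideanSpace ℝ (Fin m)) X]
  {Ht : Type*} [TopologicalSpace Ht] (It : ModelWithCorners ℝ (EuclideanSpace ℝ (Fin m)) Ht)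
  {T : Set X} {l : EuclideanSpace ℝ (Fin m) →L[ℝ] ℝ}
  {Φ : OpenPartialHomeomorph X (EuclideanSpace ℝ (Fin m))}

local notation "𝔼" => EuclideanSpace ℝ (Fin m)

open Classical in
/-- The chart of a subset that is induced by an adapted chart of the ambient manifold. -/
noncomputable def IsAdaptedChart.chart (hr : range It = {x | 0 ≤ l x})
    (hΦ : IsAdaptedChart T l Φ) (p : T) : OpenPartialHomeomorph T Ht where
  toFun y := It.symm (Φ y)
  -- The default `p` is never reached on the target, since `It h` lies in the half-space.
  invFun h := if hm : Φ.symm (It h) ∈ T then ⟨_, hm⟩ else p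
  source := {y | (y : X) ∈ Φ.source}
  target := {h | It h ∈ Φ.target}
  map_source' y hy := by
    have h1 : Φ y ∈ range It := by rw [hr]; exact (hΦ.mem_iff y hy).1 y.2
    rw [mem_ofPred_eq, It.right_inv h1]
    exact Φ.map_source hy
  map_target' h hh := by
    have h1 : Φ.symm (It h) ∈ T := (hΦ.mem_iff _ (Φ.map_target hh)).2 (by
      rw [Φ.right_inv hh]
      have : It h ∈ range It := mem_range_self h
      rwa [hr] at this)
    rw [dif_pos h1]
    exact Φ.map_target hh
  left_inv' y hy := by
    have h1 : Φ y ∈ range It := by rw [hr]; exact (hΦ.mem_iff y hy).1 y.2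
    have h2 : Φ.symm (It (It.symm (Φ y))) = y := by rw [It.right_inv h1, Φ.left_inv hy]
    rw [dif_pos (by rw [h2]; exact y.2)]
    exact Subtype.ext h2
  right_inv' h hh := by
    have h1 : Φ.symm (It h) ∈ T := (hΦ.mem_iff _ (Φ.map_target hh)).2 (by
      rw [Φ.right_inv hh]
      have : It h ∈ range It := mem_range_self h
      rwa [hr] at this)
    rw [dif_pos h1]
    simp only [Φ.right_inv hh, It.left_inv]
  open_source := Φ.open_source.preimage continuous_subtype_val
  open_target := Φ.open_target.preimage It.continuous
  continuousOn_toFun := It.continuous_symm.comp_continuousOn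
    (Φ.continuousOn.comp continuous_subtype_val.continuousOn fun _ hy => hy)
  continuousOn_invFun := by
    rw [IsInducing.subtypeVal.continuousOn_iff]
    refine (Φ.continuousOn_symm.comp It.continuous.continuousOn fun h hh => hh).congr fun h hh => ?_
    have h1 : Φ.symm (It h) ∈ T := (hΦ.mem_iff _ (Φ.map_target hh)).2 (by
      rw [Φ.right_inv hh]
      have : It h ∈ range It := mem_range_self h
      rwa [hr] at this)
    simp [dif_pos h1]

open Classical in
theorem IsAdaptedChart.chart_symm_coe (hr : range It = {x | 0 ≤ l x})
    (hΦ : IsAdaptedChart T l Φ) (p : T) {h : Ht} (hh : It h ∈ Φ.target) :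
    (((hΦ.chart It hr p).symm h : T) : X) = Φ.symm (It h) := by
  have h1 : Φ.symm (It h) ∈ T := (hΦ.mem_iff _ (Φ.map_target hh)).2 (by
    rw [Φ.right_inv hh]
    have : It h ∈ range It := mem_range_self h
    rwa [hr] at this)
  change ((if hm : Φ.symm (It h) ∈ T then (⟨_, hm⟩ : T) else p : T) : X) = _
  rw [dif_pos h1]

/-- A subset with adapted charts around all its points, as a charted space. -/
@[reducible]
noncomputable def adaptedChartedSpace (hr : range It = {x | 0 ≤ l x})
    (Φ : T → OpenPartialHomeomorph X 𝔼) (hΦ : ∀ p, IsAdaptedChart T l (Φ p))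
    (hp : ∀ p : T, (p : X) ∈ (Φ p).source) : ChartedSpace Ht T where
  atlas := range fun p => (hΦ p).chart It hr p
  chartAt p := (hΦ p).chart It hr p
  mem_chart_source p := hp p
  chart_mem_atlas p := mem_range_self p

theorem isManifold_adaptedChartedSpace (hr : range It = {x | 0 ≤ l x})
    (Φ : T → OpenPartialHomeomorph X 𝔼) (hΦ : ∀ p, IsAdaptedChart T l (Φ p))
    (hp : ∀ p : T, (p : X) ∈ (Φ p).source) :
    letI := adaptedChartedSpace It hr Φ hΦ hp
    IsManifold It ∞ T := by
  let := adaptedChartedSpace It hr Φ hΦ hp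
  refine isManifold_of_contDiffOn It ∞ T ?_
  rintro _ _ ⟨p, rfl⟩ ⟨q, rfl⟩
  have h1 : ContMDiffOn (𝓡 m) (𝓡 m) ∞ (Φ q ∘ (Φ p).symm)
      ((Φ p).target ∩ (Φ p).symm ⁻¹' (Φ q).source) :=
    (hΦ q).smooth.comp ((hΦ p).smooth_symm.mono inter_subset_left) fun z hz => hz.2
  have key : ∀ z ∈ It.symm ⁻¹' (((hΦ p).chart It hr p).symm.trans ((hΦ q).chart It hr q)).source
      ∩ range It, z ∈ (Φ p).target ∧ (Φ p).symm z ∈ (Φ q).source ∧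
        It ((hΦ q).chart It hr q (((hΦ p).chart It hr p).symm (It.symm z)))
          = Φ q ((Φ p).symm z) := by
    rintro z ⟨⟨hz1, hz2⟩, hzr⟩
    have e1 : It (It.symm z) = z := It.right_inv hzr
    have hz1' : It (It.symm z) ∈ (Φ p).target := hz1
    have e2 := (hΦ p).chart_symm_coe It hr p hz1'
    rw [e1] at e2 hz1'
    have hz2' : ((((hΦ p).chart It hr p).symm (It.symm z) : T) : X) ∈ (Φ q).source := hz2
    have e3 : It ((hΦ q).chart It hr q (((hΦ p).chart It hr p).symm (It.symm z)))
        = Φ q ((((hΦ p).chart It hr p).symm (It.symm z) : T) : X) := by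
      refine It.right_inv ?_
      rw [hr]
      exact ((hΦ q).mem_iff _ hz2').1 (Subtype.coe_prop _)
    rw [e2] at e3 hz2'
    exact ⟨hz1', hz2', e3⟩
  refine (h1.contDiffOn.mono fun z hz => ⟨(key z hz).1, (key z hz).2.1⟩).congr fun z hz => ?_
  exact (key z hz).2.2

/-- Every compact subset of a manifold lies in a compact smooth domain. -/
theorem exists_compact_domain [IsManifold (𝓡 m) ∞ X] [T2Space X] [SecondCountableTopology X]
    {A : Set X} (hA : IsCompact A) :
    ∃ (Ht : Type) (T : Set X) (_ : TopologicalSpace Ht) (_ : ChartedSpace Ht T)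
      (It : ModelWithCorners ℝ 𝔼 Ht), IsHalfSpaceModel It ∧ IsManifold It ∞ T ∧ IsCompact T ∧
      A ⊆ T ∧ ContMDiff It (𝓡 m) ∞ ((↑) : T → X) ∧
      (∀ x : T, Function.Injective (mfderiv It (𝓡 m) ((↑) : T → X) x)) ∧
      ∀ p : T, ∃ Φ : OpenPartialHomeomorph X 𝔼, ContMDiffOn (𝓡 m) (𝓡 m) ∞ Φ.symm Φ.target ∧
        ∀ z ∈ (extChartAt It p).target, z ∈ Φ.target ∧
          (((extChartAt It p).symm z : T) : X) = Φ.symm z := by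
  obtain ⟨Ht, iHt, It, l, hIt, hr, hl⟩ := exists_halfSpace_model m
  obtain ⟨g, hg, hgA, hgc, hreg⟩ := exists_regular_superlevel (m := m) hA
  have hex := fun x : {x | 0 ≤ g x} => exists_isAdaptedChart hg hreg hl x.2
  choose Φ hp hΦ using hex
  let iC : ChartedSpace Ht {x | 0 ≤ g x} := adaptedChartedSpace It hr Φ hΦ hp
  have : IsManifold It ∞ {x | 0 ≤ g x} := isManifold_adaptedChartedSpace It hr Φ hΦ hp
  -- The inverse charts of the domain extend smoothly across the boundary as inverse charts of `X`.
  -- Convergence up to the boundary relies on this extension.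
  have hsymm : ∀ p : {x | 0 ≤ g x}, ∀ z ∈ (extChartAt It p).target, z ∈ (Φ p).target ∧
      (((extChartAt It p).symm z : {x | 0 ≤ g x}) : X) = (Φ p).symm z := by
    intro p z hz
    rw [extChartAt_target] at hz
    have e1 : It (It.symm z) = z := It.right_inv hz.2
    have h1 : It (It.symm z) ∈ (Φ p).target := hz.1
    have e2 := (hΦ p).chart_symm_coe It hr p h1
    rw [e1] at h1 e2
    exact ⟨h1, e2⟩
  have hcoe : ContMDiff It (𝓡 m) ∞ ((↑) : {x | 0 ≤ g x} → X) := by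
    intro p
    have h1 : ContMDiffOn It (𝓡 m) ∞ ((Φ p).symm ∘ extChartAt It p) (chartAt Ht p).source :=
      (hΦ p).smooth_symm.comp contMDiffOn_extChartAt fun y hy =>
        (hsymm p _ ((extChartAt It p).map_source (by rwa [extChartAt_source]))).1
    have h2 := h1.contMDiffAt ((chartAt Ht p).open_source.mem_nhds (mem_chart_source Ht p))
    refine h2.congr_of_eventuallyEq ?_
    filter_upwards [extChartAt_source_mem_nhds (I := It) p] with y hy
    have h3 := (hsymm p _ ((extChartAt It p).map_source hy)).2
    rw [(extChartAt It p).left_inv hy] at h3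
    exact h3
  refine ⟨Ht, {x | 0 ≤ g x}, iHt, iC, It, hIt, this, hgc, fun x hx => (hgA x hx).le, hcoe,
    fun p => ?_, fun p => ⟨Φ p, (hΦ p).smooth_symm, hsymm p⟩⟩
  have h1 : (Φ p ∘ ((↑) : {x | 0 ≤ g x} → X)) =ᶠ[𝓝 p] extChartAt It p := by
    filter_upwards [extChartAt_source_mem_nhds (I := It) p] with y hy
    have h3 := hsymm p _ ((extChartAt It p).map_source hy)
    rw [(extChartAt It p).left_inv hy] at h3
    rw [Function.comp_apply, h3.2, (Φ p).right_inv h3.1]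
  have h2 : mfderiv It (𝓡 m) (Φ p ∘ ((↑) : {x | 0 ≤ g x} → X)) p
      = mfderiv It (𝓡 m) (extChartAt It p) p := h1.mfderiv_eq
  have h3 := mfderiv_comp p (I := It) (I' := 𝓡 m) (I'' := 𝓡 m) (g := Φ p)
    (f := ((↑) : {x | 0 ≤ g x} → X))
    (((hΦ p).smooth.contMDiffAt ((Φ p).open_source.mem_nhds (hp p))).mdifferentiableAt (by simp))
    ((hcoe p).mdifferentiableAt (by simp))
  rw [h2] at h3
  have h4 := (isInvertible_mfderiv_extChartAt (I := It) (mem_extChartAt_source p)).injective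
  rw [h3] at h4
  exact Function.Injective.of_comp h4

end Domain

/-! ### Nearly isometric parametrizations of the domains. -/

section FramedChart

open ContinuousLinearMap Metric

variable {m : ℕ} {H S : Type*} [TopologicalSpace H] [TopologicalSpace S] [ChartedSpace H S]

local notation "𝔼" => EuclideanSpace ℝ (Fin m)

variable {V : Type} [NormedAddCommGroup V] [InnerProductSpace ℝ V] [FiniteDimensional ℝ V]
  {I : ModelWithCorners ℝ (EuclideanSpace ℝ (Fin m)) H} {w : S → V}
  {A : EuclideanSpace ℝ (Fin m) →ₗᵢ[ℝ] V} {R : ℝ} {φ : EuclideanSpace ℝ (Fin m) → S}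
  {z : EuclideanSpace ℝ (Fin m)}

/-- A smooth parametrization `φ` by a ball whose composition with the smooth map `w` is nearly
isometric. -/
structure IsFramedChart (I : ModelWithCorners ℝ (EuclideanSpace ℝ (Fin m)) H) (w : S → V)
    (A : EuclideanSpace ℝ (Fin m) →ₗᵢ[ℝ] V) (R : ℝ) (φ : EuclideanSpace ℝ (Fin m) → S) :
    Prop where
  smooth_map : ContMDiff I 𝓘(ℝ, V) ∞ w
  smooth : ContMDiffOn (𝓡 m) I ∞ φ (ball 0 R)
  near : NearIsometry A R (w ∘ φ)

namespace IsFramedChart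

theorem contMDiffAt (h : IsFramedChart I w A R φ) (hz : z ∈ ball 0 R) :
    ContMDiffAt (𝓡 m) I ∞ φ z :=
  h.smooth.contMDiffAt (isOpen_ball.mem_nhds hz)

theorem fderiv_comp_eq (h : IsFramedChart I w A R φ) (hz : z ∈ ball 0 R) :
    fderiv ℝ (w ∘ φ) z = (mfderiv I 𝓘(ℝ, V) w (φ z)).comp (mfderiv (𝓡 m) I φ z) := by
  rw [← mfderiv_eq_fderiv]
  exact mfderiv_comp z (h.smooth_map.mdifferentiableAt (by simp))
    ((h.contMDiffAt hz).mdifferentiableAt (by simp))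

theorem mfderiv_injective (h : IsFramedChart I w A R φ) (hz : z ∈ ball 0 R) :
    Function.Injective (mfderiv (𝓡 m) I φ z) := by
  have h1 := h.near.fderiv_injective hz
  rw [h.fderiv_comp_eq hz] at h1
  exact Function.Injective.of_comp h1

theorem mfderiv_surjective (h : IsFramedChart I w A R φ) (hz : z ∈ ball 0 R) :
    Function.Surjective (mfderiv (𝓡 m) I φ z) := by
  let D : 𝔼 →L[ℝ] 𝔼 := mfderiv (𝓡 m) I φ z
  have hD : Function.Injective (D : 𝔼 →ₗ[ℝ] 𝔼) := h.mfderiv_injective hz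
  have hD' : Function.Surjective (D : 𝔼 →ₗ[ℝ] 𝔼) :=
    (LinearMap.injective_iff_surjective (K := ℝ) (V := 𝔼)).1 hD
  exact hD'

/-- Dimensions agree, so the injective differential is onto, and a map with surjective differential
cannot send an interior point to the boundary. -/
theorem isInteriorPoint (h : IsFramedChart I w A R φ) (hz : z ∈ ball 0 R) :
    I.IsInteriorPoint (φ z) :=
  ((h.contMDiffAt hz).mdifferentiableAt (by simp)).isInteriorPoint_of_surjective_mfderiv
    (h.mfderiv_surjective hz) BoundarylessManifold.isInteriorPoint

theorem injOn (h : IsFramedChart I w A R φ) : InjOn φ (ball 0 R) :=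
  fun _ hz _ hz' e => h.near.injOn hz hz' (congrArg w e)

variable [IsManifold I ∞ S]

theorem map_nhds_eq (h : IsFramedChart I w A R φ) (hz : z ∈ ball 0 R) :
    map φ (𝓝 z) = 𝓝 (φ z) := by
  set e := extChartAt I (φ z) with he
  have hes : ContMDiffAt I (𝓡 m) ∞ e (φ z) := contMDiffAt_extChartAt
  have hc : ContDiffAt ℝ ∞ (e ∘ φ) z := (hes.comp z (h.contMDiffAt hz)).contDiffAt
  have hsurj : Function.Surjective (fderiv ℝ (e ∘ φ) z) := by
    rw [← mfderiv_eq_fderiv, mfderiv_comp z (hes.mdifferentiableAt (by simp))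
      ((h.contMDiffAt hz).mdifferentiableAt (by simp))]
    exact (isInvertible_mfderiv_extChartAt (I := I) (mem_extChartAt_source (φ z))).surjective.comp
      (h.mfderiv_surjective hz)
  have h1 := (hc.hasStrictFDerivAt (by simp)).map_nhds_eq_of_surj (LinearMap.range_eq_top.2 hsurj)
  have h2 : φ =ᶠ[𝓝 z] e.symm ∘ (e ∘ φ) := by
    filter_upwards [(h.contMDiffAt hz).continuousAt.preimage_mem_nhds
      (extChartAt_source_mem_nhds (I := I) (φ z))] with y hy
    exact (e.left_inv hy).symm
  rw [Filter.map_congr h2, ← Filter.map_map, h1, Function.comp_apply]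
  have h3 := map_extChartAt_symm_nhdsWithin_range (I := I) (φ z)
  rwa [nhdsWithin_eq_nhds.2 (range_mem_nhds_isInteriorPoint (h.isInteriorPoint hz))] at h3

theorem isOpen_image (h : IsFramedChart I w A R φ) {s : Set 𝔼} (hs : IsOpen s)
    (hsR : s ⊆ ball 0 R) : IsOpen (φ '' s) := by
  rw [isOpen_iff_mem_nhds]
  rintro _ ⟨z, hz, rfl⟩
  rw [← h.map_nhds_eq (hsR hz)]
  exact image_mem_map (hs.mem_nhds hz)

/-- A framed chart as a partial homeomorphism. -/
noncomputable def toOpenPartialHomeomorph (h : IsFramedChart I w A R φ) :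
    OpenPartialHomeomorph 𝔼 S :=
  OpenPartialHomeomorph.ofContinuousOpenRestrict (h.injOn.toPartialEquiv φ (ball 0 R))
    h.smooth.continuousOn
    (fun s hs => by
      obtain ⟨t, ht, rfl⟩ := isOpen_induced_iff.1 hs
      have := h.isOpen_image (ht.inter isOpen_ball) (inter_subset_right (s := t))
      convert! this using 1
      ext y
      constructor
      · rintro ⟨⟨x, hx⟩, hxt, rfl⟩
        exact ⟨x, ⟨hxt, hx⟩, rfl⟩
      · rintro ⟨x, ⟨hxt, hx⟩, rfl⟩
        exact ⟨⟨x, hx⟩, hxt, rfl⟩)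
    isOpen_ball

theorem symm_apply (h : IsFramedChart I w A R φ) (hz : z ∈ ball 0 R) :
    h.toOpenPartialHomeomorph.symm (φ z) = z :=
  h.toOpenPartialHomeomorph.left_inv hz

/-- With `T` the adjoint of `A`, the map `T ∘ w ∘ φ` is a local diffeomorphism of the parameter
space. Composing its local inverse with the smooth map `T ∘ w` gives the inverse of `φ`. -/
theorem contMDiffOn_symm (h : IsFramedChart I w A R φ) :
    ContMDiffOn I (𝓡 m) ∞ h.toOpenPartialHomeomorph.symm h.toOpenPartialHomeomorph.target := by
  set e := h.toOpenPartialHomeomorph with he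
  rintro _ ⟨z₀, hz₀, rfl⟩
  set T : V →L[ℝ] 𝔼 := adjoint A.toContinuousLinearMap
  have hsm : ∀ z ∈ ball (0 : 𝔼) R, ContDiffAt ℝ ∞ (T ∘ (w ∘ φ)) z := fun z hz =>
    T.contDiff.contDiffAt.comp z (h.near.smooth z hz)
  obtain ⟨Φ, h1, h2, h3, h4⟩ := exists_openPartialHomeomorph_of_injective_fderiv isOpen_ball hsm hz₀
    (by
      have hd := T.hasFDerivAt.comp z₀ ((h.near.smooth z₀ hz₀).differentiableAt (by simp)).hasFDerivAt
      rw [hd.fderiv]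
      refine (injective_iff_map_eq_zero _).2 fun v hv => ?_
      have a := le_of_opNorm_le _ (h.near.near z₀ hz₀) v
      have b := norm_adjoint_isometry_apply_le A
        ((fderiv ℝ (w ∘ φ) z₀ - A.toContinuousLinearMap) v)
      have hv' : T (fderiv ℝ (w ∘ φ) z₀ v) = 0 := hv
      rw [sub_apply, map_sub, LinearIsometry.coe_toContinuousLinearMap,
        adjoint_isometry_apply, show adjoint A.toContinuousLinearMap (fderiv ℝ (w ∘ φ) z₀ v) = 0
        from hv', zero_sub, norm_neg] at b
      rw [sub_apply, LinearIsometry.coe_toContinuousLinearMap] at a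
      exact norm_eq_zero.1 (le_antisymm (by linarith) (norm_nonneg _)))
  have hmem : φ z₀ ∈ e.target := mem_image_of_mem φ hz₀
  have h5 : ContMDiffAt I (𝓡 m) ∞ (Φ.symm ∘ (T ∘ w)) (φ z₀) := by
    have a : ContMDiffAt I (𝓡 m) ∞ (T ∘ w) (φ z₀) :=
      (T.contDiff.contMDiff.comp h.smooth_map).contMDiffAt
    refine ContMDiffAt.comp (φ z₀) (ContDiffAt.contMDiffAt (h4 _ ?_)) a
    have : (T ∘ w) (φ z₀) = Φ z₀ := (h3 z₀).symm
    rw [this]; exact Φ.map_source h1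
  refine (h5.congr_of_eventuallyEq ?_).contMDiffWithinAt
  have hcont : ContinuousAt e.symm (φ z₀) := e.continuousAt_symm hmem
  have h6 : e.symm (φ z₀) = z₀ := h.symm_apply hz₀
  filter_upwards [hcont.preimage_mem_nhds (Φ.open_source.mem_nhds (h6.symm ▸ h1)),
    e.open_target.mem_nhds hmem] with y hy hy'
  have h7 : φ (e.symm y) = y := e.right_inv hy'
  have h8 : Φ (e.symm y) = (T ∘ w) y := by
    rw [h3, Function.comp_apply, Function.comp_apply, h7]; rfl
  rw [Function.comp_apply, ← h8]
  exact (Φ.left_inv hy).symm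

/-- Framed charts that meet in their middle parts contain each other's middle parts. -/
theorem image_subset_image [T2Space S] {B : 𝔼 →ₗᵢ[ℝ] V} {χ : 𝔼 → S}
    (hφ : IsFramedChart I w A 12 φ) (hχ : IsFramedChart I w B 12 χ)
    (hne : (φ '' ball 0 3 ∩ χ '' ball 0 3).Nonempty) :
    φ '' ball 0 3 ⊆ χ '' ball 0 10 := by
  obtain ⟨_, ⟨p₀, hp₀, rfl⟩, q₀, hq₀, hpq⟩ := hne
  have h3 : ball (0 : 𝔼) 3 ⊆ ball 0 12 := ball_subset_ball (by norm_num)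
  have h10 : ball (0 : 𝔼) 10 ⊆ ball 0 12 := ball_subset_ball (by norm_num)
  have hq₀n : ‖q₀‖ < 3 := by simpa using hq₀
  -- From `‖p - p₀‖ < 6` the two Lipschitz bounds give at most 6 · 101/99, which is below 13/2; and
  -- 3 + 13/2 is below 10.
  have key : ∀ p ∈ ball (0 : 𝔼) 3, ∀ q ∈ ball (0 : 𝔼) 12, χ q = φ p → ‖q - q₀‖ < 13 / 2 := by
    intro p hp q hq e
    have a := hχ.near.le_norm_sub hq (h3 hq₀)
    have b := hφ.near.norm_sub_le (h3 hp) (h3 hp₀)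
    simp only [Function.comp_apply, e, hpq] at a b
    have c : ‖p - p₀‖ < 6 := by
      have := norm_sub_le p p₀
      have hpn : ‖p‖ < 3 := by simpa using hp
      have hpn' : ‖p₀‖ < 3 := by simpa using hp₀
      linarith
    linarith
  have hcl : closedBall q₀ (13 / 2) ⊆ ball (0 : 𝔼) 10 := by
    intro q hq
    have a : ‖q - q₀‖ ≤ 13 / 2 := by simpa [dist_eq_norm] using hq
    have b := norm_le_norm_add_norm_sub' q q₀
    rw [mem_ball_zero_iff]; linarith
  set C := χ '' closedBall q₀ (13 / 2) with hC
  have hCc : IsClosed C := ((isCompact_closedBall q₀ _).image_of_continuousOn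
    (hχ.smooth.continuousOn.mono (hcl.trans h10))).isClosed
  have hO : IsOpen (χ '' ball 0 10) := hχ.isOpen_image isOpen_ball h10
  have hcont : ContinuousOn φ (ball 0 3) := hφ.smooth.continuousOn.mono h3
  -- The preimage of an open set equals that of a compact set, so it is open and closed in the
  -- connected ball; being nonempty, it is the whole ball.
  have hpre : ball (0 : 𝔼) 3 ∩ φ ⁻¹' (χ '' ball 0 10) = ball (0 : 𝔼) 3 ∩ φ ⁻¹' C := by
    ext p
    refine and_congr_right fun hp => ⟨?_, ?_⟩
    · rintro ⟨q, hq, e⟩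
      refine ⟨q, ?_, e⟩
      rw [mem_closedBall, dist_eq_norm]
      exact (key p hp q (h10 hq) e).le
    · rintro ⟨q, hq, e⟩
      exact ⟨q, hcl hq, e⟩
  have hconn : IsPreconnected (ball (0 : 𝔼) 3) := (convex_ball (0 : 𝔼) 3).isPreconnected
  rw [image_subset_iff]
  obtain ⟨U, hU, hUe⟩ := (continuousOn_iff'.1 hcont) _ hO
  obtain ⟨F, hF, hFe⟩ := (continuousOn_iff_isClosed.1 hcont) _ hCc
  have e1 : ball (0 : 𝔼) 3 ∩ U = ball (0 : 𝔼) 3 ∩ F := by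
    rw [inter_comm _ U, inter_comm _ F, ← hUe, ← hFe, inter_comm, hpre, inter_comm]
  have h0 : p₀ ∈ U := by
    have : p₀ ∈ φ ⁻¹' (χ '' ball 0 10) ∩ ball 0 3 :=
      ⟨⟨q₀, ball_subset_ball (by norm_num) hq₀, hpq⟩, hp₀⟩
    rw [hUe] at this; exact this.1
  have hsub : ball (0 : 𝔼) 3 ⊆ U := by
    by_contra hnot
    obtain ⟨p, hp, hpU⟩ := not_subset.1 hnot
    have hcov : ball (0 : 𝔼) 3 ⊆ U ∪ Fᶜ := fun x hx => by
      by_cases hxF : x ∈ F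
      · exact Or.inl ((e1.symm ▸ (⟨hx, hxF⟩ : x ∈ ball (0 : 𝔼) 3 ∩ F) :
          x ∈ ball (0 : 𝔼) 3 ∩ U)).2
      · exact Or.inr hxF
    obtain ⟨x, hx, hxU, hxF⟩ := hconn U Fᶜ hU hF.isOpen_compl hcov ⟨p₀, hp₀, h0⟩
      ⟨p, hp, fun hpF => hpU ((e1.symm ▸ (⟨hp, hpF⟩ : p ∈ ball (0 : 𝔼) 3 ∩ F) :
          p ∈ ball (0 : 𝔼) 3 ∩ U)).2⟩
    exact hxF ((e1 ▸ (⟨hx, hxU⟩ : x ∈ ball (0 : 𝔼) 3 ∩ U) : x ∈ ball (0 : 𝔼) 3 ∩ F)).2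
  intro p hp
  have : p ∈ U ∩ ball 0 3 := ⟨hsub hp, hp⟩
  rw [← hUe] at this
  exact this.1

end IsFramedChart

end FramedChart

/-! ### Open subsets as manifolds in the lowest universe. -/

section Parametrized

variable {m : ℕ} {H S : Type*} [TopologicalSpace H] [TopologicalSpace S] [ChartedSpace H S]
  {I : ModelWithCorners ℝ (EuclideanSpace ℝ (Fin m)) H}

local notation "𝔼" => EuclideanSpace ℝ (Fin m)

/-- The charted space structure on the domain of an open embedding that is given by
parametrizations of the target. -/
@[reducible]
noncomputable def pullbackChartedSpace {X : Type*} [TopologicalSpace X] {j : X → S}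
    (hj : IsOpenEmbedding j) (e : X → OpenPartialHomeomorph 𝔼 S)
    (he : ∀ x, j x ∈ (e x).target) : ChartedSpace 𝔼 X where
  atlas := range fun x =>
    haveI : Nonempty X := ⟨x⟩
    (hj.toOpenPartialHomeomorph j).trans (e x).symm
  chartAt x :=
    haveI : Nonempty X := ⟨x⟩
    (hj.toOpenPartialHomeomorph j).trans (e x).symm
  mem_chart_source x := by simpa using he x
  chart_mem_atlas x := mem_range_self x

/-- An open subset that is covered by parametrizations from a small family is a manifold modelled
on the whole vector space, in the lowest universe. -/
theorem exists_manifold_of_parametrizations {κ : Type} [T2Space S]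
    [SecondCountableTopology S] (e : κ → OpenPartialHomeomorph 𝔼 S)
    (he : ∀ i, ContMDiffOn (𝓡 m) I ∞ (e i) (e i).source)
    (he' : ∀ i, ContMDiffOn I (𝓡 m) ∞ (e i).symm (e i).target)
    {U : Set S} (hU : IsOpen U) (hcov : U ⊆ ⋃ i, (e i).target) :
    ∃ (X : Type) (_ : TopologicalSpace X) (_ : ChartedSpace 𝔼 X) (j : X → S),
      IsManifold (𝓡 m) ∞ X ∧ T2Space X ∧ SecondCountableTopology X ∧ IsOpenEmbedding j ∧
      range j = U ∧ ContMDiff (𝓡 m) I ∞ j ∧ ∀ x, Function.Injective (mfderiv (𝓡 m) I j x) := by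
  classical
  -- A point of `U` is determined by an index and a parameter vector.
  have hsmall : Small.{0} U := by
    have hex : ∀ x : U, ∃ q : κ × 𝔼, e q.1 q.2 = x := fun x => by
      obtain ⟨i, hi⟩ := mem_iUnion.1 (hcov x.2)
      exact ⟨(i, (e i).symm x), (e i).right_inv hi⟩
    choose F hF using hex
    exact small_of_injective (f := F) fun x y h => Subtype.ext (by rw [← hF x, ← hF y, h])
  let X := Shrink.{0} U
  let j : X → S := fun x => ((equivShrink U).symm x : S)
  let iT : TopologicalSpace X := TopologicalSpace.induced j inferInstance
  have hrange : range j = U := by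
    ext y
    constructor
    · rintro ⟨x, rfl⟩; exact Subtype.coe_prop _
    · intro hy; exact ⟨equivShrink U ⟨y, hy⟩, by simp [j]⟩
  have hj : IsOpenEmbedding j :=
    ⟨⟨⟨rfl⟩, Subtype.coe_injective.comp (equivShrink U).symm.injective⟩, by rw [hrange]; exact hU⟩
  have hex : ∀ x : X, ∃ i, j x ∈ (e i).target := fun x =>
    mem_iUnion.1 (hcov (hrange ▸ mem_range_self x))
  choose c hc using hex
  let iC : ChartedSpace 𝔼 X := pullbackChartedSpace hj (fun x => e (c x)) hc
  have hchart : ∀ x y : X, chartAt 𝔼 x y = (e (c x)).symm (j y) := fun x y => rfl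
  have hsource : ∀ x y : X, y ∈ (chartAt 𝔼 x).source ↔ j y ∈ (e (c x)).target := fun x y => by
    have : Nonempty X := ⟨x⟩
    change y ∈ ((hj.toOpenPartialHomeomorph j).trans (e (c x)).symm).source ↔ _
    simp
  have hsymm : ∀ x : X, ∀ z ∈ (chartAt 𝔼 x).target, z ∈ (e (c x)).source ∧
      j ((chartAt 𝔼 x).symm z) = e (c x) z := fun x z hz => by
    have h1 := (chartAt 𝔼 x).map_target hz
    rw [hsource] at h1
    have h2 : (e (c x)).symm (j ((chartAt 𝔼 x).symm z)) = z := (chartAt 𝔼 x).right_inv hz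
    have h3 := (e (c x)).map_target h1
    have h4 := (e (c x)).right_inv h1
    rw [h2] at h3 h4
    exact ⟨h3, h4.symm⟩
  have hM : IsManifold (𝓡 m) ∞ X := by
    refine isManifold_of_contDiffOn (𝓡 m) ∞ X ?_
    rintro _ _ ⟨x, rfl⟩ ⟨y, rfl⟩
    have h1 : ContMDiffOn (𝓡 m) (𝓡 m) ∞ ((e (c y)).symm ∘ e (c x))
        ((e (c x)).source ∩ e (c x) ⁻¹' (e (c y)).target) :=
      (he' (c y)).comp ((he (c x)).mono inter_subset_left) fun z hz => hz.2
    have key : ∀ z ∈ ((chartAt 𝔼 x).symm.trans (chartAt 𝔼 y)).source,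
        z ∈ (e (c x)).source ∩ e (c x) ⁻¹' (e (c y)).target ∧
        chartAt 𝔼 y ((chartAt 𝔼 x).symm z) = ((e (c y)).symm ∘ e (c x)) z := by
      rintro z ⟨hz1, hz2⟩
      have h2 := hsymm x z hz1
      have hz2' : j ((chartAt 𝔼 x).symm z) ∈ (e (c y)).target := (hsource y _).1 hz2
      rw [h2.2] at hz2'
      exact ⟨⟨h2.1, hz2'⟩, by rw [hchart, h2.2]; rfl⟩
    exact (h1.contDiffOn.mono fun z hz => (key z hz.1).1).congr fun z hz => (key z hz.1).2
  have hjs : ContMDiff (𝓡 m) I ∞ j := by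
    intro x
    have h1 : ContMDiffOn (𝓡 m) I ∞ (e (c x) ∘ chartAt 𝔼 x) (chartAt 𝔼 x).source :=
      (he (c x)).comp (contMDiffOn_chart) fun y hy =>
        (hsymm x _ ((chartAt 𝔼 x).map_source hy)).1
    refine (h1.contMDiffAt ((chartAt 𝔼 x).open_source.mem_nhds
      (mem_chart_source 𝔼 x))).congr_of_eventuallyEq ?_
    filter_upwards [(chartAt 𝔼 x).open_source.mem_nhds (mem_chart_source 𝔼 x)] with y hy
    exact ((e (c x)).right_inv ((hsource x y).1 hy)).symm
  refine ⟨X, iT, iC, j, hM, hj.isEmbedding.t2Space, hj.isEmbedding.secondCountableTopology, hj,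
    hrange, hjs, fun x => ?_⟩
  have h2 : mfderiv (𝓡 m) (𝓡 m) ((e (c x)).symm ∘ j) x
      = mfderiv (𝓡 m) (𝓡 m) (extChartAt (𝓡 m) x) x := by
    congr 1
  have h3 := mfderiv_comp x (I := 𝓡 m) (I' := I) (I'' := 𝓡 m) (g := (e (c x)).symm) (f := j)
    (((he' (c x)).contMDiffAt ((e (c x)).open_target.mem_nhds (hc x))).mdifferentiableAt (by simp))
    ((hjs x).mdifferentiableAt (by simp))
  rw [h2] at h3
  have h4 := (isInvertible_mfderiv_extChartAt (I := 𝓡 m) (mem_extChartAt_source x)).injective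
  rw [h3] at h4
  exact Function.Injective.of_comp h4

end Parametrized

/-! ### The normal condition in chart-free form. -/

section OpenPartial

open Metric

variable {m : ℕ} {H S : Type*} [TopologicalSpace H] [TopologicalSpace S] [ChartedSpace H S]
  {V : Type} [NormedAddCommGroup V] [InnerProductSpace ℝ V] [FiniteDimensional ℝ V]
  {I : ModelWithCorners ℝ (EuclideanSpace ℝ (Fin m)) H} {w : S → V}
  {A : EuclideanSpace ℝ (Fin m) →ₗᵢ[ℝ] V} {R : ℝ} {φ : EuclideanSpace ℝ (Fin m) → S}
  {p z : EuclideanSpace ℝ (Fin m)} [IsManifold I ∞ S]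

theorem IsFramedChart.mfderiv_symm_injective (h : IsFramedChart I w A R φ) (hz : z ∈ ball 0 R) :
    Function.Injective (mfderiv I (𝓡 m) h.toOpenPartialHomeomorph.symm (φ z)) := by
  set e := h.toOpenPartialHomeomorph
  have hmem : φ z ∈ e.target := mem_image_of_mem φ hz
  have hes := h.contMDiffOn_symm.contMDiffAt (e.open_target.mem_nhds hmem)
  have h1 : e.symm (φ z) = z := h.symm_apply hz
  have h2 : φ ∘ e.symm =ᶠ[𝓝 (φ z)] id := by
    filter_upwards [e.open_target.mem_nhds hmem] with y hy using e.right_inv hy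
  have h3 := mfderiv_comp (φ z) (I := I) (I' := 𝓡 m) (I'' := I) (g := φ) (f := e.symm)
    (by rw [h1]; exact (h.contMDiffAt hz).mdifferentiableAt (by simp))
    (hes.mdifferentiableAt (by simp))
  rw [h2.mfderiv_eq, mfderiv_id] at h3
  have h4 : Function.Injective (ContinuousLinearMap.id ℝ (TangentSpace I (φ z))) :=
    fun _ _ h => h
  rw [h3] at h4
  exact Function.Injective.of_comp h4

/-- Since the differential of `φ` is onto, the tangent space of `w ∘ φ` at `p` is the range of the
differential of `w` at `φ p`. The condition thus depends on the point and not on the chart, which is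
what allows gluing. -/
theorem IsFramedChart.tangentDefect_eq_zero_iff (h : IsFramedChart I w A R φ)
    (hp : p ∈ ball 0 R) {f : EuclideanSpace ℝ (Fin m) → V} :
    tangentDefect (w ∘ φ) f p z = 0 ↔
      ∀ v, inner ℝ (f z - w (φ p)) (mfderiv I 𝓘(ℝ, V) w (φ p) v : V) = 0 := by
  rw [tangentDefect]
  constructor
  · intro h0 v
    obtain ⟨u, rfl⟩ := h.mfderiv_surjective hp v
    have key : ∀ u : EuclideanSpace ℝ (Fin m),
        inner ℝ (f z - w (φ p)) (fderiv ℝ (w ∘ φ) p u) = 0 := fun u => by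
      rw [← ContinuousLinearMap.adjoint_inner_left]
      have h2 : f z - w (φ p) = f z - (w ∘ φ) p := rfl
      rw [h2, h0, inner_zero_left]
    have h2 := key u
    rw [h.fderiv_comp_eq hp] at h2
    exact h2
  · intro h0
    refine ext_inner_right ℝ fun u => ?_
    rw [ContinuousLinearMap.adjoint_inner_left, inner_zero_left, h.fderiv_comp_eq hp]
    exact h0 _

end OpenPartial

/-! ### Gluing the normal projections to embeddings. -/

section Glue

open Metric

variable {m : ℕ} {ι : Type} {H S : ℕ → Type*} [∀ k, TopologicalSpace (H k)]
  [∀ k, TopologicalSpace (S k)] [∀ k, ChartedSpace (H k) (S k)]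
  {V : Type} [NormedAddCommGroup V] [InnerProductSpace ℝ V] [FiniteDimensional ℝ V]
  {I : ∀ k, ModelWithCorners ℝ (EuclideanSpace ℝ (Fin m)) (H k)} {w : ∀ k, S k → V}
  {A : ι → EuclideanSpace ℝ (Fin m) →ₗᵢ[ℝ] V} {φ : ι → ∀ k, EuclideanSpace ℝ (Fin m) → S k}
  {f : ι → EuclideanSpace ℝ (Fin m) → V}

local notation "𝔼" => EuclideanSpace ℝ (Fin m)

/-- Families of framed charts of a sequence of manifolds that converge, stay close to each other,
and have the same overlap pattern for all members of the sequence. -/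
structure FramedSequence (I : ∀ k, ModelWithCorners ℝ (EuclideanSpace ℝ (Fin m)) (H k))
    (w : ∀ k, S k → V) (A : ι → EuclideanSpace ℝ (Fin m) →ₗᵢ[ℝ] V)
    (φ : ι → ∀ k, EuclideanSpace ℝ (Fin m) → S k) (f : ι → EuclideanSpace ℝ (Fin m) → V) :
    Prop where
  chart : ∀ i k, IsFramedChart (I k) (w k) (A i) 12 (φ i k)
  limit : ∀ i, NearIsometry (A i) 12 (f i)
  close : ∀ i k l, ∀ z ∈ ball (0 : EuclideanSpace ℝ (Fin m)) 12,
    ‖w k (φ i k z) - w l (φ i l z)‖ ≤ 1 / 100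
  close_limit : ∀ i k, ∀ z ∈ ball (0 : EuclideanSpace ℝ (Fin m)) 12,
    ‖f i z - w k (φ i k z)‖ ≤ 1 / 100
  conv : ∀ i, ∀ z ∈ ball (0 : EuclideanSpace ℝ (Fin m)) 12, ∀ n,
    ConvC n atTop (fun k => w k ∘ φ i k) (f i) z
  pattern : ∀ i j k l, (φ i k '' ball 0 3 ∩ φ j k '' ball 0 3).Nonempty →
    (φ i l '' ball 0 3 ∩ φ j l '' ball 0 3).Nonempty

namespace FramedSequence

variable [∀ k, IsManifold (I k) ∞ (S k)] [∀ k, T2Space (S k)] {i j : ι} {k : ℕ}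
  {p q z : EuclideanSpace ℝ (Fin m)}

theorem nearPair (h : FramedSequence I w A φ f) (i : ι) (k : ℕ) :
    NearPair (A i) 12 (w 0 ∘ φ i 0) (w k ∘ φ i k) :=
  ⟨(h.chart i 0).near, (h.chart i k).near, fun z hz => h.close i k 0 z hz⟩

theorem nearPair_limit (h : FramedSequence I w A φ f) (i : ι) :
    NearPair (A i) 12 (w 0 ∘ φ i 0) (f i) :=
  ⟨(h.chart i 0).near, h.limit i, fun z hz => h.close_limit i 0 z hz⟩

theorem normalParam_mem_ball (h : FramedSequence I w A φ f) (i : ι) (k : ℕ)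
    (hp : p ∈ ball 0 2) : normalParam 12 (w 0 ∘ φ i 0) (w k ∘ φ i k) p ∈ ball (0 : 𝔼) 3 := by
  have h1 := ((h.nearPair i k).normalParam_spec
    (ball_subset_ball (by norm_num) hp)).1
  exact NearPair.closedBall_subset (s := 1 / 2) (ball_subset_ball (by norm_num) hp) h1

theorem tangentDefect_transfer (h : FramedSequence I w A φ f) {p' q' : 𝔼} (hp : p ∈ ball 0 12)
    (hq : q ∈ ball 0 12) (h0 : φ i 0 p = φ j 0 q) (hk : φ i k p' = φ j k q')
    (hz : tangentDefect (w 0 ∘ φ i 0) (w k ∘ φ i k) p p' = 0) :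
    tangentDefect (w 0 ∘ φ j 0) (w k ∘ φ j k) q q' = 0 := by
  rw [(h.chart j 0).tangentDefect_eq_zero_iff hq, ← h0]
  rw [(h.chart i 0).tangentDefect_eq_zero_iff hp] at hz
  simpa only [Function.comp_apply, hk] using hz

/-- The pattern makes the charts `i` and `j` meet in `S k` too, so the point found by chart `i` has
a parameter in the ball of radius 10 of chart `j`. That parameter satisfies the normal condition at
`q`, and uniqueness finishes. -/
theorem glue_eq (h : FramedSequence I w A φ f) (hp : p ∈ ball 0 2) (hq : q ∈ ball 0 2)
    (h0 : φ i 0 p = φ j 0 q) (k : ℕ) :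
    φ i k (normalParam 12 (w 0 ∘ φ i 0) (w k ∘ φ i k) p)
      = φ j k (normalParam 12 (w 0 ∘ φ j 0) (w k ∘ φ j k) q) := by
  have h23 : ball (0 : 𝔼) 2 ⊆ ball 0 3 := ball_subset_ball (by norm_num)
  have h2 : ball (0 : 𝔼) 2 ⊆ ball 0 12 := ball_subset_ball (by norm_num)
  have hpat := h.pattern i j 0 k ⟨_, mem_image_of_mem _ (h23 hp), q, h23 hq, h0.symm⟩
  obtain ⟨q', hq', e⟩ := (h.chart i k).image_subset_image (h.chart j k) hpat
    (mem_image_of_mem _ (h.normalParam_mem_ball i k hp))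
  rw [← e]
  congr 1
  refine (h.nearPair j k).eq_normalParam (ball_subset_ball (by norm_num) hq)
    (ball_subset_ball (by norm_num) hq') ?_
  exact h.tangentDefect_transfer (h2 hp) (h2 hq) h0 e.symm
    ((h.nearPair i k).normalParam_spec (ball_subset_ball (by norm_num) hp)).2

/-- The pattern is now used from `S k` back to `S 0`: chart `j` reaches `φ i 0 p` at some `q'`,
which has the same normal parameter as `q`. Both lie where `normalParam` is injective. -/
theorem glue_injective (h : FramedSequence I w A φ f) (hp : p ∈ ball 0 2) (hq : q ∈ ball 0 2)
    (e : φ i k (normalParam 12 (w 0 ∘ φ i 0) (w k ∘ φ i k) p)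
      = φ j k (normalParam 12 (w 0 ∘ φ j 0) (w k ∘ φ j k) q)) :
    φ i 0 p = φ j 0 q := by
  have h23 : ball (0 : 𝔼) 2 ⊆ ball 0 3 := ball_subset_ball (by norm_num)
  have h2 : ball (0 : 𝔼) 2 ⊆ ball 0 12 := ball_subset_ball (by norm_num)
  have hpat := h.pattern i j k 0 ⟨_, mem_image_of_mem _ (h.normalParam_mem_ball i k hp), _,
    h.normalParam_mem_ball j k hq, e.symm⟩
  obtain ⟨q', hq', e'⟩ := (h.chart i 0).image_subset_image (h.chart j 0) hpat
    (mem_image_of_mem _ (h23 hp))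
  rw [← e']
  congr 1
  have hq'' : q' ∈ ball (0 : 𝔼) (12 - 1 / 2) := ball_subset_ball (by norm_num) hq'
  have hq2 : q ∈ ball (0 : 𝔼) (12 - 1 / 2) := ball_subset_ball (by norm_num) hq
  refine (h.nearPair j k).normalParam_injOn hq'' hq2 (Eq.symm ?_)
  refine (h.nearPair j k).eq_normalParam hq'' ((h.nearPair j k).normalParam_mem hq2) ?_
  exact h.tangentDefect_transfer (h2 hp) (ball_subset_ball (by norm_num) hq') e'.symm e
    ((h.nearPair i k).normalParam_spec (ball_subset_ball (by norm_num) hp)).2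

/-- Normal projection moves parameters by at most 1/2, so every point of a unit ball is hit from the
closed ball of radius 3/2, which the compact domain contains. The last clause describes the
embeddings by convergent parameter maps, on full neighbourhoods even at boundary points. -/
theorem exists_gluing [Finite ι] [∀ k, SecondCountableTopology (S k)]
    (h : FramedSequence I w A φ f) :
    ∃ (Ht St : Type) (_ : TopologicalSpace Ht) (_ : TopologicalSpace St) (_ : ChartedSpace Ht St)
      (It : ModelWithCorners ℝ 𝔼 Ht),
      IsHalfSpaceModel It ∧ IsManifold It ∞ St ∧ T2Space St ∧ SecondCountableTopology St ∧
      CompactSpace St ∧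
      ∃ ψ : ∀ k, St → S k, (∀ k, IsSmoothEmb It (I k) (ψ k)) ∧
        (∀ i k, φ i k '' ball 0 1 ⊆ range (ψ k)) ∧
        ∀ p : St, ∀ z ∈ (extChartAt It p).target, ∃ (i : ι) (Θ : ℕ → 𝔼 → 𝔼) (Θ' : 𝔼 → 𝔼),
          ∀ᶠ z' in 𝓝 z, (∀ n, ConvC n atTop Θ Θ' z') ∧ Θ' z' ∈ ball (0 : 𝔼) 12 ∧
            (z' ∈ (extChartAt It p).target → ∀ k,
              ψ k ((extChartAt It p).symm z') = φ i k (Θ k z')) := by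
  classical
  have h23 : ball (0 : 𝔼) 2 ⊆ ball 0 3 := ball_subset_ball (by norm_num)
  have h2 : ball (0 : 𝔼) 2 ⊆ ball 0 12 := ball_subset_ball (by norm_num)
  have h2' : ball (0 : 𝔼) 2 ⊆ ball 0 (12 - 1 / 2) := ball_subset_ball (by norm_num)
  have hO : ∀ i, IsOpen (φ i 0 '' ball 0 2) := fun i => (h.chart i 0).isOpen_image isOpen_ball h2
  let e := fun i => (h.chart i 0).toOpenPartialHomeomorph
  obtain ⟨X, _, _, j, hXM, _, _, hj, hrange, hjs, hjd⟩ := exists_manifold_of_parametrizations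
    (I := I 0) e (fun i => (h.chart i 0).smooth) (fun i => (h.chart i 0).contMDiffOn_symm)
    (isOpen_iUnion hO) (iUnion_mono fun i => image_mono h2)
  have hex : ∀ x, ∃ i, j x ∈ φ i 0 '' ball 0 2 := fun x =>
    mem_iUnion.1 (hrange ▸ mem_range_self x)
  choose c hc using hex
  let θ := fun i k => normalParam 12 (w 0 ∘ φ i 0) (w k ∘ φ i k)
  let ψ : ∀ k, X → S k := fun k x => φ (c x) k (θ (c x) k ((e (c x)).symm (j x)))
  have hesymm : ∀ i, ∀ p ∈ ball (0 : 𝔼) 2, (e i).symm (φ i 0 p) = p := fun i p hp =>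
    (h.chart i 0).symm_apply (h2 hp)
  -- By `glue_eq` the arbitrary choice `c x` of a chart does not matter, so `ψ k` has the smooth
  -- local form of any chart.
  have hψ : ∀ k x i p, p ∈ ball (0 : 𝔼) 2 → j x = φ i 0 p → ψ k x = φ i k (θ i k p) := by
    intro k x i p hp hx
    obtain ⟨q, hq, hqx⟩ := hc x
    change φ (c x) k (θ (c x) k ((e (c x)).symm (j x))) = _
    rw [← hqx, hesymm _ q hq]
    exact h.glue_eq hq hp (hqx.trans hx) k
  have hψloc : ∀ k x i, j x ∈ φ i 0 '' ball 0 2 →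
      ψ k =ᶠ[𝓝 x] φ i k ∘ θ i k ∘ (e i).symm ∘ j := by
    intro k x i hx
    filter_upwards [hj.continuous.continuousAt.preimage_mem_nhds ((hO i).mem_nhds hx)] with y hy
    obtain ⟨p, hp, hpy⟩ := hy
    rw [hψ k y i p hp hpy.symm]
    simp only [Function.comp_apply, ← hpy, hesymm i p hp]
  have hθs : ∀ i k, ∀ p ∈ ball (0 : 𝔼) 2, ContMDiffAt (𝓡 m) (𝓡 m) ∞ (θ i k) p := fun i k p hp =>
    ((h.nearPair i k).contDiffAt_normalParam (h2' hp)).contMDiffAt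
  have hes : ∀ i, ∀ p ∈ ball (0 : 𝔼) 2, ContMDiffAt (I 0) (𝓡 m) ∞ (e i).symm (φ i 0 p) :=
    fun i p hp => (h.chart i 0).contMDiffOn_symm.contMDiffAt
      ((e i).open_target.mem_nhds (mem_image_of_mem _ (h2 hp)))
  have hinner : ∀ x i p, p ∈ ball (0 : 𝔼) 2 → j x = φ i 0 p →
      ContMDiffAt (𝓡 m) (𝓡 m) ∞ ((e i).symm ∘ j) x := fun x i p hp hx =>
    ContMDiffAt.comp x (by rw [hx]; exact hes i p hp) hjs.contMDiffAt
  have hinner' : ∀ x i p, p ∈ ball (0 : 𝔼) 2 → j x = φ i 0 p → ∀ k,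
      ContMDiffAt (𝓡 m) (𝓡 m) ∞ (θ i k ∘ (e i).symm ∘ j) x := fun x i p hp hx k =>
    ContMDiffAt.comp x (by
      rw [Function.comp_apply, hx, hesymm i p hp]; exact hθs i k p hp) (hinner x i p hp hx)
  have hφs : ∀ x i p, p ∈ ball (0 : 𝔼) 2 → j x = φ i 0 p → ∀ k,
      ContMDiffAt (𝓡 m) (I k) ∞ (φ i k) ((θ i k ∘ (e i).symm ∘ j) x) := fun x i p hp hx k => by
    simp only [Function.comp_apply, hx, hesymm i p hp]
    exact (h.chart i k).contMDiffAt (ball_subset_ball (by norm_num)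
      (h.normalParam_mem_ball i k hp))
  have hψs : ∀ k, ContMDiff (𝓡 m) (I k) ∞ (ψ k) := fun k x => by
    obtain ⟨p, hp, hpx⟩ := hc x
    exact (ContMDiffAt.comp x (hφs x _ p hp hpx.symm k)
      (hinner' x _ p hp hpx.symm k)).congr_of_eventuallyEq (hψloc k x (c x) (hc x))
  have hψd : ∀ k x, Function.Injective (mfderiv (𝓡 m) (I k) (ψ k) x) := fun k x => by
    obtain ⟨p, hp, hpx⟩ := hc x
    have hx := hpx.symm
    have hval0 : (e (c x)).symm (j x) ∈ ball (0 : 𝔼) 2 := by rw [hx, hesymm _ p hp]; exact hp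
    rw [(hψloc k x (c x) (hc x)).mfderiv_eq,
      mfderiv_comp x ((hφs x _ p hp hx k).mdifferentiableAt (by simp))
        ((hinner' x _ p hp hx k).mdifferentiableAt (by simp)),
      mfderiv_comp x (g := θ (c x) k) (I' := 𝓡 m) (by
        rw [Function.comp_apply, hx, hesymm _ p hp]
        exact (hθs _ k p hp).mdifferentiableAt (by simp))
        ((hinner x _ p hp hx).mdifferentiableAt (by simp)),
      mfderiv_comp x (g := (e (c x)).symm) (I' := I 0) (by
        rw [hx]; exact (hes _ p hp).mdifferentiableAt (by simp))
        (hjs.mdifferentiableAt (by simp))]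
    refine Function.Injective.comp (g := mfderiv (𝓡 m) (I k) (φ (c x) k) _) ?_
      (Function.Injective.comp (g := mfderiv (𝓡 m) (𝓡 m) (θ (c x) k) _) ?_
      (Function.Injective.comp (g := mfderiv (I 0) (𝓡 m) (e (c x)).symm _) ?_ (hjd x)))
    · exact (h.chart _ k).mfderiv_injective (ball_subset_ball (by norm_num)
        (h.normalParam_mem_ball _ k hval0))
    · rw [mfderiv_eq_fderiv]
      exact (h.nearPair _ k).fderiv_normalParam_injective (h2' hval0)
    · rw [hx]
      exact (h.chart _ 0).mfderiv_symm_injective (h2 hp)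
  have hψinj : ∀ k, Function.Injective (ψ k) := fun k x y hxy => by
    obtain ⟨p, hp, hpx⟩ := hc x
    obtain ⟨q, hq, hqy⟩ := hc y
    rw [hψ k x _ p hp hpx.symm, hψ k y _ q hq hqy.symm] at hxy
    have := h.glue_injective hp hq hxy
    rw [hpx, hqy] at this
    exact hj.injective this
  set C : Set X := ⋃ i, j ⁻¹' (φ i 0 '' closedBall 0 (3 / 2)) with hC
  have hcb : closedBall (0 : 𝔼) (3 / 2) ⊆ ball 0 2 := closedBall_subset_ball (by norm_num)
  have hCc : IsCompact C := by
    refine isCompact_iUnion fun i => hj.isInducing.isCompact_preimage' ?_ ?_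
    · exact (isCompact_closedBall _ _).image_of_continuousOn
        ((h.chart i 0).smooth.continuousOn.mono (hcb.trans h2))
    · rw [hrange]
      exact (image_mono hcb).trans (subset_iUnion (fun i => φ i 0 '' ball 0 2) i)
  obtain ⟨Ht, T, _, _, It, hIt, hTM, hTc, hCT, hval, hvald, hchart⟩ :=
    exists_compact_domain (m := m) hCc
  have hTcs : CompactSpace T := isCompact_iff_compactSpace.1 hTc
  have hemb : ∀ k, ContMDiff It (I k) ∞ (ψ k ∘ ((↑) : T → X)) := fun k => (hψs k).comp hval
  refine ⟨Ht, T, inferInstance, inferInstance, inferInstance, It, hIt, hTM, inferInstance,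
    inferInstance, hTcs, fun k => ψ k ∘ ((↑) : T → X), fun k => ⟨hemb k, fun x => ?_, ?_⟩,
    ?_, ?_⟩
  · rw [mfderiv_comp x ((hψs k).mdifferentiableAt (by simp)) (hval.mdifferentiableAt (by simp))]
    exact Function.Injective.comp (g := mfderiv (𝓡 m) (I k) (ψ k) x) (hψd k x) (hvald x)
  · exact ((hemb k).continuous.isClosedEmbedding
      ((hψinj k).comp Subtype.coe_injective)).isEmbedding
  · rintro i k _ ⟨z, hz, rfl⟩
    obtain ⟨p, hp, hpz⟩ := (h.nearPair i k).exists_normalParam_eq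
      (ball_subset_ball (by norm_num) hz)
    have hp32 : p ∈ closedBall (0 : 𝔼) (3 / 2) := by
      have a : dist p 0 ≤ dist p z + dist z 0 := dist_triangle _ _ _
      rw [mem_closedBall] at hp ⊢
      rw [mem_ball] at hz
      linarith
    obtain ⟨x, hx⟩ : φ i 0 p ∈ range j := by
      rw [hrange]; exact mem_iUnion.2 ⟨i, mem_image_of_mem _ (hcb hp32)⟩
    have hxC : x ∈ C := mem_iUnion.2 ⟨i, p, hp32, hx.symm⟩
    refine ⟨⟨x, hCT hxC⟩, ?_⟩
    change ψ k x = φ i k z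
    rw [hψ k x i p (hcb hp32) hx]
    exact congrArg _ hpz
  · intro p z hz
    obtain ⟨Φ, hΦs, hΦ⟩ := hchart p
    have hzΦ := (hΦ z hz).1
    set i := c (Φ.symm z) with hi
    let g : 𝔼 → 𝔼 := (e i).symm ∘ j ∘ Φ.symm
    have hnear : ∀ᶠ z' in 𝓝 z, z' ∈ Φ.target ∧ j (Φ.symm z') ∈ φ i 0 '' ball 0 2 := by
      refine Filter.Eventually.and (Φ.open_target.mem_nhds hzΦ) ?_
      have : ContinuousAt (j ∘ Φ.symm) z :=
        hj.continuous.continuousAt.comp (Φ.continuousAt_symm hzΦ)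
      exact this.preimage_mem_nhds ((hO i).mem_nhds (hc _))
    have hgs : ∀ᶠ z' in 𝓝 z, ContDiffAt ℝ ∞ g z' := by
      filter_upwards [hnear] with z' hz'
      obtain ⟨hz1, p', hp', hpz'⟩ := hz'
      refine ContMDiffAt.contDiffAt ?_
      exact ContMDiffAt.comp z' (g := (e i).symm ∘ j) (f := Φ.symm) (I' := 𝓡 m)
        (hinner _ i p' hp' hpz'.symm) (hΦs.contMDiffAt (Φ.open_target.mem_nhds hz1))
    refine ⟨i, fun k => θ i k ∘ g, normalParam 12 (w 0 ∘ φ i 0) (f i) ∘ g, ?_⟩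
    filter_upwards [hnear, hgs.eventually_nhds] with z' hz' hgz'
    obtain ⟨hz1, p', hp', hpz'⟩ := hz'
    have hgp : g z' = p' := by
      change (e i).symm (j (Φ.symm z')) = p'
      rw [← hpz', hesymm i p' hp']
    refine ⟨fun n => ?_, ?_, fun hzt k => ?_⟩
    · have := convC_normalParam (fun k => h.nearPair i k) (h.nearPair_limit i)
        (p := g z') (by rw [hgp]; exact h2' hp') (h.conv i) n
      exact ConvC.comp_right (a := fun k => θ i k) this hgz'
    · rw [Function.comp_apply, hgp]
      exact (h.nearPair_limit i).normalParam_mem (h2' hp')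
    · have h1 := (hΦ z' hzt).2
      simp only [Function.comp_apply, h1]
      rw [hψ k _ i p' hp' hpz'.symm, hgp]

end FramedSequence

end Glue

/-! ### Joint convergence of maps into a manifold. -/

section ConvergenceInManifolds

variable {m d : ℕ} {ι : Type*} {l : Filter ι} {G M : Type*} [TopologicalSpace G]
  [TopologicalSpace M] [ChartedSpace G M] {J : ModelWithCorners ℝ (EuclideanSpace ℝ (Fin d)) G}

local notation "𝔼" => EuclideanSpace ℝ (Fin m)

theorem ConvC.comp_tendsto {E F : Type} [NormedAddCommGroup E] [NormedSpace ℝ E]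
    [NormedAddCommGroup F] [NormedSpace ℝ F] {n : ℕ} {f : ι → E → F} {g : E → F} {x : E}
    {κ : Type*} {l' : Filter κ} {σ : κ → ι} (hσ : Tendsto σ l' l) (h : ConvC n l f g x) :
    ConvC n l' (fun k => f (σ k)) g x := by
  have hq : Tendsto (fun q : κ × E => (σ q.1, q.2)) (l' ×ˢ 𝓝 x) (l ×ˢ 𝓝 x) :=
    (hσ.comp tendsto_fst).prodMk tendsto_snd
  exact ⟨hq.eventually h.smooth, h.smooth_limit, fun j hj => (h.tendsto j hj).comp hq⟩

/-- Continuous convergence at the point `x` of all derivatives, in charts of the target, of a family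
of maps from a Euclidean space to a manifold. -/
structure ConvInto (J : ModelWithCorners ℝ (EuclideanSpace ℝ (Fin d)) G) (l : Filter ι)
    (f : ι → EuclideanSpace ℝ (Fin m) → M) (v : EuclideanSpace ℝ (Fin m) → M)
    (x : EuclideanSpace ℝ (Fin m)) : Prop where
  smooth_limit : ContMDiffAt (𝓡 m) J ∞ v x
  mem_source : ∀ q, v x ∈ (chartAt G q).source →
    ∀ᶠ p in l ×ˢ 𝓝 x, f p.1 p.2 ∈ (chartAt G q).source
  conv : ∀ q, v x ∈ (chartAt G q).source →
    ∀ n, ConvC n l (fun k => extChartAt J q ∘ f k) (extChartAt J q ∘ v) x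

namespace ConvInto

variable {f : ι → EuclideanSpace ℝ (Fin m) → M} {v : EuclideanSpace ℝ (Fin m) → M}
  {x : EuclideanSpace ℝ (Fin m)}

theorem tendsto (h : ConvInto J l f v x) :
    Tendsto (fun p : ι × 𝔼 => f p.1 p.2) (l ×ˢ 𝓝 x) (𝓝 (v x)) := by
  have hx := mem_chart_source G (v x)
  have h1 := (h.conv _ hx 0).apply
  have h2 := (continuousAt_extChartAt_symm (I := J) (v x)).tendsto.comp h1
  rw [extChartAt_to_inv] at h2
  refine h2.congr' ?_
  filter_upwards [h.mem_source _ hx] with p hp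
  exact (extChartAt J (v x)).left_inv (by rwa [extChartAt_source])

theorem tendsto_apply (h : ConvInto J l f v x) : Tendsto (fun k => f k x) l (𝓝 (v x)) :=
  h.tendsto.comp (tendsto_id.prodMk tendsto_const_nhds)

theorem comp_tendsto {κ : Type*} {l' : Filter κ} {σ : κ → ι} (hσ : Tendsto σ l' l)
    (h : ConvInto J l f v x) : ConvInto J l' (fun k => f (σ k)) v x :=
  ⟨h.smooth_limit, fun q hq =>
    ((hσ.comp tendsto_fst).prodMk tendsto_snd).eventually (h.mem_source q hq),
    fun q hq n => ConvC.comp_tendsto (f := fun k => extChartAt J q ∘ f k) hσ (h.conv q hq n)⟩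

theorem comp {Θ : ι → EuclideanSpace ℝ (Fin m) → EuclideanSpace ℝ (Fin m)}
    {Θ' : EuclideanSpace ℝ (Fin m) → EuclideanSpace ℝ (Fin m)}
    (h : ConvInto J l f v (Θ' x)) (hΘ : ∀ n, ConvC n l Θ Θ' x) :
    ConvInto J l (fun k => f k ∘ Θ k) (v ∘ Θ') x := by
  refine ⟨h.smooth_limit.comp x (hΘ 0).smooth_limit.self_of_nhds.contMDiffAt, fun q hq => ?_,
    fun q hq n => ?_⟩
  · exact (hΘ 0).tendsto_prodMk.eventually (h.mem_source q hq)
  · exact ConvC.comp (a := fun k => extChartAt J q ∘ f k) (b := extChartAt J q ∘ v) (h.conv q hq n) (hΘ n)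

theorem comp_contDiff {g : EuclideanSpace ℝ (Fin m) → EuclideanSpace ℝ (Fin m)}
    (h : ConvInto J l f v (g x)) (hg : ContDiff ℝ ∞ g) :
    ConvInto J l (fun k => f k ∘ g) (v ∘ g) x :=
  h.comp fun _ => ConvC.const (Eventually.of_forall fun _ => hg.contDiffAt)

/-- Composition with a smooth map on the target, at a limit point in the interior. -/
theorem comp_left [IsManifold J ∞ M] {V : Type} [NormedAddCommGroup V] [NormedSpace ℝ V]
    {e : M → V} (he : ContMDiff J 𝓘(ℝ, V) ∞ e) (h : ConvInto J l f v x)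
    (hx : v x ∈ J.interior M) (n : ℕ) : ConvC n l (fun k => e ∘ f k) (e ∘ v) x := by
  have hs := mem_chart_source G (v x)
  have h1 : ∀ᶠ z in 𝓝 (extChartAt J (v x) (v x)),
      ContDiffAt ℝ ∞ (e ∘ (extChartAt J (v x)).symm) z := by
    have hint : interior (extChartAt J (v x)).target ∈ 𝓝 (extChartAt J (v x) (v x)) :=
      isOpen_interior.mem_nhds (J.isInteriorPoint_iff.1 hx)
    filter_upwards [hint] with z hz
    refine ContMDiffAt.contDiffAt (he.contMDiffAt.comp z ?_)
    exact (contMDiffOn_extChartAt_symm (v x)).contMDiffAt (mem_interior_iff_mem_nhds.1 hz)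
  have h2 := ConvC.comp_left (g := extChartAt J (v x) ∘ v) h1 (h.conv _ hs n)
  refine h2.congr ?_ ?_
  · filter_upwards [h.mem_source _ hs] with p hp
    simp only [Function.comp_apply]
    rw [(extChartAt J (v x)).left_inv (by rwa [extChartAt_source])]
  · filter_upwards [h.smooth_limit.continuousAt.preimage_mem_nhds
      (extChartAt_source_mem_nhds (I := J) (v x))] with y hy
    simp only [Function.comp_apply]
    rw [(extChartAt J (v x)).left_inv hy]

end ConvInto

/-- Uniform convergence on a closed ball around `x`, together with continuity of the limiting
derivatives, gives the joint limit. -/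
theorem SmoothlyConvergesOn.convInto [IsManifold J ∞ M] {U : Set 𝔼} {f : ℕ → 𝔼 → M} {v : 𝔼 → M}
    (hU : IsOpen U) (h : SmoothlyConvergesOn (𝓡 m) J U f v)
    (hf : ∀ k, ContMDiffOn (𝓡 m) J ∞ (f k) U) {x : 𝔼} (hx : x ∈ U) : ConvInto J atTop f v x := by
  have hvs : ContMDiffAt (𝓡 m) J ∞ v x := h.1.contMDiffAt (hU.mem_nhds hx)
  have key : ∀ q, v x ∈ (chartAt G q).source → ∃ L ∈ 𝓝 x, L ⊆ U ∧
      MapsTo v L (chartAt G q).source ∧ (∀ᶠ k in atTop, MapsTo (f k) L (chartAt G q).source) ∧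
      ∀ j : ℕ, TendstoUniformlyOn (fun k => iteratedFDeriv ℝ j (extChartAt J q ∘ f k))
        (iteratedFDeriv ℝ j (extChartAt J q ∘ v)) atTop L := by
    intro q hq
    have hW : U ∩ v ⁻¹' (chartAt G q).source ∈ 𝓝 x := inter_mem (hU.mem_nhds hx)
      (hvs.continuousAt.preimage_mem_nhds ((chartAt G q).open_source.mem_nhds hq))
    obtain ⟨δ, hδ, hL⟩ := Metric.nhds_basis_closedBall.mem_iff.1 hW
    refine ⟨Metric.closedBall x δ, Metric.closedBall_mem_nhds x hδ, fun y hy => (hL hy).1,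
      fun y hy => (hL hy).2, ?_⟩
    have h1 := h.2 x q (Metric.closedBall x δ) (isCompact_closedBall x δ) (fun y hy => (hL hy).1)
      (by rw [chartAt_self_eq]; exact subset_univ _) (fun y hy => (hL hy).2)
    refine ⟨h1.1, fun j => ?_⟩
    have h2 := h1.2 j
    simp only [extChartAt_self_eq, modelWithCornersSelf_coe, range_id,
      iteratedFDerivWithin_univ] at h2
    have e1 : ∀ g : 𝔼 → M, extChartAt J q ∘ g ∘ (extChartAt (𝓡 m) x).symm
        = extChartAt J q ∘ g := fun g => by
      ext1 y
      simp only [extChartAt, Function.comp_apply, chartAt_self_eq]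
      rfl
    simp only [e1, image_id] at h2
    exact h2
  have sm : ∀ q, ∀ g : 𝔼 → M, ∀ y ∈ U, ContMDiffOn (𝓡 m) J ∞ g U → g y ∈ (chartAt G q).source →
      ContDiffAt ℝ ∞ (extChartAt J q ∘ g) y := fun q g y hy hg hgy =>
    ContMDiffAt.contDiffAt ((contMDiffAt_extChartAt' hgy).comp y (hg.contMDiffAt (hU.mem_nhds hy)))
  refine ⟨hvs, fun q hq => ?_, fun q hq n => ?_⟩
  · obtain ⟨L, hL, -, -, h1, -⟩ := key q hq
    filter_upwards [prod_mem_prod h1 hL] with p hp using hp.1 hp.2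
  · obtain ⟨L, hL, hLU, hvL, h1, h2⟩ := key q hq
    have hsl : ∀ᶠ y in 𝓝 x, ContDiffAt ℝ ∞ (extChartAt J q ∘ v) y := by
      filter_upwards [hL] with y hy using sm q v y (hLU hy) h.1 (hvL hy)
    refine ⟨?_, hsl, fun j hj => ?_⟩
    · filter_upwards [prod_mem_prod h1 hL] with p hp
        using sm q _ p.2 (hLU hp.2) (hf p.1) (hp.1 hp.2)
    · have hc : ContinuousAt (iteratedFDeriv ℝ j (extChartAt J q ∘ v)) x := by
        exact (hsl.self_of_nhds.iteratedFDeriv_right (m := 0) (i := j) (by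
          norm_cast; exact le_top)).continuousAt
      refine Metric.tendsto_nhds.2 fun ε hε => ?_
      have a := Metric.tendstoUniformlyOn_iff.1 (h2 j) (ε / 2) (half_pos hε)
      have b := Metric.tendsto_nhds.1 hc.tendsto (ε / 2) (half_pos hε)
      filter_upwards [prod_mem_prod a (inter_mem hL b)] with p hp
      have a' := hp.1 p.2 hp.2.1
      have b' : dist _ _ < ε / 2 := hp.2.2
      rw [dist_comm] at a'
      exact (dist_triangle _ _ _).trans_lt (by linarith)

end ConvergenceInManifolds

/-! ### From local convergence to convergence on a manifold with boundary. -/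

section LocalLimit

variable {m d : ℕ} {G M Ht St : Type*} [TopologicalSpace G]
  [TopologicalSpace M] [ChartedSpace G M] {J : ModelWithCorners ℝ (EuclideanSpace ℝ (Fin d)) G}
  [TopologicalSpace Ht] [TopologicalSpace St] [ChartedSpace Ht St]
  {It : ModelWithCorners ℝ (EuclideanSpace ℝ (Fin m)) Ht}

local notation "𝔼" => EuclideanSpace ℝ (Fin m)

/-- A sequence of maps that converges locally, in extended charts, converges. -/
theorem exists_smoothlyConvergesOn_of_local [T2Space M] [IsManifold It ∞ St] [IsManifold J ∞ M]
    {F : ℕ → St → M}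
    (h : ∀ p : St, ∀ z ∈ (extChartAt It p).target, ∃ (f : ℕ → 𝔼 → M) (g : 𝔼 → M),
      ∀ᶠ z' in 𝓝 z, ConvInto J atTop f g z' ∧
        (z' ∈ (extChartAt It p).target → ∀ k, F k ((extChartAt It p).symm z') = f k z')) :
    ∃ v, SmoothlyConvergesOn It J univ F v := by
  have hv : ∀ x, ∃ y, Tendsto (fun k => F k x) atTop (𝓝 y) := fun x => by
    obtain ⟨f, g, hfg⟩ := h x _ (mem_extChartAt_target x)
    obtain ⟨h1, h2⟩ := hfg.self_of_nhds
    have h3 := h2 (mem_extChartAt_target x)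
    rw [extChartAt_to_inv] at h3
    exact ⟨_, h1.tendsto_apply.congr fun k => (h3 k).symm⟩
  choose v hv using hv
  have h' : ∀ p : St, ∀ z ∈ (extChartAt It p).target, ∃ (f : ℕ → 𝔼 → M) (g : 𝔼 → M),
      ∀ᶠ z' in 𝓝 z, ConvInto J atTop f g z' ∧ (z' ∈ (extChartAt It p).target →
        (∀ k, F k ((extChartAt It p).symm z') = f k z') ∧
          v ((extChartAt It p).symm z') = g z') := fun p z hz => by
    obtain ⟨f, g, hfg⟩ := h p z hz
    refine ⟨f, g, hfg.mono fun z' hz' => ⟨hz'.1, fun ht => ⟨hz'.2 ht, ?_⟩⟩⟩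
    exact tendsto_nhds_unique (hv _)
      (hz'.1.tendsto_apply.congr fun k => (hz'.2 ht k).symm)
  refine ⟨v, contMDiffOn_univ.2 fun x => ?_, fun p q L hL _ hLp hLq => ?_⟩
  · obtain ⟨f, g, hfg⟩ := h' x _ (mem_extChartAt_target x)
    have h1 : ContMDiffAt It J ∞ (g ∘ extChartAt It x) x :=
      hfg.self_of_nhds.1.smooth_limit.comp x contMDiffAt_extChartAt
    refine h1.congr_of_eventuallyEq ?_
    filter_upwards [(continuousAt_extChartAt x).eventually hfg,
      extChartAt_source_mem_nhds (I := It) x] with y hy hys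
    have := (hy.2 ((extChartAt It x).map_source hys)).2
    rwa [(extChartAt It x).left_inv hys] at this
  have hsrc : L ⊆ (extChartAt It p).source := by rwa [extChartAt_source]
  have hLt : ∀ z ∈ extChartAt It p '' L, z ∈ (extChartAt It p).target := by
    rintro _ ⟨y, hy, rfl⟩; exact (extChartAt It p).map_source (hsrc hy)
  have hLc : IsCompact (extChartAt It p '' L) :=
    hL.image_of_continuousOn ((continuousOn_extChartAt p).mono hsrc)
  have hvq : ∀ z ∈ extChartAt It p '' L, v ((extChartAt It p).symm z) ∈ (chartAt G q).source := by
    rintro _ ⟨y, hy, rfl⟩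
    rw [(extChartAt It p).left_inv (hsrc hy)]; exact hLq hy
  constructor
  · have := eventually_forall_mem_of_isCompact (l := atTop) (p := fun k z =>
      z ∈ (extChartAt It p).target → F k ((extChartAt It p).symm z) ∈ (chartAt G q).source)
      hLc fun z hz => by
        obtain ⟨f, g, hfg⟩ := h' p z (hLt z hz)
        have e := (hfg.self_of_nhds.2 (hLt z hz)).2
        filter_upwards [hfg.self_of_nhds.1.mem_source q (e ▸ hvq z hz),
          tendsto_snd.eventually hfg] with a ha hb ht
        rwa [(hb.2 ht).1]
    filter_upwards [this] with k hk y hy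
    have := hk _ (mem_image_of_mem _ hy) (hLt _ (mem_image_of_mem _ hy))
    rwa [(extChartAt It p).left_inv (hsrc hy)] at this
  · intro j
    -- On a compact set locally uniform convergence suffices, and that amounts to a joint limit at
    -- each point.
    rw [← tendstoLocallyUniformlyOn_iff_tendstoUniformlyOn_of_compact hLc]
    refine tendstoLocallyUniformlyOn_iff_forall_tendsto.2 fun z hz => ?_
    obtain ⟨f, g, hfg⟩ := h' p z (hLt z hz)
    have hC := hfg.self_of_nhds.1
    have e := (hfg.self_of_nhds.2 (hLt z hz)).2
    have hc := hC.conv q (e ▸ hvq z hz) j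
    have h1 := hc.tendsto j le_rfl
    have h2 : Tendsto (fun a : ℕ × 𝔼 => iteratedFDeriv ℝ j (extChartAt J q ∘ g) a.2)
        (atTop ×ˢ 𝓝 z) (𝓝 (iteratedFDeriv ℝ j (extChartAt J q ∘ g) z)) :=
      (ConvC.const hc.smooth_limit).tendsto j le_rfl
    have h3 := (h2.prodMk_nhds h1).mono_right
      (nhds_le_uniformity (iteratedFDeriv ℝ j (extChartAt J q ∘ g) z))
    refine (h3.mono_left (prod_mono le_rfl nhdsWithin_le_nhds)).congr' ?_
    have hw : ∀ᶠ a : ℕ × 𝔼 in (atTop : Filter ℕ) ×ˢ 𝓝[extChartAt It p '' L] z, a.2 ∈ extChartAt It p '' L :=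
      tendsto_snd.eventually eventually_mem_nhdsWithin
    have hle : (atTop : Filter ℕ) ×ˢ 𝓝[extChartAt It p '' L] z ≤ atTop ×ˢ 𝓝 z :=
      prod_mono le_rfl nhdsWithin_le_nhds
    -- Unique differentiability of the range lets derivatives within it be computed from a smooth
    -- extension, also at boundary points.
    have aux : ∀ (A : St → M) (B : 𝔼 → M) (z' : 𝔼), z' ∈ (extChartAt It p).target →
        (∀ᶠ y in 𝓝 z', y ∈ (extChartAt It p).target → A ((extChartAt It p).symm y) = B y) →
        ContDiffAt ℝ ∞ (extChartAt J q ∘ B) z' →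
        iteratedFDeriv ℝ j (extChartAt J q ∘ B) z' =
          iteratedFDerivWithin ℝ j (extChartAt J q ∘ A ∘ (extChartAt It p).symm) (range It) z' := by
      intro A B z' hz' hAB hB
      have hzr : z' ∈ range It := extChartAt_target_subset_range p hz'
      rw [← iteratedFDerivWithin_eq_iteratedFDeriv It.uniqueDiffOn (hB.of_le (by exact_mod_cast le_top)) hzr]
      refine Filter.EventuallyEq.iteratedFDerivWithin_eq ?_ ?_ j
      · filter_upwards [nhdsWithin_le_nhds hAB, extChartAt_target_mem_nhdsWithin_of_mem hz'] with
          y hy hyt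
        simp only [Function.comp_apply, hy hyt]
      · simp only [Function.comp_apply, hAB.self_of_nhds hz']
    filter_upwards [hle (tendsto_snd.eventually hfg.eventually_nhds), hw, hle hc.smooth,
      hle (tendsto_snd.eventually hc.smooth_limit)] with a ha haL hs hs'
    rw [aux v g a.2 (hLt _ haL) (ha.mono fun y hy hyt => (hy.2 hyt).2) hs',
      aux (F a.1) (f a.1) a.2 (hLt _ haL) (ha.mono fun y hy hyt => (hy.2 hyt).1 a.1) hs]

end LocalLimit

/-! ### A Euclidean-valued map that is immersive on a compact set. -/

section Immersion

variable {d : ℕ} {G M : Type*} [TopologicalSpace G] [TopologicalSpace M] [ChartedSpace G M]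

/-- Only finitely many bump functions meet `K`. Near a point of `K` one of them equals 1, and the
corresponding component of the map is then a chart. -/
theorem exists_contMDiff_injective_mfderiv (J : ModelWithCorners ℝ (EuclideanSpace ℝ (Fin d)) G)
    [IsManifold J ∞ M] [T2Space M] [SecondCountableTopology M] {K : Set M} (hK : IsCompact K) :
    ∃ (N : ℕ) (e : M → EuclideanSpace ℝ (Fin N)), ContMDiff J 𝓘(ℝ, EuclideanSpace ℝ (Fin N)) ∞ e ∧
      ∀ x ∈ K, Function.Injective (mfderiv J 𝓘(ℝ, EuclideanSpace ℝ (Fin N)) e x) := by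
  have := Manifold.locallyCompact_of_finiteDimensional (M := M) J
  obtain ⟨ι, f, -⟩ := SmoothBumpCovering.exists_isSubordinate J hK.isClosed
    fun (x : M) _ => univ_mem
  have hfin : {i | (Function.support (f i) ∩ K).Nonempty}.Finite :=
    f.locallyFinite.finite_nonempty_inter_compact hK
  have := hfin.fintype
  set W := {i | (Function.support (f i) ∩ K).Nonempty} → EuclideanSpace ℝ (Fin d) × ℝ
  let F : M → W := fun x i => (f i x • extChartAt J (f.c i) x, f i x)
  have hF : ContMDiff J 𝓘(ℝ, W) ∞ F := contMDiff_pi_space.2 fun i =>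
    ((f i).contMDiff_smul contMDiffOn_extChartAt).prodMk_space (f i).contMDiff
  have hFi : ∀ x ∈ K, Function.Injective (mfderiv J 𝓘(ℝ, W) F x) := fun x hx => by
    let i : {i | (Function.support (f i) ∩ K).Nonempty} := ⟨f.ind x hx, x, by
      rw [Function.mem_support, f.apply_ind x hx]; exact one_ne_zero, hx⟩
    let L := (ContinuousLinearMap.fst ℝ (EuclideanSpace ℝ (Fin d)) ℝ).comp
      (ContinuousLinearMap.proj (R := ℝ)
        (φ := fun _ : {i | (Function.support (f i) ∩ K).Nonempty} =>
          EuclideanSpace ℝ (Fin d) × ℝ) i)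
    have h1 := L.hasMFDerivAt.comp x (hF.mdifferentiableAt (by simp)).hasMFDerivAt
    have h2 := (hasMFDerivAt_extChartAt (I := J)
      (f.mem_chartAt_ind_source x hx)).congr_of_eventuallyEq (f₁ := L ∘ F) (by
        filter_upwards [f.eventuallyEq_one x hx] with y hy
        change f (f.ind x hx) y • extChartAt J (f.c (f.ind x hx)) y = _
        rw [hy, Pi.one_apply, one_smul])
    have h3 := hasMFDerivAt_unique h1 h2
    have h4 := (mdifferentiable_chart (I := J) (f.c (f.ind x hx))).mfderiv_injective
      (f.mem_chartAt_ind_source x hx)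
    rw [← h3] at h4
    exact Function.Injective.of_comp (f := L) (g := mfderiv J 𝓘(ℝ, W) F x) h4
  set V := EuclideanSpace ℝ (Fin (Module.finrank ℝ W))
  let L : W ≃L[ℝ] V := ContinuousLinearEquiv.ofFinrankEq finrank_euclideanSpace_fin.symm
  refine ⟨_, L ∘ F, L.toDiffeomorph.contMDiff.comp hF, fun x hx => ?_⟩
  rw [mfderiv_comp _ L.differentiableAt.mdifferentiableAt (hF.mdifferentiableAt (by simp)),
    L.mfderiv_eq]
  exact L.injective.comp (hFi x hx)

end Immersion

/-! ### Rescaling an immersion to near isometries. -/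

section Scale

open Metric

variable {m : ℕ} {V : Type} [NormedAddCommGroup V] [InnerProductSpace ℝ V]
  [FiniteDimensional ℝ V]

local notation "𝔼" => EuclideanSpace ℝ (Fin m)

/-- Pull an orthonormal basis of the range back through `T`. -/
theorem exists_equiv_isometry {T : 𝔼 →L[ℝ] V} (hT : Function.Injective T) :
    ∃ (B : 𝔼 ≃L[ℝ] 𝔼) (A : 𝔼 →ₗᵢ[ℝ] V), ∀ z, T (B z) = A z := by
  let e := LinearEquiv.ofInjective (T : 𝔼 →ₗ[ℝ] V) hT
  have hr : Module.finrank ℝ (LinearMap.range (T : 𝔼 →ₗ[ℝ] V)) = m := by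
    rw [← e.finrank_eq, finrank_euclideanSpace_fin]
  let b := (stdOrthonormalBasis ℝ (LinearMap.range (T : 𝔼 →ₗ[ℝ] V))).reindex (finCongr hr)
  refine ⟨(b.repr.symm.toLinearEquiv.trans e.symm).toContinuousLinearEquiv,
    (LinearMap.range (T : 𝔼 →ₗ[ℝ] V)).subtypeₗᵢ.comp b.repr.symm.toLinearIsometry, fun z => ?_⟩
  change ((e (e.symm (b.repr.symm z)) : LinearMap.range (T : 𝔼 →ₗ[ℝ] V)) : V) = b.repr.symm z
  rw [e.apply_symm_apply]

theorem exists_antilipschitz_of_isCompact {P : Set 𝔼} (hP : IsCompact P) {T : 𝔼 → 𝔼 →L[ℝ] V}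
    (hT : ContinuousOn T P) (hinj : ∀ p ∈ P, Function.Injective (T p)) :
    ∃ c > 0, ∀ p ∈ P, ∀ h, c * ‖h‖ ≤ ‖T p h‖ := by
  have hc : ContinuousOn (fun a : 𝔼 × 𝔼 => ‖T a.1 a.2‖) (P ×ˢ sphere 0 1) :=
    ((hT.comp continuousOn_fst fun a ha => ha.1).clm_apply continuousOn_snd).norm
  have hpos : ∃ c > 0, ∀ a ∈ P ×ˢ sphere (0 : 𝔼) 1, c ≤ ‖T a.1 a.2‖ := by
    rcases (P ×ˢ sphere (0 : 𝔼) 1).eq_empty_or_nonempty with h0 | h0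
    · exact ⟨1, one_pos, by simp [h0]⟩
    · obtain ⟨a, ha, hmin⟩ := (hP.prod (isCompact_sphere 0 1)).exists_isMinOn h0 hc
      refine ⟨_, norm_pos_iff.2 fun h => ?_, hmin⟩
      have : a.2 = 0 := hinj _ ha.1 (by rw [h, map_zero])
      have h1 := ha.2
      rw [this] at h1
      simp at h1
  obtain ⟨c, hc, h⟩ := hpos
  refine ⟨c, hc, fun p hp z => ?_⟩
  rcases eq_or_ne z 0 with rfl | hz
  · simp
  · have hz' : 0 < ‖z‖ := norm_pos_iff.2 hz
    have h1 := h (p, ‖z‖⁻¹ • z) ⟨hp, by simp [norm_smul, hz'.ne']⟩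
    rw [map_smul, norm_smul, norm_inv, norm_norm] at h1
    calc c * ‖z‖ ≤ ‖z‖⁻¹ * ‖T p z‖ * ‖z‖ := by gcongr
      _ = ‖T p z‖ := by field_simp

theorem nearIsometry_of_fderiv_fderiv {A : 𝔼 →ₗᵢ[ℝ] V} {R : ℝ} {f : 𝔼 → V}
    (hs : ∀ z ∈ ball (0 : 𝔼) R, ContDiffAt ℝ ∞ f z)
    (h1 : ∀ z ∈ ball (0 : 𝔼) R, ‖fderiv ℝ f z - A.toContinuousLinearMap‖ ≤ 1 / 100)
    (h2 : ∀ z ∈ ball (0 : 𝔼) R, ‖fderiv ℝ (fderiv ℝ f) z‖ ≤ 1 / 100) : NearIsometry A R f where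
  smooth := hs
  near := h1
  lip := fun z hz z' hz' => (convex_ball 0 R).norm_image_sub_le_of_norm_fderiv_le
    (fun y hy => ((hs y hy).fderiv_right (m := ∞) (by simp)).differentiableAt (by simp)) h2 hz' hz

theorem fderiv_rescale {g : 𝔼 → V} {B : 𝔼 ≃L[ℝ] 𝔼} {p z : 𝔼} {ρ : ℝ} (hρ : ρ ≠ 0)
    (hg : DifferentiableAt ℝ g (p + ρ • B z)) :
    fderiv ℝ (fun z => ρ⁻¹ • g (p + ρ • B z)) z
      = (fderiv ℝ g (p + ρ • B z)).comp (B : 𝔼 →L[ℝ] 𝔼) := by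
  have h1 : HasFDerivAt (fun z => p + ρ • B z) (ρ • (B : 𝔼 →L[ℝ] 𝔼)) z :=
    (B.hasFDerivAt.const_smul ρ).const_add p
  have h2 : HasFDerivAt (fun z => ρ⁻¹ • g (p + ρ • B z)) _ z :=
    (hg.hasFDerivAt.comp z h1).const_smul ρ⁻¹
  rw [h2.fderiv, ContinuousLinearMap.comp_smul, smul_smul, inv_mul_cancel₀ hρ, one_smul]

/-- Each of the two derivatives contributes a factor `ρ`, and the prefactor cancels only one. -/
theorem norm_fderiv_fderiv_rescale_le {g : 𝔼 → V} {B : 𝔼 ≃L[ℝ] 𝔼} {p z : 𝔼} {ρ C b : ℝ}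
    (hρ : 0 < ρ) (hb : 0 ≤ b)
    (hg : ∀ᶠ y in 𝓝 (p + ρ • B z), ContDiffAt ℝ ∞ g y)
    (hC : ‖fderiv ℝ (fderiv ℝ g) (p + ρ • B z)‖ ≤ C) (hB : ‖(B : 𝔼 →L[ℝ] 𝔼)‖ ≤ b) :
    ‖fderiv ℝ (fderiv ℝ (fun z => ρ⁻¹ • g (p + ρ • B z))) z‖ ≤ ρ * C * b ^ 2 := by
  have h1 : HasFDerivAt (fun z => p + ρ • B z) (ρ • (B : 𝔼 →L[ℝ] 𝔼)) z :=
    (B.hasFDerivAt.const_smul ρ).const_add p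
  have h2 : fderiv ℝ (fun z => ρ⁻¹ • g (p + ρ • B z)) =ᶠ[𝓝 z]
      fun z => (ContinuousLinearMap.compL ℝ 𝔼 𝔼 V).flip (B : 𝔼 →L[ℝ] 𝔼)
        (fderiv ℝ g (p + ρ • B z)) := by
    filter_upwards [h1.continuousAt.eventually hg] with y hy
    exact fderiv_rescale hρ.ne' (hy.differentiableAt (by simp))
  have h3 : HasFDerivAt (fderiv ℝ g) (fderiv ℝ (fderiv ℝ g) (p + ρ • B z)) (p + ρ • B z) :=
    ((hg.self_of_nhds.fderiv_right (m := ∞) (by simp)).differentiableAt (by simp)).hasFDerivAt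
  have hC0 : 0 ≤ C := le_trans (by positivity) hC
  have h4 : HasFDerivAt (fun z => (ContinuousLinearMap.compL ℝ 𝔼 𝔼 V).flip (B : 𝔼 →L[ℝ] 𝔼)
      (fderiv ℝ g (p + ρ • B z))) _ z :=
    ((ContinuousLinearMap.compL ℝ 𝔼 𝔼 V).flip (B : 𝔼 →L[ℝ] 𝔼)).hasFDerivAt.comp z (h3.comp z h1)
  rw [h2.fderiv_eq, h4.fderiv]
  refine ContinuousLinearMap.opNorm_le_bound _ (by positivity) fun x => ?_
  refine ContinuousLinearMap.opNorm_le_bound _ (by positivity) fun y => ?_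
  change ‖fderiv ℝ (fderiv ℝ g) (p + ρ • B z) (ρ • B x) (B y)‖ ≤ _
  have hBx : ∀ x, ‖B x‖ ≤ b * ‖x‖ := fun x =>
    ((B : 𝔼 →L[ℝ] 𝔼).le_opNorm x).trans (by gcongr)
  calc _ ≤ ‖fderiv ℝ (fderiv ℝ g) (p + ρ • B z)‖ * ‖ρ • B x‖ * ‖B y‖ :=
        ContinuousLinearMap.le_opNorm₂ _ _ _
    _ ≤ C * (ρ * (b * ‖x‖)) * (b * ‖y‖) := by
        rw [norm_smul, Real.norm_of_nonneg hρ.le]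
        gcongr
        · exact hBx x
        · exact hBx y
    _ = _ := by ring

/-- After rescaling, an immersion is close to linear isometries, uniformly on compact sets. -/
theorem exists_scale {g : 𝔼 → V} {O P : Set 𝔼} (hO : IsOpen O) (hg : ContDiffOn ℝ ∞ g O)
    (hinj : ∀ p ∈ P, Function.Injective (fderiv ℝ g p)) (hP : IsCompact P) (hPO : P ⊆ O)
    {η R : ℝ} (hη : 0 < η) (hR : 0 < R) :
    ∃ ρ₀ > (0 : ℝ), ∀ ρ : ℝ, 0 < ρ → ρ ≤ ρ₀ → ∀ p ∈ P, ∃ (A : 𝔼 →ₗᵢ[ℝ] V) (B : 𝔼 ≃L[ℝ] 𝔼),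
      ∀ z ∈ closedBall (0 : 𝔼) R, p + ρ • B z ∈ O ∧
        ‖fderiv ℝ (fun z => ρ⁻¹ • g (p + ρ • B z)) z - A.toContinuousLinearMap‖ ≤ η ∧
        ‖fderiv ℝ (fderiv ℝ (fun z => ρ⁻¹ • g (p + ρ • B z))) z‖ ≤ η := by
  have hgO : ∀ y ∈ O, ContDiffAt ℝ ∞ g y := fun y hy => hg.contDiffAt (hO.mem_nhds hy)
  have hg1 : ∀ y ∈ O, ContDiffAt ℝ ∞ (fderiv ℝ g) y := fun y hy =>
    (hgO y hy).fderiv_right (by simp)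
  have hg2 : ∀ y ∈ O, ContDiffAt ℝ ∞ (fderiv ℝ (fderiv ℝ g)) y := fun y hy =>
    (hg1 y hy).fderiv_right (by simp)
  obtain ⟨c, hc, hcP⟩ := exists_antilipschitz_of_isCompact hP
    (fun y hy => (hg1 y (hPO hy)).continuousAt.continuousWithinAt) hinj
  obtain ⟨δ, hδ, hδO⟩ := hP.exists_cthickening_subset_open hO hPO
  obtain ⟨C', hC'⟩ := (hP.cthickening (r := δ)).exists_bound_of_continuousOn
    (f := fderiv ℝ (fderiv ℝ g))
    fun y hy => (hg2 y (hδO hy)).continuousAt.continuousWithinAt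
  set C := max C' 1
  have hC1 : 0 < C := lt_max_of_lt_right one_pos
  -- In this order, the bounds keep the rescaled points in the `δ`-thickening of `P`, the first
  -- derivative near `A`, and the second derivative small; the norm of `B` is at most `c⁻¹`.
  refine ⟨min (δ * c / R) (min (η * c ^ 2 / (C * R)) (η * c ^ 2 / C)), by positivity,
    fun ρ hρ hρ₀ p hp => ?_⟩
  have hr1 : ρ * R / c ≤ δ := by
    have := hρ₀.trans (min_le_left _ _)
    rw [le_div_iff₀ hR] at this
    rwa [div_le_iff₀ hc]
  have hr2 : ρ * C * R / c ^ 2 ≤ η := by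
    have := hρ₀.trans ((min_le_right _ _).trans (min_le_left _ _))
    rw [le_div_iff₀ (by positivity)] at this
    rw [div_le_iff₀ (by positivity)]; linarith
  have hr3 : ρ * C * c⁻¹ ^ 2 ≤ η := by
    have := hρ₀.trans ((min_le_right _ _).trans (min_le_right _ _))
    rw [le_div_iff₀ (by positivity)] at this
    rw [inv_pow, ← div_eq_mul_inv, div_le_iff₀ (by positivity)]; linarith
  obtain ⟨B, A, hAB⟩ := exists_equiv_isometry (hinj p hp)
  have hBz : ∀ z, ‖B z‖ ≤ c⁻¹ * ‖z‖ := fun z => by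
    have := hcP p hp (B z)
    rw [hAB, A.norm_map] at this
    rw [← div_eq_inv_mul, le_div_iff₀ hc]; linarith
  have hB : ‖(B : 𝔼 →L[ℝ] 𝔼)‖ ≤ c⁻¹ :=
    ContinuousLinearMap.opNorm_le_bound _ (by positivity) hBz
  have hmem : ∀ z ∈ closedBall (0 : 𝔼) R, ‖ρ • B z‖ ≤ ρ * R / c := fun z hz => by
    rw [mem_closedBall_zero_iff] at hz
    rw [norm_smul, Real.norm_of_nonneg hρ.le]
    calc ρ * ‖B z‖ ≤ ρ * (c⁻¹ * R) := by gcongr; exact (hBz z).trans (by gcongr)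
      _ = _ := by ring
  have hsub : closedBall p δ ⊆ cthickening δ P := closedBall_subset_cthickening hp δ
  have hmem' : ∀ z ∈ closedBall (0 : 𝔼) R, p + ρ • B z ∈ closedBall p δ := fun z hz => by
    rw [mem_closedBall_iff_norm, add_sub_cancel_left]
    exact (hmem z hz).trans hr1
  refine ⟨A, B, fun z hz => ⟨hδO (hsub (hmem' z hz)), ?_, ?_⟩⟩
  · have hzO := hδO (hsub (hmem' z hz))
    rw [fderiv_rescale hρ.ne' ((hgO _ hzO).differentiableAt (by simp))]
    have e : A.toContinuousLinearMap = (fderiv ℝ g p).comp (B : 𝔼 →L[ℝ] 𝔼) := by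
      ext1 y; exact (hAB y).symm
    rw [e, ← ContinuousLinearMap.sub_comp]
    have h1 : ‖fderiv ℝ g (p + ρ • B z) - fderiv ℝ g p‖ ≤ C * ‖p + ρ • B z - p‖ :=
      (convex_closedBall p δ).norm_image_sub_le_of_norm_fderiv_le
        (fun y hy => (hg1 y (hδO (hsub hy))).differentiableAt (by simp))
        (fun y hy => (hC' y (hsub hy)).trans (le_max_left _ _))
        (mem_closedBall_self hδ.le) (hmem' z hz)
    rw [add_sub_cancel_left] at h1
    calc _ ≤ ‖fderiv ℝ g (p + ρ • B z) - fderiv ℝ g p‖ * ‖(B : 𝔼 →L[ℝ] 𝔼)‖ :=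
          ContinuousLinearMap.opNorm_comp_le _ _
      _ ≤ (C * (ρ * R / c)) * c⁻¹ := by
          gcongr
          exact h1.trans (by gcongr; exact hmem z hz)
      _ = ρ * C * R / c ^ 2 := by field_simp
      _ ≤ η := hr2
  · refine (norm_fderiv_fderiv_rescale_le hρ (inv_nonneg.2 hc.le) ?_
      ((hC' _ (hsub (hmem' z hz))).trans (le_max_left _ _)) hB).trans hr3
    filter_upwards [hO.mem_nhds (hδO (hsub (hmem' z hz)))] with y hy using hgO y hy

end Scale

/-! ### Finitely many nearly isometric charts. -/

section Refinement

open Metric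

theorem eventually_near {m : ℕ} {V : Type} [NormedAddCommGroup V] [InnerProductSpace ℝ V]
    {ι : Type*} {l : Filter ι} {f : ι → EuclideanSpace ℝ (Fin m) → V}
    {g : EuclideanSpace ℝ (Fin m) → V} {x : EuclideanSpace ℝ (Fin m)}
    {A : EuclideanSpace ℝ (Fin m) →L[ℝ] V} (h : ConvC 2 l f g x)
    (h1 : ‖fderiv ℝ g x - A‖ ≤ 1 / 200) (h2 : ‖fderiv ℝ (fderiv ℝ g) x‖ ≤ 1 / 200) :
    ∀ᶠ q in l ×ˢ 𝓝 x, ContDiffAt ℝ ∞ (f q.1) q.2 ∧ ‖fderiv ℝ (f q.1) q.2 - A‖ ≤ 1 / 100 ∧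
      ‖fderiv ℝ (fderiv ℝ (f q.1)) q.2‖ ≤ 1 / 100 ∧ ‖f q.1 q.2 - g q.2‖ ≤ 1 / 200 := by
  have hg : Tendsto (fun q : ι × EuclideanSpace ℝ (Fin m) => g q.2) (l ×ˢ 𝓝 x) (𝓝 (g x)) :=
    h.smooth_limit.self_of_nhds.continuousAt.tendsto.comp tendsto_snd
  have t1 := (h.fderiv.apply.sub_const A).norm
  have t2 := h.fderiv.fderiv.apply.norm
  have t3 := (h.apply.sub hg).norm
  rw [sub_self, norm_zero] at t3
  filter_upwards [h.smooth, t1.eventually_lt_const (h1.trans_lt (by norm_num : _ < (1 : ℝ) / 100)),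
    t2.eventually_lt_const (h2.trans_lt (by norm_num : _ < (1 : ℝ) / 100)),
    t3.eventually_lt_const (by norm_num : (0 : ℝ) < 1 / 200)] with q a b c d
  exact ⟨a, b.le, c.le, d.le⟩

theorem image_rescale_ball_mem_nhds {m : ℕ} (p : EuclideanSpace ℝ (Fin m)) {ρ : ℝ} (hρ : 0 < ρ)
    (B : EuclideanSpace ℝ (Fin m) ≃L[ℝ] EuclideanSpace ℝ (Fin m)) :
    (fun z => p + ρ • B z) '' ball 0 1 ∈ 𝓝 p := by
  have hc : Continuous fun y => B.symm (ρ⁻¹ • (y - p)) := by fun_prop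
  have h0 : B.symm (ρ⁻¹ • (p - p)) ∈ ball (0 : EuclideanSpace ℝ (Fin m)) 1 := by simp
  filter_upwards [hc.continuousAt.preimage_mem_nhds (isOpen_ball.mem_nhds h0)] with y hy
  exact ⟨_, hy, by simp [smul_smul, hρ.ne']⟩

variable {d m : ℕ} {G M : Type*} [TopologicalSpace G] [TopologicalSpace M] [ChartedSpace G M]
  {J : ModelWithCorners ℝ (EuclideanSpace ℝ (Fin d)) G}
  {H S : ℕ → Type*} [∀ k, TopologicalSpace (H k)] [∀ k, TopologicalSpace (S k)]
  [∀ k, ChartedSpace (H k) (S k)] {I : ∀ k, ModelWithCorners ℝ (EuclideanSpace ℝ (Fin m)) (H k)}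

local notation "𝔼" => EuclideanSpace ℝ (Fin m)

/-- Finitely many small charts, close to linear isometries after an immersion `e` of the target,
whose images cover the preimages of a neighbourhood of `K`. -/
theorem exists_refinement [IsManifold J ∞ M] [T2Space M] [SecondCountableTopology M]
    {K : Set M} (hK : IsCompact K) (hKM : K ⊆ J.interior M) {u : ∀ k, S k → M}
    {n : ℕ} {r : ℝ} {φ : Fin n → ∀ k, 𝔼 → S k} (hc : IsUniformlyRobustCover J I K u n r φ)
    {v : Fin n → 𝔼 → M}
    (hv : ∀ i, SmoothlyConvergesOn (𝓡 m) J (ball 0 r) (fun k => u k ∘ φ i k) (v i))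
    (hinj : ∀ i, ∀ x ∈ ball (0 : 𝔼) r, Function.Injective (mfderiv (𝓡 m) J (v i) x)) :
    ∃ (Kt : Set M) (N : ℕ) (e : M → EuclideanSpace ℝ (Fin N)) (ι : Type)
      (A : ι → 𝔼 →ₗᵢ[ℝ] EuclideanSpace ℝ (Fin N)) (χ : ι → ∀ k, 𝔼 → S k) (v' : ι → 𝔼 → M),
      Finite ι ∧ IsCompact Kt ∧ Kt ⊆ J.interior M ∧ K ⊆ interior Kt ∧
      ContMDiff J 𝓘(ℝ, EuclideanSpace ℝ (Fin N)) ∞ e ∧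
      (∀ i k, ContMDiffOn (𝓡 m) (I k) ∞ (χ i k) (ball 0 12)) ∧
      (∀ i, ∀ z ∈ ball (0 : 𝔼) 12, ConvInto J atTop (fun k => u k ∘ χ i k) (v' i) z) ∧
      (∀ i, ∀ z ∈ ball (0 : 𝔼) 12, v' i z ∈ J.interior M) ∧
      (∀ i, NearIsometry (A i) 12 (e ∘ v' i)) ∧
      ∀ᶠ k in atTop, (∀ i, NearIsometry (A i) 12 (e ∘ u k ∘ χ i k)) ∧
        (∀ i, ∀ z ∈ ball (0 : 𝔼) 12, ‖e (u k (χ i k z)) - e (v' i z)‖ ≤ 1 / 200) ∧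
        u k ⁻¹' Kt ⊆ ⋃ i, χ i k '' ball 0 1 := by
  have := Manifold.locallyCompact_of_finiteDimensional (M := M) J
  obtain ⟨ε, hε, K₀, -, hKK₀, hrob⟩ := hc.robust
  -- The limits are controlled over `K₁`, while only preimages of the smaller `Kt` are covered; the
  -- gap absorbs the distance between the maps and their limits. Both sets lie in the interior of
  -- `M`, which `K₀` need not do.
  obtain ⟨K₁, hK₁, hKK₁, hK₁₀⟩ := exists_compact_between hK
    (isOpen_interior.inter (J.isOpen_interior (M := M) (n := ∞) (by simp))) (subset_inter hKK₀ hKM)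
  obtain ⟨Kt, hKt, hKKt, hKtK₁⟩ := exists_compact_between hK isOpen_interior hKK₁
  obtain ⟨N, e, he, hei⟩ := exists_contMDiff_injective_mfderiv J hK₁
  -- Robustness of the cover is needed at one radius only: it confines the parameters to a compact
  -- ball inside the domain of convergence.
  obtain ⟨r₁, hr₁, hr₁r⟩ : ∃ r₁, r - ε < r₁ ∧ r₁ < r := exists_between (by linarith)
  have hb : closedBall (0 : 𝔼) r₁ ⊆ ball 0 r := closedBall_subset_ball hr₁r
  have hsm : ∀ i k, ContMDiffOn (𝓡 m) J ∞ (u k ∘ φ i k) (ball 0 r) := fun i k =>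
    (hc.smooth k).comp_contMDiffOn (hc.smooth_cover i k)
  have hconv : ∀ i, ∀ x ∈ ball (0 : 𝔼) r, ConvInto J atTop (fun k => u k ∘ φ i k) (v i) x :=
    fun i x hx => (hv i).convInto isOpen_ball (hsm i) hx
  let P : Fin n → Set 𝔼 := fun i => closedBall 0 r₁ ∩ v i ⁻¹' K₁
  have hP : ∀ i, IsCompact (P i) := fun i =>
    (isCompact_closedBall (0 : 𝔼) r₁).of_isClosed_subset
      (((hv i).1.continuousOn.mono hb).preimage_isClosed_of_isClosed isClosed_closedBall
        hK₁.isClosed) inter_subset_left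
  let O : Fin n → Set 𝔼 := fun i => ball 0 r ∩ v i ⁻¹' J.interior M
  have hO : ∀ i, IsOpen (O i) := fun i =>
    (hv i).1.continuousOn.isOpen_inter_preimage isOpen_ball
      (J.isOpen_interior (n := ∞) (by simp))
  have hPO : ∀ i, P i ⊆ O i := fun i p hp => ⟨hb hp.1, (hK₁₀ hp.2).2⟩
  have hg : ∀ i, ContDiffOn ℝ ∞ (e ∘ v i) (O i) := fun i =>
    contMDiffOn_iff_contDiffOn.1 (he.comp_contMDiffOn ((hv i).1.mono inter_subset_left))
  have hgi : ∀ i, ∀ p ∈ P i, Function.Injective (fderiv ℝ (e ∘ v i) p) := fun i p hp => by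
    have hvp : MDifferentiableAt (𝓡 m) J (v i) p :=
      ((hv i).1.contMDiffAt (isOpen_ball.mem_nhds (hb hp.1))).mdifferentiableAt (by simp)
    rw [← mfderiv_eq_fderiv, mfderiv_comp p (he.mdifferentiableAt (by simp)) hvp]
    exact Function.Injective.comp (g := mfderiv J 𝓘(ℝ, EuclideanSpace ℝ (Fin N)) e (v i p))
      (hei _ hp.2) (hinj i p (hb hp.1))
  have hscale := fun i => exists_scale (hO i) (hg i) (hgi i) (hP i) (hPO i)
    (η := 1 / 200) (R := 12) (by norm_num) (by norm_num)
  choose ρ₀ hρ₀ hscale using hscale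
  -- A common `ρ` is required, since all charts must be compared through the same map `E`.
  obtain ⟨ρ, hρ⟩ := (eventually_all.2 fun i => Ioc_mem_nhdsGT (hρ₀ i) :
    ∀ᶠ ρ in 𝓝[>] (0 : ℝ), ∀ i, ρ ∈ Ioc 0 (ρ₀ i)).and self_mem_nhdsWithin |>.exists
  have hρ0 : 0 < ρ := hρ.2
  have hs := fun i => hscale i ρ hρ0 (hρ.1 i).2
  choose A B hAB using hs
  have hcov := fun i => (hP i).elim_nhds_subcover'
    (fun p hp => (fun z => p + ρ • B i p hp z) '' ball 0 1)
    fun p hp => image_rescale_ball_mem_nhds p hρ0 (B i p hp)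
  choose t ht using hcov
  let ι := Σ i : Fin n, {p : P i // p ∈ t i}
  let g : ι → 𝔼 → 𝔼 := fun a z => (a.2.1 : 𝔼) + ρ • B a.1 a.2.1 a.2.1.2 z
  let E : M → EuclideanSpace ℝ (Fin N) := fun x => ρ⁻¹ • e x
  have hE : ContMDiff J 𝓘(ℝ, EuclideanSpace ℝ (Fin N)) ∞ E :=
    ((contDiff_const_smul ρ⁻¹).contMDiff (n := ∞)).comp he
  have hgO : ∀ a, ∀ z ∈ closedBall (0 : 𝔼) 12, g a z ∈ O a.1 := fun a z hz =>
    (hAB a.1 a.2.1 a.2.1.2 z hz).1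
  have hgs : ∀ a, ContDiff ℝ ∞ (g a) := fun a =>
    contDiff_const.add ((B a.1 a.2.1 a.2.1.2).contDiff.const_smul ρ)
  have hconv' : ∀ a, ∀ z ∈ closedBall (0 : 𝔼) 12,
      ConvInto J atTop (fun k => u k ∘ φ a.1 k ∘ g a) (v a.1 ∘ g a) z := fun a z hz =>
    ConvInto.comp_contDiff (f := fun k => u k ∘ φ a.1 k) (hconv a.1 _ (hgO a z hz).1) (hgs a)
  have hCE : ∀ a, ∀ z ∈ closedBall (0 : 𝔼) 12, ∀ n,
      ConvC n atTop (fun k => E ∘ u k ∘ φ a.1 k ∘ g a) (E ∘ v a.1 ∘ g a) z := fun a z hz n =>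
    ConvInto.comp_left hE (hconv' a z hz) (hgO a z hz).2 n
  have hball : ball (0 : 𝔼) 12 ⊆ closedBall 0 12 := ball_subset_closedBall
  refine ⟨Kt, N, E, ι, fun a => A a.1 a.2.1 a.2.1.2, fun a k => φ a.1 k ∘ g a,
    fun a => v a.1 ∘ g a, inferInstance, hKt, fun x hx => (hK₁₀ (interior_subset (hKtK₁ hx))).2,
    hKKt, hE, fun a k => ?_, fun a z hz => hconv' a z (hball hz),
    fun a z hz => (hgO a z (hball hz)).2, fun a => ?_, ?_⟩
  · exact (hc.smooth_cover a.1 k).comp (hgs a).contMDiff.contMDiffOn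
      fun z hz => (hgO a z (hball hz)).1
  · refine nearIsometry_of_fderiv_fderiv
      (fun z hz => (hCE a z (hball hz) 0).smooth_limit.self_of_nhds) (fun z hz => ?_)
      fun z hz => ?_
    · exact (hAB a.1 a.2.1 a.2.1.2 z (hball hz)).2.1.trans (by norm_num)
    · exact (hAB a.1 a.2.1 a.2.1.2 z (hball hz)).2.2.trans (by norm_num)
  · have h1 : ∀ᶠ k in atTop, ∀ a : ι, ∀ z ∈ closedBall (0 : 𝔼) 12,
        ContDiffAt ℝ ∞ (E ∘ u k ∘ φ a.1 k ∘ g a) z ∧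
        ‖fderiv ℝ (E ∘ u k ∘ φ a.1 k ∘ g a) z
          - (A a.1 a.2.1 a.2.1.2).toContinuousLinearMap‖ ≤ 1 / 100 ∧
        ‖fderiv ℝ (fderiv ℝ (E ∘ u k ∘ φ a.1 k ∘ g a)) z‖ ≤ 1 / 100 ∧
        ‖(E ∘ u k ∘ φ a.1 k ∘ g a) z - (E ∘ v a.1 ∘ g a) z‖ ≤ 1 / 200 :=
      eventually_all.2 fun a => eventually_forall_mem_of_isCompact (isCompact_closedBall 0 12)
        fun z hz => eventually_near (hCE a z hz 2) (hAB a.1 a.2.1 a.2.1.2 z hz).2.1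
          (hAB a.1 a.2.1 a.2.1.2 z hz).2.2
    -- Where the limit value is not interior to `K₁` it lies outside the closed set `Kt`, and then
    -- so do the nearby values for large `k`.
    have h2 : ∀ᶠ k in atTop, ∀ i, ∀ p ∈ closedBall (0 : 𝔼) r₁,
        u k (φ i k p) ∈ Kt → v i p ∈ K₁ :=
      eventually_all.2 fun i => eventually_forall_mem_of_isCompact (isCompact_closedBall 0 r₁)
        fun p hp => by
          have hC := hconv i p (hb hp)
          by_cases hpK : v i p ∈ interior K₁
          · have : ∀ᶠ y in 𝓝 p, v i y ∈ interior K₁ :=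
              hC.smooth_limit.continuousAt.preimage_mem_nhds (isOpen_interior.mem_nhds hpK)
            filter_upwards [tendsto_snd.eventually this] with q hq _ using interior_subset hq
          · have : Ktᶜ ∈ 𝓝 (v i p) :=
              hKt.isClosed.isOpen_compl.mem_nhds fun h => hpK (hKtK₁ h)
            filter_upwards [hC.tendsto this] with q hq hq' using absurd hq' hq
    filter_upwards [h1, h2] with k hk1 hk2
    refine ⟨fun a => nearIsometry_of_fderiv_fderiv (fun z hz => (hk1 a z (hball hz)).1)
      (fun z hz => (hk1 a z (hball hz)).2.1) fun z hz => (hk1 a z (hball hz)).2.2.1,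
      fun a z hz => (hk1 a z (hball hz)).2.2.2, fun s hs => ?_⟩
    have hs' : s ∈ ⋃ i, φ i k '' ball 0 r₁ := by
      by_contra hns
      exact hrob k r₁ ⟨hr₁, hr₁r⟩ hns
        (interior_subset (hK₁₀ (interior_subset (hKtK₁ hs))).1)
    obtain ⟨i, p, hp, rfl⟩ := mem_iUnion.1 hs'
    have hpP : p ∈ P i := ⟨ball_subset_closedBall hp, hk2 i p (ball_subset_closedBall hp) hs⟩
    obtain ⟨q, hq, z, hz, rfl⟩ := mem_iUnion₂.1 (ht i hpP)
    exact mem_iUnion.2 ⟨⟨i, q, hq⟩, z, hz, rfl⟩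

end Refinement

/-! ### The subsequence and the conclusion. -/

section Main

open Metric

theorem exists_frequently_eq {α : Type*} [Finite α] (f : ℕ → α) : ∃ a, ∃ᶠ k in atTop, f k = a := by
  by_contra! h
  obtain ⟨k, hk⟩ := (eventually_all.2 h).exists
  exact hk (f k) rfl

end Main

end KConv

theorem mainTheorem9 {d m : ℕ}
    {G M : Type*} [TopologicalSpace G] [TopologicalSpace M] [ChartedSpace G M]
    (J : ModelWithCorners ℝ (EuclideanSpace ℝ (Fin d)) G) (hJ : KConv.IsHalfSpaceModel J)
    [IsManifold J ∞ M] [T2Space M] [SecondCountableTopology M]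
    {H S : ℕ → Type*} [∀ k, TopologicalSpace (H k)] [∀ k, TopologicalSpace (S k)]
    [∀ k, ChartedSpace (H k) (S k)]
    (I : ∀ k, ModelWithCorners ℝ (EuclideanSpace ℝ (Fin m)) (H k))
    (hI : ∀ k, KConv.IsHalfSpaceModel (I k))
    [∀ k, IsManifold (I k) ∞ (S k)] [∀ k, T2Space (S k)] [∀ k, SecondCountableTopology (S k)]
    (K : Set M) (hK : IsCompact K) (hKM : K ⊆ J.interior M)
    (u : ∀ k, S k → M)
    (hu : KConv.KlocConvergesToImmersed J I K u) :
    ∃ σ : ℕ → ℕ, StrictMono σ ∧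
      KConv.RobustlyConverges J (fun k => I (σ k)) K (fun k => u (σ k)) := by
  obtain ⟨n, r, φ, hc, hφ⟩ := hu
  choose v hv hinj using hφ
  obtain ⟨Kt, N, e, ι, A, χ, v', _, hKt, hKtM, hKKt, he, hχ, hconv, hint, hlim, hev⟩ :=
    KConv.exists_refinement hK hKM hc hv hinj
  -- There are finitely many overlap patterns, so one occurs infinitely often; the subsequence keeps
  -- it, together with the bounds valid for large `k`.
  obtain ⟨a, ha⟩ := KConv.exists_frequently_eq fun k =>
    {p : ι × ι | (χ p.1 k '' Metric.ball 0 3 ∩ χ p.2 k '' Metric.ball 0 3).Nonempty}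
  obtain ⟨σ, hσ, hgood⟩ := extraction_of_frequently_atTop (ha.and_eventually hev)
  refine ⟨σ, hσ, ?_⟩
  have hF : KConv.FramedSequence (fun k => I (σ k)) (fun k => e ∘ u (σ k)) A
      (fun i k => χ i (σ k)) (fun i => e ∘ v' i) :=
    { chart := fun i k => ⟨he.comp (hc.smooth _), hχ i _, (hgood k).2.1 i⟩
      limit := hlim
      close := fun i k l z hz => by
        have h1 := (hgood k).2.2.1 i z hz
        have h2 := (hgood l).2.2.1 i z hz
        rw [norm_sub_rev] at h2
        refine (norm_sub_le_norm_sub_add_norm_sub _ (e (v' i z)) _).trans ?_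
        simp only [Function.comp_apply]
        linarith
      close_limit := fun i k z hz => by
        rw [norm_sub_rev]
        exact ((hgood k).2.2.1 i z hz).trans (by norm_num)
      conv := fun i z hz n => KConv.ConvC.comp_tendsto (f := fun k => e ∘ u k ∘ χ i k)
        hσ.tendsto_atTop ((hconv i z hz).comp_left he (hint i z hz) n)
      pattern := fun i j k l h => by
        have h1 : (i, j) ∈ a := (hgood k).1 ▸ h
        have h2 := (hgood l).1.symm ▸ h1
        exact h2 }
  obtain ⟨Ht, St, _, _, _, It, hIt, hSt, hT2, hSC, hcomp, ψ, hψ, hψr, hψl⟩ := hF.exists_gluing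
  refine ⟨Kt, ⟨hKt, hKtM, hKKt, fun k Kh hKh hKhKt => ?_⟩, Ht, St, _, _, _, It, hIt, hSt, hT2, hSC,
    hcomp, ψ, hψ, fun k s hs hsK => hs ?_, KConv.exists_smoothlyConvergesOn_of_local fun p z hz => ?_⟩
  -- The preimage of `Kt` lies in this compact union and, by `IsFramedChart.isInteriorPoint`, misses
  -- the boundary. Removing the boundary therefore changes nothing, and preimages of compact subsets
  -- are closed in a compact set.
  · have hcpt : IsCompact (⋃ i, χ i (σ k) '' Metric.closedBall 0 1) := isCompact_iUnion fun i =>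
      (isCompact_closedBall _ _).image_of_continuousOn
        ((hχ i (σ k)).continuousOn.mono (Metric.closedBall_subset_ball (by norm_num)))
    refine hcpt.of_isClosed_subset ?_ ?_
    · have : u (σ k) ⁻¹' Kh \ (I (σ k)).boundary (S (σ k)) = u (σ k) ⁻¹' Kh := by
        refine sdiff_eq_left.2 (Set.disjoint_left.2 fun s hs => ?_)
        obtain ⟨i, z, hz, rfl⟩ := mem_iUnion.1 ((hgood k).2.2.2 (hKhKt hs))
        exact fun hbd => (ModelWithCorners.isInteriorPoint_iff_not_isBoundaryPoint _).1
          ((hF.chart i k).isInteriorPoint (Metric.ball_subset_ball (by norm_num) hz)) hbd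
      rw [this]
      exact hKh.isClosed.preimage (hc.smooth _).continuous
    · intro s hs
      obtain ⟨i, hi⟩ := mem_iUnion.1 ((hgood k).2.2.2 (hKhKt hs.1))
      exact mem_iUnion.2 ⟨i, image_mono Metric.ball_subset_closedBall hi⟩
  · obtain ⟨i, z, hz, rfl⟩ := mem_iUnion.1 ((hgood k).2.2.2 hsK)
    exact hψr i k (mem_image_of_mem _ hz)
  · obtain ⟨i, Θ, Θ', hΘ⟩ := hψl p z hz
    refine ⟨fun k => (u (σ k) ∘ χ i (σ k)) ∘ Θ k, v' i ∘ Θ', hΘ.mono fun z' hz' => ⟨?_, ?_⟩⟩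
    · exact KConv.ConvInto.comp (f := fun k => u (σ k) ∘ χ i (σ k))
        ((hconv i _ hz'.2.1).comp_tendsto hσ.tendsto_atTop) hz'.1
    · intro ht k
      exact congrArg (u (σ k)) (hz'.2.2 ht k)
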